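/- Let $d\ge 3$ and $1\le k\le d-1$. Write $\eta\in\mathbb R^d$ as $\eta=(\tilde\eta,\eta_d)$ with $\tilde\eta=(\eta_1,\eta',\eta'')\in\mathbb R\times\mathbb R^{k-1}\times\mathbb R^{d-k-1}$, and set $$\mathcal D=\{\tilde\eta:\ |\eta'|\le 1,\ |\eta''|\le 1,\ \eta_1\in[1,2]\},\qquad \mathcal G_\rho(\tilde\eta)=\frac{|\eta'|^2-|\eta''|^2+\rho}{2\eta_1}.$$ Let $\tilde\chi\in C^\infty(\mathbb R^{d-1})$ be supported in $\mathcal D$, let $m$ be a real-valued smooth function on $\mathcal D$ with $\frac12\le m\le 2$, and let $\psi\in\mathcal S(\mathbb R)$ be such that $\widehat\psi$ is supported in $[-2,-1/2]\cup[1/2,2]$, where $\widehat f(\xi)=\int e^{-2\pi i x\cdot\xi}f(x)\,dx$. For $\rho\in\mathbb R$ and $\lambda>0$ the symbol $\tilde\chi(\tilde\eta)\,\psi\big(\lambda^{-1}m(\tilde\eta)(\eta_d-\mathcal G_\rho(\tilde\eta))\big)$ (understood as $0$ for $\tilde\eta\notin\mathcal D$) is a smooth function on $\mathbb R^d$ all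 of whose derivatives grow at most polynomially, so that $$\widehat{\mathcal T^\rho_\lambda f}(\eta)=\tilde\chi(\tilde\eta)\,\psi\big(\lambda^{-1}m(\tilde\eta)(\eta_d-\mathcal G_\rho(\tilde\eta))\big)\,\widehat f(\eta)$$ defines an operator on tempered distributions. Moreover, for every $R>0$ there is a constant $C$, depending only on $d,k,\tilde\chi,m,\psi$ and $R$, such that for all $\lambda>0$, all $\rho$ with $0<|\rho|\le R$, all $p\in[1,2]$ and all $f\in L^p(\mathbb R^d)$ the following holds. (i) If $\frac1q=\frac{d-1}{d+1}\big(1-\frac1p\big)$, then $\mathcal T^\rho_\lambda f\in L^q(\mathbb R^d)$ and $$\|\mathcal T^\rho_\lambda f\|_{L^q}\le C\,|\rho|^{-\frac12(\frac1p-\frac1q)}\,\lambda^{\frac dp-\frac{d-1}2}\,\|f\|_{L^p}.$$ (ii) If $\frac1q=\frac{d-2}{d}\big(1-\frac1p\big)$, then $\mathcal T^\rho_\lambda f\in L^q(\mathbb R^d)$ and $$\|\mathcal T^\rho_\lambda f\|_{L^q}\le C\,\lambda^{\frac{d-1}p-\frac{d-2}2}\,\|f\|_{L^p}.$$ (For $p=1$,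 $q=\infty$.) -/

import Mathlib

open MeasureTheory
open scoped ENNReal SchwartzMap ContDiff FourierTransform

noncomputable section

namespace GraphMultiplier

/- Frequency variables.  The ambient dimension is `d = n + 2`.  A point
`η = (η₁, η', η'', η_d)` of `ℝ × ℝ^{k-1} × ℝ^{d-k-1} × ℝ` is an element of
`EuclideanSpace ℝ (Fin (n + 2))`, and `η̃ = (η₁, η', η'')` is an element of
`EuclideanSpace ℝ (Fin (n + 1))`.  The coordinate with index `0` is `η₁`; the coordinates
with index `j`, `1 ≤ j < k`, form `η'`; those with index `j`, `k ≤ j ≤ n = d - 2`, form `η''`. -/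

/-- `|η'|²`. -/
def normSqFst {n : ℕ} (k : ℕ) (t : EuclideanSpace ℝ (Fin (n + 1))) : ℝ :=
  ∑ i : Fin n, if (i : ℕ) + 1 < k then t i.succ ^ 2 else 0

/-- `|η''|²`. -/
def normSqSnd {n : ℕ} (k : ℕ) (t : EuclideanSpace ℝ (Fin (n + 1))) : ℝ :=
  ∑ i : Fin n, if k ≤ (i : ℕ) + 1 then t i.succ ^ 2 else 0

/-- The set `𝓓 = {η̃ : |η'| ≤ 1, |η''| ≤ 1, η₁ ∈ [1, 2]}`. -/
def domainD {n : ℕ} (k : ℕ) : Set (EuclideanSpace ℝ (Fin (n + 1))) :=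
  {t | normSqFst k t ≤ 1 ∧ normSqSnd k t ≤ 1 ∧ t 0 ∈ Set.Icc (1 : ℝ) 2}

/-- The graph function `𝓖_ρ(η̃) = (|η'|² - |η''|² + ρ) / (2 η₁)`. It is only used over `𝓓`,
where `η₁ ≥ 1`. -/
def graphFun {n : ℕ} (k : ℕ) (ρ : ℝ) (t : EuclideanSpace ℝ (Fin (n + 1))) : ℝ :=
  (normSqFst k t - normSqSnd k t + ρ) / (2 * t 0)

/-- The projection `η ↦ η̃` forgetting the last coordinate `η_d`. -/
def tilde {n : ℕ} (η : EuclideanSpace ℝ (Fin (n + 2))) : EuclideanSpace ℝ (Fin (n + 1)) :=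
  WithLp.toLp 2 fun i => η i.castSucc

/-- The symbol `χ̃(η̃) ψ(λ⁻¹ m(η̃) (η_d - 𝓖_ρ(η̃)))`. -/
def symbol {n : ℕ} (k : ℕ) (χ : EuclideanSpace ℝ (Fin (n + 1)) → ℂ)
    (m : EuclideanSpace ℝ (Fin (n + 1)) → ℝ) (ψ : 𝓢(ℝ, ℂ)) (ρ lam : ℝ)
    (η : EuclideanSpace ℝ (Fin (n + 2))) : ℂ :=
  χ (tilde η) * ψ (lam⁻¹ * (m (tilde η) * (η (Fin.last (n + 1)) - graphFun k ρ (tilde η))))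

/-- The multiplier operator `𝓣^ρ_λ`, acting on tempered distributions by
`(𝓣^ρ_λ f)^ = symbol · f^`. -/
def multOp {n : ℕ} (k : ℕ) (χ : EuclideanSpace ℝ (Fin (n + 1)) → ℂ)
    (m : EuclideanSpace ℝ (Fin (n + 1)) → ℝ) (ψ : 𝓢(ℝ, ℂ)) (ρ lam : ℝ) :
    𝓢'(EuclideanSpace ℝ (Fin (n + 2)), ℂ) →L[ℂ] 𝓢'(EuclideanSpace ℝ (Fin (n + 2)), ℂ) :=
  TemperedDistribution.fourierMultiplierCLM ℂ (symbol k χ m ψ ρ lam)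

/-- `T` maps `L^p` into `L^q` with `‖T f‖_q ≤ A ‖f‖_p`: for every `f ∈ L^p` the tempered
distribution `T f` is (represented by) a function `g ∈ L^q` satisfying this bound. -/
def LpLqBound {d : ℕ}
    (T : 𝓢'(EuclideanSpace ℝ (Fin d), ℂ) →L[ℂ] 𝓢'(EuclideanSpace ℝ (Fin d), ℂ))
    (p q : ℝ≥0∞) [Fact (1 ≤ p)] [Fact (1 ≤ q)] (A : ℝ) : Prop :=
  ∀ f : Lp ℂ p (volume : Measure (EuclideanSpace ℝ (Fin d))),
    ∃ g : Lp ℂ q (volume : Measure (EuclideanSpace ℝ (Fin d))),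
      T (Lp.toTemperedDistribution f) = Lp.toTemperedDistribution g ∧ ‖g‖ ≤ A * ‖f‖

end GraphMultiplier

end

/-! The operator is analysed slice by slice in the variable `t` dual to `η_d`. With `d = n + 2`, the
slice at `t` of the convolution kernel is the inverse Fourier transform in `η̃` of `λ e^{2πi t 𝓖_ρ}
χ̃ m⁻¹ ψ^∨(λ t / m)`, where `ψ^∨` is the inverse Fourier transform (`slice_fourierInv_symbol`). What
is needed is a dispersive bound for `e^{2πi t 𝓖_ρ}`, followed by a Strichartz-type TT* argument in
`t`.

Dispersive bound. For fixed `η₁ = r` the phase is quadratic in the other `n` variables. Integrating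
them out gives exact Fresnel factors of total size `(r / |t|)^{n/2}` and a phase linear in `r`, so
there remains an integral over `r ∈ [1, 2]` with phase `α r + π t ρ / r` (`regKernel_zero`). The
trivial estimate yields `|t|^{-n/2}` uniformly in `ρ`; van der Corput's lemma gains a further `|t
ρ|^{-1/2}`. Both bounds have the form `B |t|^{-N/2}`: with `N = d - 2` and `B` constant they lead to
(ii), with `N = d - 1` and `B` a multiple of `|ρ|^{-1/2}` to (i). The rest of the argument is run
once, for general `N` and `B`. The amplitude costs only a constant, being the Fourier transform of a
function whose `L¹` norm is bounded uniformly in `λ t` (`exists_fourier_eq_amp`).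

Endpoint `p = 1`. Since `ψ^∨` vanishes near `0`, the kernel vanishes for `|t|` small compared with
`1 / λ`, hence is `O(B λ^{1 + N/2})` (`exists_kernel_bound`).

Endpoint `p = 2`. The square of the modulus of the symbol is a symbol of the same kind. Its slice
forms are interpolated between the dispersive bound and Plancherel at `α = N / (N + 2)`, which gives
decay `|t|^{-α}`; the Hardy–Littlewood–Sobolev inequality sums the slices
(`exists_quadratic_bound`). Cauchy–Schwarz then gives the bound with constant `λ^{1/2} B^{(1-α)/2}`
(`exists_multForm_bound_two`).

Riesz–Thorin between the endpoints gives all `p ∈ [1, 2]` on the line `1/q = α (1 - 1/p)`.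
Everything is proved for the bilinear form `multForm`; duality and density transfer it to the
operator on `L^p` (`lpLqBound_of_multForm`). -/

namespace GraphMultiplier

/-! ### Riesz–Thorin interpolation for bilinear forms. -/

/-- Bilinear forms on integrable functions bounded with respect to the `L¹` norms. -/
structure IsBoundedBilin {X Y : Type*} [MeasurableSpace X] [MeasurableSpace Y]
    (μ : Measure X) (ν : Measure Y) (B : (X → ℂ) → (Y → ℂ) → ℂ) (M : ℝ) : Prop where
  add_left : ∀ f f' g, Integrable f μ → Integrable f' μ → Integrable g ν →
    B (fun x => f x + f' x) g = B f g + B f' g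
  smul_left : ∀ (c : ℂ) f g, Integrable f μ → Integrable g ν →
    B (fun x => c * f x) g = c * B f g
  add_right : ∀ f g g', Integrable f μ → Integrable g ν → Integrable g' ν →
    B f (fun x => g x + g' x) = B f g + B f g'
  smul_right : ∀ (c : ℂ) f g, Integrable f μ → Integrable g ν →
    B f (fun x => c * g x) = c * B f g
  bound : ∀ f g, Integrable f μ → Integrable g ν →
    ‖B f g‖ ≤ M * (∫ x, ‖f x‖ ∂μ) * (∫ y, ‖g y‖ ∂ν)

section

variable {X Y : Type*} [MeasurableSpace X] [MeasurableSpace Y]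
  {μ : Measure X} {ν : Measure Y} {B : (X → ℂ) → (Y → ℂ) → ℂ} {M : ℝ}

theorem IsBoundedBilin.flip (h : IsBoundedBilin μ ν B M) :
    IsBoundedBilin ν μ (fun g f => B f g) M where
  add_left f f' g hf hf' hg := h.add_right g f f' hg hf hf'
  smul_left c f g hf hg := h.smul_right c g f hg hf
  add_right f g g' hf hg hg' := h.add_left g g' f hg hg' hf
  smul_right c f g hf hg := h.smul_left c g f hg hf
  bound f g hf hg := by
    have := h.bound g f hg hf
    linarith [mul_right_comm M (∫ x, ‖g x‖ ∂μ) (∫ y, ‖f y‖ ∂ν)]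

theorem IsBoundedBilin.zero_left (h : IsBoundedBilin μ ν B M) {g : Y → ℂ}
    (hg : Integrable g ν) : B (fun _ => 0) g = 0 := by
  simpa using h.smul_left 0 (fun _ => 0) g (integrable_zero _ _ _) hg

theorem IsBoundedBilin.sum_left (h : IsBoundedBilin μ ν B M) {ι : Type*} (s : Finset ι)
    (c : ι → ℂ) (f : ι → X → ℂ) {g : Y → ℂ} (hf : ∀ i ∈ s, Integrable (f i) μ)
    (hg : Integrable g ν) :
    B (fun x => ∑ i ∈ s, c i * f i x) g = ∑ i ∈ s, c i * B (f i) g := by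
  classical
  induction s using Finset.induction_on with
  | empty => simpa using h.zero_left hg
  | insert a s ha ih =>
    simp only [Finset.sum_insert ha]
    have hs : ∀ i ∈ s, Integrable (f i) μ := fun i hi => hf i (Finset.mem_insert_of_mem hi)
    have ha' := hf a (Finset.mem_insert_self a s)
    rw [h.add_left (fun x => c a * f a x) (fun x => ∑ i ∈ s, c i * f i x) g (ha'.const_mul _)
      (integrable_finsetSum s fun i hi => (hs i hi).const_mul (c i)) hg,
      h.smul_left _ _ _ ha' hg, ih hs]

theorem IsBoundedBilin.sub_left (h : IsBoundedBilin μ ν B M) {f f' : X → ℂ} {g : Y → ℂ}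
    (hf : Integrable f μ) (hf' : Integrable f' μ) (hg : Integrable g ν) :
    B (fun x => f x - f' x) g = B f g - B f' g := by
  have h1 := h.add_left f (fun x => (-1) * f' x) g hf (hf'.const_mul _) hg
  rw [h.smul_left _ _ _ hf' hg] at h1
  rw [show (fun x => f x - f' x) = fun x => f x + (-1) * f' x by ext; ring, h1]
  ring

/-- Joint continuity in `L¹`, through which the simple-function case of interpolation passes to the
limit. -/
theorem IsBoundedBilin.norm_sub_le (h : IsBoundedBilin μ ν B M) {f f' : X → ℂ} {g g' : Y → ℂ}
    (hf : Integrable f μ) (hf' : Integrable f' μ) (hg : Integrable g ν) (hg' : Integrable g' ν) :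
    ‖B f g - B f' g'‖ ≤ M * (∫ x, ‖f x - f' x‖ ∂μ) * (∫ y, ‖g y‖ ∂ν) +
      M * (∫ x, ‖f' x‖ ∂μ) * (∫ y, ‖g y - g' y‖ ∂ν) := by
  have e : B f g - B f' g' = B (fun x => f x - f' x) g + B f' (fun y => g y - g' y) := by
    rw [h.sub_left hf hf' hg, h.flip.sub_left hg hg' hf']; ring
  rw [e]
  exact (norm_add_le _ _).trans
    (add_le_add (h.bound _ _ (hf.sub hf') hg) (h.bound _ _ hf' (hg.sub hg')))

/-- The analytic family `|c|^{p (1 - z + z / p₁)} c / |c|` of the complex interpolation method. -/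
noncomputable def interpPow (p p₁ : ℝ) (z c : ℂ) : ℂ :=
  Complex.exp ((Real.log ‖c‖ * p : ℝ) * (1 - z + z / p₁)) * (c / ‖c‖)

theorem interpPow_zero (p p₁ : ℝ) (z : ℂ) : interpPow p p₁ z 0 = 0 := by simp [interpPow]

theorem differentiable_interpPow (p p₁ : ℝ) (c : ℂ) :
    Differentiable ℂ fun z => interpPow p p₁ z c := by
  unfold interpPow; fun_prop

theorem interpPow_re (p₁ : ℝ) (z : ℂ) : (1 - z + z / p₁).re = 1 - z.re + z.re / p₁ := by
  simp [Complex.div_ofReal_re]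

theorem norm_interpPow {p p₁ : ℝ} (z : ℂ) {c : ℂ} (hc : c ≠ 0) :
    ‖interpPow p p₁ z c‖ = ‖c‖ ^ (p * (1 - z.re + z.re / p₁)) := by
  have hc' : 0 < ‖c‖ := norm_pos_iff.2 hc
  rw [interpPow, norm_mul, norm_div, Complex.norm_real, norm_norm, div_self hc'.ne', mul_one,
    Complex.norm_exp, Complex.re_ofReal_mul, interpPow_re, Real.rpow_def_of_pos hc', mul_assoc]

theorem norm_interpPow_le {p p₁ : ℝ} (hp : 0 ≤ p) (hp₁ : 1 ≤ p₁) {z : ℂ}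
    (hz : z ∈ Complex.HadamardThreeLines.verticalClosedStrip 0 1) (c : ℂ) :
    ‖interpPow p p₁ z c‖ ≤ Real.exp (|Real.log ‖c‖| * p) := by
  rcases eq_or_ne c 0 with rfl | hc
  · simp [interpPow_zero]
  have hz0 : 0 ≤ z.re := hz.1
  have hz1 : z.re ≤ 1 := hz.2
  rw [norm_interpPow z hc, Real.rpow_def_of_pos (norm_pos_iff.2 hc)]
  apply Real.exp_le_exp.2
  have h1 : z.re / p₁ ≤ z.re := div_le_self hz0 hp₁
  have h2 : 0 ≤ z.re / p₁ := by positivity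
  calc Real.log ‖c‖ * (p * (1 - z.re + z.re / p₁))
      ≤ |Real.log ‖c‖| * (p * 1) := by
        apply mul_le_mul (le_abs_self _) _ (by apply mul_nonneg hp; linarith) (abs_nonneg _)
        exact mul_le_mul_of_nonneg_left (by linarith) hp
    _ = _ := by ring

theorem interpPow_self {p p₁ θ : ℝ} (h : p * (1 - θ + θ / p₁) = 1) (c : ℂ) :
    interpPow p p₁ θ c = c := by
  rcases eq_or_ne c 0 with rfl | hc
  · simp [interpPow_zero]
  have hc' : 0 < ‖c‖ := norm_pos_iff.2 hc
  have e : ((Real.log ‖c‖ * p : ℝ) : ℂ) * (1 - θ + θ / p₁) = (Real.log ‖c‖ : ℝ) := by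
    have h' : (p : ℂ) * (1 - θ + θ / p₁) = 1 := by exact_mod_cast h
    rw [Complex.ofReal_mul, mul_assoc, h', mul_one]
  rw [interpPow, e, ← Complex.ofReal_exp, Real.exp_log hc', mul_div_cancel₀]
  exact_mod_cast hc'.ne'

/-- The level `0` is left out so that, for integrable `f`, only level sets of finite measure occur;
this is the role of `u 0 = 0`. -/
theorem SimpleFunc_eq_sum (f : SimpleFunc X ℂ) (u : ℂ → ℂ) (hu : u 0 = 0) :
    (fun x => u (f x)) =
      fun x => ∑ c ∈ f.range.erase 0, u c * Set.indicator (f ⁻¹' {c}) (fun _ => (1 : ℂ)) x := by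
  ext x
  by_cases hx : f x = 0
  · rw [hx, hu, Finset.sum_eq_zero]
    intro c hc
    rw [Set.indicator_of_notMem, mul_zero]
    simp only [Set.mem_preimage, Set.mem_singleton_iff, hx]
    exact fun h => (Finset.ne_of_mem_erase hc) h.symm
  · rw [Finset.sum_eq_single (f x)]
    · simp
    · intro c _ hc
      rw [Set.indicator_of_notMem, mul_zero]
      simpa using hc.symm
    · intro h
      exact absurd (Finset.mem_erase.2 ⟨hx, f.mem_range_self x⟩) h

theorem integrable_indicator_preimage (f : SimpleFunc X ℂ) (hf : Integrable f μ) {c : ℂ}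
    (hc : c ∈ f.range.erase 0) :
    Integrable (Set.indicator (f ⁻¹' {c}) (fun _ => (1 : ℂ))) μ := by
  have h := SimpleFunc.measure_preimage_lt_top_of_integrable f hf (Finset.ne_of_mem_erase hc)
  exact (integrable_indicator_iff (f.measurableSet_fiber c)).2
    (integrableOn_const h.ne)

/-- With `u` and `v` taken from the analytic family, all dependence on `z` sits in finitely many
scalar coefficients, so analyticity and boundedness on the strip are immediate. -/
theorem IsBoundedBilin.simpleFunc_sum (h : IsBoundedBilin μ ν B M) (f : SimpleFunc X ℂ)
    (g : SimpleFunc Y ℂ) (hf : Integrable f μ) (hg : Integrable g ν) (u v : ℂ → ℂ)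
    (hu : u 0 = 0) (hv : v 0 = 0) :
    B (fun x => u (f x)) (fun y => v (g y)) = ∑ c ∈ f.range.erase 0, u c *
      ∑ d ∈ g.range.erase 0, v d * B (Set.indicator (f ⁻¹' {c}) (fun _ => 1))
        (Set.indicator (g ⁻¹' {d}) (fun _ => 1)) := by
  have hgi : Integrable (fun y => v (g y)) ν := by
    rw [SimpleFunc_eq_sum g v hv]
    exact integrable_finsetSum _ fun d hd => (integrable_indicator_preimage g hg hd).const_mul _
  rw [SimpleFunc_eq_sum f u hu, h.sum_left _ _ _
    (fun c hc => integrable_indicator_preimage f hf hc) hgi]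
  refine Finset.sum_congr rfl fun c hc => ?_
  rw [SimpleFunc_eq_sum g v hv, h.flip.sum_left _ _ _
    (fun d hd => integrable_indicator_preimage g hg hd) (integrable_indicator_preimage f hf hc)]

theorem integrable_simpleFunc_map (f : SimpleFunc X ℂ) (hf : Integrable f μ) {u : ℂ → ℂ}
    (hu : u 0 = 0) : Integrable (fun x => u (f x)) μ := by
  rw [SimpleFunc_eq_sum f u hu]
  exact integrable_finsetSum _ fun c hc => (integrable_indicator_preimage f hf hc).const_mul _

theorem norm_interpPow_of_re_zero {p p₁ : ℝ} (hp : 0 < p) {z : ℂ} (hz : z.re = 0) (c : ℂ) :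
    ‖interpPow p p₁ z c‖ = ‖c‖ ^ p := by
  rcases eq_or_ne c 0 with rfl | hc
  · simp [interpPow_zero, Real.zero_rpow hp.ne']
  · simp [norm_interpPow z hc, hz]

theorem norm_interpPow_of_re_one {p p₁ : ℝ} (hp : 0 < p) (hp₁ : 1 ≤ p₁) {z : ℂ} (hz : z.re = 1)
    (c : ℂ) : ‖interpPow p p₁ z c‖ ^ p₁ = ‖c‖ ^ p := by
  rcases eq_or_ne c 0 with rfl | hc
  · simp [interpPow_zero, Real.zero_rpow hp.ne', Real.zero_rpow (by linarith : p₁ ≠ 0)]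
  · rw [norm_interpPow z hc, hz, ← Real.rpow_mul (norm_nonneg _)]
    congr 1
    field_simp
    ring

/-- **Riesz–Thorin interpolation** between an `L¹ × L¹` and an `L^{p₁} × L^{r₁}` bound of a
bilinear form, for simple functions. -/
theorem IsBoundedBilin.riesz_thorin_simpleFunc (h : IsBoundedBilin μ ν B M) (hM : 0 ≤ M)
    {p₁ r₁ M₁ p r θ : ℝ} (hp₁ : 1 ≤ p₁) (hr₁ : 1 ≤ r₁) (hM₁ : 0 ≤ M₁)
    (h₁ : ∀ (f : SimpleFunc X ℂ) (g : SimpleFunc Y ℂ), Integrable f μ → Integrable g ν →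
      ‖B f g‖ ≤ M₁ * (∫ x, ‖f x‖ ^ p₁ ∂μ) ^ (1 / p₁) * (∫ y, ‖g y‖ ^ r₁ ∂ν) ^ (1 / r₁))
    (hp0 : 0 < p) (hr0 : 0 < r) (hθ0 : 0 ≤ θ) (hθ1 : θ ≤ 1)
    (hp : 1 / p = 1 - θ + θ / p₁) (hr : 1 / r = 1 - θ + θ / r₁)
    (f : SimpleFunc X ℂ) (g : SimpleFunc Y ℂ) (hf : Integrable f μ) (hg : Integrable g ν) :
    ‖B f g‖ ≤ M ^ (1 - θ) * M₁ ^ θ * (∫ x, ‖f x‖ ^ p ∂μ) ^ (1 / p)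
      * (∫ y, ‖g y‖ ^ r ∂ν) ^ (1 / r) := by
  set P := ∫ x, ‖f x‖ ^ p ∂μ with hP
  set R := ∫ y, ‖g y‖ ^ r ∂ν with hR
  have hP0 : 0 ≤ P := integral_nonneg fun x => by positivity
  have hR0 : 0 ≤ R := integral_nonneg fun x => by positivity
  let F : ℂ → ℂ := fun z => B (fun x => interpPow p p₁ z (f x)) (fun y => interpPow r r₁ z (g y))
  have hF : ∀ z, F z = _ := fun z => h.simpleFunc_sum f g hf hg (interpPow p p₁ z)
    (interpPow r r₁ z) (interpPow_zero _ _ _) (interpPow_zero _ _ _)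
  have hdiff : Differentiable ℂ F := by
    rw [show F = _ from funext hF]
    refine Differentiable.fun_sum fun c _ => (differentiable_interpPow _ _ _).mul ?_
    exact Differentiable.fun_sum fun d _ => (differentiable_interpPow _ _ _).mul_const _
  have hbdd : BddAbove ((norm ∘ F) '' Complex.HadamardThreeLines.verticalClosedStrip 0 1) := by
    refine ⟨∑ c ∈ f.range.erase 0, Real.exp (|Real.log ‖c‖| * p) *
      ∑ d ∈ g.range.erase 0, Real.exp (|Real.log ‖d‖| * r) *
      ‖B (Set.indicator (f ⁻¹' {c}) (fun _ => 1)) (Set.indicator (g ⁻¹' {d}) (fun _ => 1))‖, ?_⟩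
    rintro _ ⟨z, hz, rfl⟩
    simp only [Function.comp, hF]
    refine (norm_sum_le _ _).trans (Finset.sum_le_sum fun c _ => ?_)
    rw [norm_mul]
    refine mul_le_mul (norm_interpPow_le hp0.le hp₁ hz c) ?_ (norm_nonneg _) (Real.exp_pos _).le
    refine (norm_sum_le _ _).trans (Finset.sum_le_sum fun d _ => ?_)
    rw [norm_mul]
    exact mul_le_mul_of_nonneg_right (norm_interpPow_le hr0.le hr₁ hz d) (norm_nonneg _)
  -- On `Re z = 0` the two deformed functions have `L¹` norms `P` and `R`; on `Re z = 1` their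
  -- `L^{p₁}` and `L^{r₁}` norms are `P^{1/p₁}` and `R^{1/r₁}`. At `z = θ` they are `f` and `g`
  -- themselves.
  have key := Complex.HadamardThreeLines.norm_le_interp_of_mem_verticalClosedStrip₀₁' F
    (z := (θ : ℂ)) (a := M * P * R) (b := M₁ * P ^ (1 / p₁) * R ^ (1 / r₁))
    (by simpa [Complex.HadamardThreeLines.verticalClosedStrip] using ⟨hθ0, hθ1⟩)
    hdiff.diffContOnCl hbdd ?_ ?_
  · have hpθ : p * (1 - θ + θ / p₁) = 1 := by rw [← hp]; field_simp
    have hrθ : r * (1 - θ + θ / r₁) = 1 := by rw [← hr]; field_simp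
    have hpp : 0 ≤ θ / p₁ := by positivity
    have hrr : 0 ≤ θ / r₁ := by positivity
    simp only [F, interpPow_self hpθ, interpPow_self hrθ, Complex.ofReal_re] at key
    refine key.trans_eq ?_
    rw [Real.mul_rpow (by positivity) hR0, Real.mul_rpow hM hP0,
      Real.mul_rpow (by positivity) (by positivity), Real.mul_rpow hM₁ (by positivity),
      ← Real.rpow_mul hP0, ← Real.rpow_mul hR0, hp, hr,
      Real.rpow_add_of_nonneg hP0 (by linarith) hpp, Real.rpow_add_of_nonneg hR0 (by linarith) hrr]
    ring_nf
  · intro z hz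
    have hz' : z.re = 0 := hz
    refine (h.bound _ _ (integrable_simpleFunc_map f hf (interpPow_zero _ _ _))
      (integrable_simpleFunc_map g hg (interpPow_zero _ _ _))).trans_eq ?_
    simp only [norm_interpPow_of_re_zero hp0 hz', norm_interpPow_of_re_zero hr0 hz', hP, hR]
  · intro z hz
    have hz' : z.re = 1 := hz
    have := h₁ (f.map (interpPow p p₁ z)) (g.map (interpPow r r₁ z))
      (integrable_simpleFunc_map f hf (interpPow_zero _ _ _))
      (integrable_simpleFunc_map g hg (interpPow_zero _ _ _))
    simp only [SimpleFunc.map_apply, norm_interpPow_of_re_one hp0 hp₁ hz',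
      norm_interpPow_of_re_one hr0 hr₁ hz'] at this
    rw [← hP, ← hR] at this
    refine le_trans (le_of_eq ?_) this
    rfl

/-- A bounded integrable function is approximated by simple functions in all `L^p` at once. -/
theorem exists_simpleFunc_approx {f : X → ℂ} (hf : Measurable f) (hi : Integrable f μ) {C : ℝ}
    (hC : ∀ x, ‖f x‖ ≤ C) : ∃ F : ℕ → SimpleFunc X ℂ, (∀ n, Integrable (F n) μ) ∧
      Filter.Tendsto (fun n => ∫ x, ‖F n x - f x‖ ∂μ) Filter.atTop (nhds 0) ∧
      ∀ p : ℝ, 1 ≤ p → Filter.Tendsto (fun n => ∫ x, ‖F n x‖ ^ p ∂μ) Filter.atTop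
        (nhds (∫ x, ‖f x‖ ^ p ∂μ)) := by
  let F := SimpleFunc.approxOn f hf Set.univ 0 (Set.mem_univ _)
  have hle : ∀ n x, ‖F n x‖ ≤ 2 * ‖f x‖ := fun n x => by
    have := SimpleFunc.norm_approxOn_zero_le hf (Set.mem_univ (0 : ℂ)) x n
    simpa [two_mul] using this
  have hlim : ∀ x, Filter.Tendsto (fun n => F n x) Filter.atTop (nhds (f x)) := fun x =>
    SimpleFunc.tendsto_approxOn hf (Set.mem_univ _) (by simp)
  refine ⟨F, fun n => ?_, ?_, fun p hp => ?_⟩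
  · exact (hi.norm.const_mul 2).mono' (F n).aestronglyMeasurable (ae_of_all _ (hle n))
  · have := tendsto_integral_of_dominated_convergence (μ := μ) (F := fun n x => ‖F n x - f x‖)
      (f := fun _ => (0 : ℝ)) (fun x => 3 * ‖f x‖)
      (fun n => ((F n).aestronglyMeasurable.sub hi.1).norm) (hi.norm.const_mul 3)
      (fun n => ae_of_all _ fun x => by
        rw [norm_norm]; linarith [norm_sub_le (F n x) (f x), hle n x])
      (ae_of_all _ fun x => by
        have := ((hlim x).sub_const (f x)).norm
        simpa using this)
    simpa using this
  -- As `‖F n‖ ≤ 2 ‖f‖` and `‖f‖ ≤ C`, one power of `‖f‖` is kept and the remaining `p - 1` are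
  -- bounded, so integrability of `f` supplies a majorant for every `p ≥ 1`.
  · refine tendsto_integral_of_dominated_convergence (fun x => 2 ^ p * C ^ (p - 1) * ‖f x‖)
      (fun n => (((F n).measurable.norm).pow_const p).aestronglyMeasurable)
      (hi.norm.const_mul _) (fun n => ae_of_all _ fun x => ?_) (ae_of_all _ fun x => ?_)
    · rw [Real.norm_of_nonneg (by positivity)]
      calc ‖F n x‖ ^ p ≤ (2 * ‖f x‖) ^ p := Real.rpow_le_rpow (norm_nonneg _) (hle n x) (by linarith)
        _ = 2 ^ p * (‖f x‖ ^ (p - 1) * ‖f x‖) := by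
          rw [Real.mul_rpow (by norm_num) (norm_nonneg _)]
          congr 1
          nth_rewrite 3 [← Real.rpow_one ‖f x‖]
          rw [← Real.rpow_add_of_nonneg (norm_nonneg _) (by linarith) zero_le_one]; ring_nf
        _ ≤ _ := by
          rw [mul_assoc]
          gcongr
          exact hC x
    · exact (hlim x).norm.rpow_const (Or.inr (by linarith))

/-- **Riesz–Thorin interpolation** for bounded integrable functions. -/
theorem IsBoundedBilin.riesz_thorin (h : IsBoundedBilin μ ν B M) (hM : 0 ≤ M)
    {p₁ r₁ M₁ p r θ : ℝ} (hp₁ : 1 ≤ p₁) (hr₁ : 1 ≤ r₁) (hM₁ : 0 ≤ M₁)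
    (h₁ : ∀ (f : SimpleFunc X ℂ) (g : SimpleFunc Y ℂ), Integrable f μ → Integrable g ν →
      ‖B f g‖ ≤ M₁ * (∫ x, ‖f x‖ ^ p₁ ∂μ) ^ (1 / p₁) * (∫ y, ‖g y‖ ^ r₁ ∂ν) ^ (1 / r₁))
    (hp1 : 1 ≤ p) (hr1 : 1 ≤ r) (hθ0 : 0 ≤ θ) (hθ1 : θ ≤ 1)
    (hp : 1 / p = 1 - θ + θ / p₁) (hr : 1 / r = 1 - θ + θ / r₁)
    {f : X → ℂ} {g : Y → ℂ} (hfm : Measurable f) (hgm : Measurable g)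
    (hf : Integrable f μ) (hg : Integrable g ν) (hfb : ∃ C, ∀ x, ‖f x‖ ≤ C)
    (hgb : ∃ C, ∀ x, ‖g x‖ ≤ C) :
    ‖B f g‖ ≤ M ^ (1 - θ) * M₁ ^ θ * (∫ x, ‖f x‖ ^ p ∂μ) ^ (1 / p)
      * (∫ y, ‖g y‖ ^ r ∂ν) ^ (1 / r) := by
  obtain ⟨C, hC⟩ := hfb
  obtain ⟨D, hD⟩ := hgb
  obtain ⟨F, hFi, hF1, hFp⟩ := exists_simpleFunc_approx hfm hf hC
  obtain ⟨G, hGi, hG1, hGp⟩ := exists_simpleFunc_approx hgm hg hD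
  have hlim : Filter.Tendsto (fun n => B (F n) (G n)) Filter.atTop (nhds (B f g)) := by
    rw [tendsto_iff_norm_sub_tendsto_zero]
    have hG1' := hGp 1 le_rfl
    simp only [Real.rpow_one] at hG1'
    have := ((hF1.const_mul M).mul hG1').add (hG1.const_mul (M * ∫ x, ‖f x‖ ∂μ))
    simp only [mul_zero, zero_mul, add_zero] at this
    exact squeeze_zero (fun _ => norm_nonneg _)
      (fun n => h.norm_sub_le (hFi n) hf (hGi n) hg) this
  refine le_of_tendsto_of_tendsto' hlim.norm ?_ (fun n => h.riesz_thorin_simpleFunc hM hp₁ hr₁ hM₁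
    h₁ (by linarith) (by linarith) hθ0 hθ1 hp hr (F n) (G n) (hFi n) (hGi n))
  exact (((hFp p hp1).rpow_const (Or.inr (by positivity))).const_mul _).mul
    ((hGp r hr1).rpow_const (Or.inr (by positivity)))

end

/-! ### The Hardy–Littlewood–Sobolev inequality on the line. -/

theorem lintegral_comp_abs (f : ℝ → ℝ≥0∞) :
    ∫⁻ x : ℝ, f |x| = 2 * ∫⁻ x in Set.Ioi (0 : ℝ), f x := by
  rw [← lintegral_add_compl _ (measurableSet_Ioi (a := (0 : ℝ))), Set.compl_Ioi, two_mul]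
  congr 1
  · exact setLIntegral_congr_fun measurableSet_Ioi fun x hx => by rw [abs_of_pos hx]
  · rw [setLIntegral_congr Iio_ae_eq_Iic.symm]
    have h := (Measure.measurePreserving_neg (volume : Measure ℝ)).setLIntegral_comp_preimage_emb
      (MeasurableEquiv.neg ℝ).measurableEmbedding (fun x => f |x|) (Set.Ioi 0)
    simp only [abs_neg, Set.neg_preimage, Set.neg_Ioi, neg_zero] at h
    rw [h]
    exact setLIntegral_congr_fun measurableSet_Ioi fun x hx => by rw [abs_of_pos hx]

theorem lintegral_rpow_abs_lt {α κ : ℝ} (hα : α < 1) (hκ : 0 < κ) :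
    ∫⁻ t : ℝ, Set.indicator {t | |t| < κ} (fun t => ENNReal.ofReal (|t| ^ (-α))) t =
      ENNReal.ofReal (2 / (1 - α) * κ ^ (1 - α)) := by
  have h := lintegral_comp_abs
    (fun t => Set.indicator (Set.Iio κ) (fun t => ENNReal.ofReal (t ^ (-α))) t)
  have e : (fun t : ℝ => Set.indicator {t | |t| < κ} (fun t => ENNReal.ofReal (|t| ^ (-α))) t) =
      fun t => Set.indicator (Set.Iio κ) (fun t => ENNReal.ofReal (t ^ (-α))) |t| := by
    ext t; simp [Set.indicator]
  rw [e, h, lintegral_indicator measurableSet_Iio, Measure.restrict_restrict measurableSet_Iio,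
    Set.Iio_inter_Ioi, setLIntegral_congr Ioo_ae_eq_Ioc, ← ofReal_integral_eq_lintegral_ofReal,
    ← intervalIntegral.integral_of_le hκ.le, integral_rpow (Or.inl (by linarith)),
    Real.zero_rpow (by linarith), show (2 : ℝ≥0∞) = ENNReal.ofReal 2 by simp,
    ← ENNReal.ofReal_mul (by norm_num)]
  · congr 1
    rw [show -α + 1 = 1 - α by ring]; ring
  · have := intervalIntegral.intervalIntegrable_rpow' (a := 0) (b := κ) (r := -α) (by linarith)
    exact (intervalIntegrable_iff_integrableOn_Ioc_of_le hκ.le).1 this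
  · filter_upwards [ae_restrict_mem measurableSet_Ioc] with x hx
    exact Real.rpow_nonneg hx.1.le _

theorem lintegral_rpow_neg_two_abs_ge {κ : ℝ} (hκ : 0 < κ) :
    ∫⁻ t : ℝ, Set.indicator {t | κ ≤ |t|} (fun t => ENNReal.ofReal (|t| ^ (-2 : ℝ))) t =
      ENNReal.ofReal (2 / κ) := by
  have h := lintegral_comp_abs
    (fun t => Set.indicator (Set.Ici κ) (fun t => ENNReal.ofReal (t ^ (-2 : ℝ))) t)
  have e : (fun t : ℝ => Set.indicator {t | κ ≤ |t|}
      (fun t => ENNReal.ofReal (|t| ^ (-2 : ℝ))) t) =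
      fun t => Set.indicator (Set.Ici κ) (fun t => ENNReal.ofReal (t ^ (-2 : ℝ))) |t| := by
    ext t; simp [Set.indicator]
  have hs : Set.Ici κ ∩ Set.Ioi 0 = Set.Ici κ :=
    Set.inter_eq_left.2 fun x hx => hκ.trans_le hx
  rw [e, h, lintegral_indicator measurableSet_Ici, Measure.restrict_restrict measurableSet_Ici,
    hs, setLIntegral_congr Ioi_ae_eq_Ici.symm, ← ofReal_integral_eq_lintegral_ofReal,
    integral_Ioi_rpow_of_lt (by norm_num) hκ, show (2 : ℝ≥0∞) = ENNReal.ofReal 2 by simp,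
    ← ENNReal.ofReal_mul (by norm_num)]
  · congr 1
    rw [show (-2 : ℝ) + 1 = -1 by norm_num, Real.rpow_neg_one]; field_simp
  · exact integrableOn_Ioi_rpow_of_lt (by norm_num) hκ
  · filter_upwards [ae_restrict_mem measurableSet_Ioi] with x hx
    exact Real.rpow_nonneg (hκ.trans hx).le _

/-- The pointwise estimate behind the Hardy–Littlewood–Sobolev inequality. -/
theorem lintegral_truncated_riesz_le {α p : ℝ} (hα0 : 0 < α) (hα1 : α < 1) (hp : p = 2 / (2 - α))
    {F : ℝ → ℝ≥0∞} (hF : Measurable F) (s : ℝ) {a I : ℝ} (ha : 0 < a) (hI : 0 < I)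
    (hFI : ∫⁻ t, F t ^ p ≤ ENNReal.ofReal I) :
    ∫⁻ t, Set.indicator {t | F t ≤ ENNReal.ofReal a} F t * ENNReal.ofReal (|t - s| ^ (-α)) ≤
      ENNReal.ofReal ((2 / (1 - α) + 2 ^ (α / 2)) * (a ^ (p - 1) * I ^ (1 - α))) := by
  have h2α : 0 < 2 - α := by linarith
  have hp0 : 0 < p := by rw [hp]; positivity
  -- The cut between near and far is chosen to balance the two contributions: near `s` the bound `F
  -- ≤ a` is used, far from `s` Hölder's inequality, and both give multiples of `a^{p-1} I^{1-α}`.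
  set κ := I / a ^ p with hκ
  have hκ0 : 0 < κ := by positivity
  set k1 : ℝ → ℝ≥0∞ := fun t =>
    Set.indicator {t | |t| < κ} (fun t => ENNReal.ofReal (|t| ^ (-α))) t with hk1
  set k2 : ℝ → ℝ≥0∞ := fun t =>
    Set.indicator {t | κ ≤ |t|} (fun t => ENNReal.ofReal (|t| ^ (-α))) t with hk2
  have hk1m : Measurable k1 :=
    Measurable.indicator (by fun_prop) (measurableSet_lt (by fun_prop) (by fun_prop))
  have hk2m : Measurable k2 :=
    Measurable.indicator (by fun_prop) (measurableSet_le (by fun_prop) (by fun_prop))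
  have hpt : ∀ t, Set.indicator {t | F t ≤ ENNReal.ofReal a} F t *
      ENNReal.ofReal (|t - s| ^ (-α)) ≤ ENNReal.ofReal a * k1 (t - s) + F t * k2 (t - s) := by
    intro t
    by_cases h : |t - s| < κ
    · refine le_trans ?_ le_self_add
      rw [hk1]; simp only [Set.indicator, Set.mem_ofPred_eq, h, if_true]
      gcongr
      split_ifs with h'
      · exact h'
      · exact zero_le
    · refine le_trans ?_ le_add_self
      rw [hk2]; simp only [Set.indicator, Set.mem_ofPred_eq, not_lt.1 h, if_true]
      gcongr
      split_ifs with h'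
      · exact le_rfl
      · exact zero_le
  -- The dual exponent `2 / α` turns the tail `|t|^{-α}` into `|t|^{-2}`, integrable at infinity.
  have hpq : p.HolderConjugate (2 / α) := by
    rw [Real.holderConjugate_iff]
    refine ⟨by rw [hp, lt_div_iff₀ h2α]; linarith, ?_⟩
    rw [hp]; field_simp; ring
  have h1 : ∫⁻ t, ENNReal.ofReal a * k1 (t - s) =
      ENNReal.ofReal (a * (2 / (1 - α) * κ ^ (1 - α))) := by
    rw [lintegral_const_mul _ (by fun_prop), lintegral_sub_right_eq_self k1 s,
      lintegral_rpow_abs_lt hα1 hκ0, ENNReal.ofReal_mul ha.le]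
  have h2 : ∫⁻ t, F t * k2 (t - s) ≤
      ENNReal.ofReal (I ^ (1 / p) * (2 / κ) ^ (α / 2)) := by
    refine (ENNReal.lintegral_mul_le_Lp_mul_Lq volume hpq hF.aemeasurable
      (by fun_prop)).trans ?_
    rw [ENNReal.ofReal_mul (by positivity), ← ENNReal.ofReal_rpow_of_pos hI,
      ← ENNReal.ofReal_rpow_of_pos (by positivity : 0 < 2 / κ)]
    gcongr ?_ ^ _ * ?_
    rw [one_div_div]
    gcongr
    rw [lintegral_sub_right_eq_self (fun t => k2 t ^ (2 / α)) s,
      ← lintegral_rpow_neg_two_abs_ge hκ0]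
    refine lintegral_mono fun t => ?_
    simp only [hk2, Set.indicator]
    split_ifs with h
    · have ht : 0 < |t| := hκ0.trans_le h
      rw [ENNReal.ofReal_rpow_of_pos (by positivity), ← Real.rpow_mul ht.le]
      apply ENNReal.ofReal_le_ofReal
      apply le_of_eq
      congr 1
      field_simp
    · rw [ENNReal.zero_rpow_of_pos (by positivity)]
  refine (lintegral_mono hpt).trans ?_
  rw [lintegral_add_left (by fun_prop), h1]
  refine (add_le_add le_rfl h2).trans ?_
  rw [← ENNReal.ofReal_add (by positivity) (by positivity)]
  apply ENNReal.ofReal_le_ofReal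
  apply le_of_eq
  have e0 : p * (1 - α) = 2 - p := by rw [hp]; field_simp; ring
  have e1 : a * κ ^ (1 - α) = a ^ (p - 1) * I ^ (1 - α) := by
    rw [hκ, Real.div_rpow hI.le (by positivity), ← Real.rpow_mul ha.le, e0,
      show p - 1 = 1 - (2 - p) by ring, Real.rpow_sub ha 1, Real.rpow_one]
    ring
  have e2 : I ^ (1 / p) * (2 / κ) ^ (α / 2) = 2 ^ (α / 2) * (a ^ (p - 1) * I ^ (1 - α)) := by
    have hx : 1 / p - α / 2 = 1 - α := by rw [hp]; field_simp; ring
    have hy : p * (α / 2) = p - 1 := by linarith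
    rw [Real.div_rpow (by norm_num) hκ0.le, hκ, Real.div_rpow hI.le (by positivity),
      ← Real.rpow_mul ha.le, hy, ← hx, Real.rpow_sub hI]
    field_simp
  rw [e2, ← e1]; ring

/-- The **Hardy–Littlewood–Sobolev inequality** on the line, in the diagonal case. -/
theorem lintegral_riesz_le {α p : ℝ} (hα0 : 0 < α) (hα1 : α < 1) (hp : p = 2 / (2 - α))
    {F : ℝ → ℝ≥0∞} (hF : Measurable F) (hFt : ∀ t, F t ≠ ⊤) {I : ℝ} (hI : 0 < I)
    (hFI : ∫⁻ t, F t ^ p ≤ ENNReal.ofReal I) :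
    ∫⁻ s, ∫⁻ t, F s * F t * ENNReal.ofReal (|t - s| ^ (-α)) ≤
      ENNReal.ofReal (2 * (2 / (1 - α) + 2 ^ (α / 2)) * I ^ (2 / p)) := by
  have h2α : 0 < 2 - α := by linarith
  have hp0 : 0 < p := by rw [hp]; positivity
  set c := 2 / (1 - α) + 2 ^ (α / 2) with hc
  have h1α : 0 < 1 - α := by linarith
  have hc0 : 0 < c := by positivity
  -- By symmetry it suffices to treat the half where `F t ≤ F s`. There the truncated estimate
  -- applies with level `a = F s`, and `F s * (F s)^{p-1} = (F s)^p` integrates back to at most `I`.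
  let H : ℝ → ℝ → ℝ≥0∞ := fun s t =>
    F s * (Set.indicator {t | F t ≤ F s} F t * ENNReal.ofReal (|t - s| ^ (-α)))
  have hHm : Measurable (Function.uncurry H) := by
    refine (hF.comp measurable_fst).mul (Measurable.mul ?_ (by fun_prop))
    have : (fun q : ℝ × ℝ => Set.indicator {t | F t ≤ F q.1} F q.2) =
        Set.indicator {q : ℝ × ℝ | F q.2 ≤ F q.1} (fun q => F q.2) := by
      ext q; simp [Set.indicator]
    rw [this]
    exact (hF.comp measurable_snd).indicator
      (measurableSet_le (hF.comp measurable_snd) (hF.comp measurable_fst))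
  have hpt : ∀ s t, F s * F t * ENNReal.ofReal (|t - s| ^ (-α)) ≤ H s t + H t s := by
    intro s t
    rcases le_total (F t) (F s) with h | h
    · refine le_trans (le_of_eq ?_) le_self_add
      simp only [H, Set.indicator, Set.mem_ofPred_eq, h, if_true]; ring
    · refine le_trans (le_of_eq ?_) le_add_self
      simp only [H, Set.indicator, Set.mem_ofPred_eq, h, if_true, abs_sub_comm t s]; ring
  have hH : ∫⁻ s, ∫⁻ t, H s t ≤ ENNReal.ofReal (c * I ^ (2 / p)) := by
    calc ∫⁻ s, ∫⁻ t, H s t ≤ ∫⁻ s, ENNReal.ofReal (c * I ^ (1 - α)) * F s ^ p := by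
          refine lintegral_mono fun s => ?_
          simp only [H]
          rw [lintegral_const_mul' _ _ (hFt s)]
          rcases eq_or_ne (F s) 0 with h0 | h0
          · rw [h0, zero_mul]; exact zero_le
          have ha : 0 < (F s).toReal := ENNReal.toReal_pos h0 (hFt s)
          have := lintegral_truncated_riesz_le hα0 hα1 hp hF s ha hI hFI
          rw [ENNReal.ofReal_toReal (hFt s)] at this
          refine (mul_le_mul_right this _).trans (le_of_eq ?_)
          nth_rewrite 1 [← ENNReal.ofReal_toReal (hFt s)]
          rw [← ENNReal.ofReal_mul ha.le]
          nth_rewrite 3 [← ENNReal.ofReal_toReal (hFt s)]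
          rw [ENNReal.ofReal_rpow_of_pos ha, ← ENNReal.ofReal_mul (by positivity)]
          congr 1
          have : (F s).toReal ^ p = (F s).toReal * (F s).toReal ^ (p - 1) := by
            rw [Real.rpow_sub ha, Real.rpow_one]; field_simp
          rw [this]; ring
      _ = ENNReal.ofReal (c * I ^ (1 - α)) * ∫⁻ s, F s ^ p :=
          lintegral_const_mul _ (hF.pow_const _)
      _ ≤ ENNReal.ofReal (c * I ^ (1 - α)) * ENNReal.ofReal I := by gcongr
      _ = _ := by
          rw [← ENNReal.ofReal_mul (by positivity), mul_assoc]
          congr 2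
          rw [show 2 / p = 1 - α + 1 by rw [hp]; field_simp; ring, Real.rpow_add hI, Real.rpow_one]
  calc ∫⁻ s, ∫⁻ t, F s * F t * ENNReal.ofReal (|t - s| ^ (-α))
      ≤ ∫⁻ s, ∫⁻ t, (H s t + H t s) :=
        lintegral_mono fun s => lintegral_mono fun t => hpt s t
    _ = ∫⁻ s, ((∫⁻ t, H s t) + ∫⁻ t, H t s) := by
        refine lintegral_congr fun s => lintegral_add_left ?_ _
        exact hHm.comp (measurable_const.prodMk measurable_id)
    _ = (∫⁻ s, ∫⁻ t, H s t) + ∫⁻ s, ∫⁻ t, H t s :=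
        lintegral_add_left hHm.lintegral_prod_right _
    _ = 2 * ∫⁻ s, ∫⁻ t, H s t := by
        rw [two_mul, lintegral_lintegral_swap (f := fun s t => H t s)]
        exact (hHm.comp measurable_swap).aemeasurable
    _ ≤ 2 * ENNReal.ofReal (c * I ^ (2 / p)) := by gcongr
    _ = _ := by
        rw [show (2 : ℝ≥0∞) = ENNReal.ofReal 2 by simp, ← ENNReal.ofReal_mul (by norm_num),
          mul_assoc]

/-! ### Fourier multiplier forms and Plancherel's theorem. -/

section

variable {V : Type*} [NormedAddCommGroup V] [InnerProductSpace ℝ V] [FiniteDimensional ℝ V]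
  [MeasurableSpace V] [BorelSpace V]

theorem continuous_fourier_of_integrable {f : V → ℂ} (hf : Integrable f) : Continuous (𝓕 f) :=
  VectorFourier.fourierIntegral_continuous Real.continuous_fourierChar
    (innerSL ℝ).continuous₂ hf

theorem norm_fourier_le (f : V → ℂ) (x : V) : ‖𝓕 f x‖ ≤ ∫ y, ‖f y‖ :=
  VectorFourier.norm_fourierIntegral_le_integral_norm _ _ _ _ _

theorem continuous_fourierInv_of_integrable {f : V → ℂ} (hf : Integrable f) :
    Continuous (𝓕⁻ f) := by
  have : 𝓕⁻ f = fun x => 𝓕 f (-x) := by ext x; rw [Real.fourierInv_eq_fourier_neg]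
  rw [this]
  exact (continuous_fourier_of_integrable hf).comp continuous_neg

theorem integral_fourier_mul_eq_flip {f g : V → ℂ} (hf : Integrable f) (hg : Integrable g) :
    ∫ x, 𝓕 f x * g x = ∫ x, f x * 𝓕 g x := by
  have := VectorFourier.integral_fourierIntegral_smul_eq_flip (L := innerₗ V)
    Real.continuous_fourierChar continuous_inner hf hg
  rw [flip_innerₗ] at this
  exact this

theorem integral_fourierInv_mul_eq_flip {f g : V → ℂ} (hf : Integrable f) (hg : Integrable g) :
    ∫ x, 𝓕⁻ f x * g x = ∫ x, f x * 𝓕⁻ g x := by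
  have h := integral_fourier_mul_eq_flip hf hg.comp_neg
  calc ∫ x, 𝓕⁻ f x * g x = ∫ x, 𝓕⁻ f (-x) * g (-x) :=
        (integral_neg_eq_self (fun x => 𝓕⁻ f x * g x) volume).symm
    _ = ∫ x, 𝓕 f x * g (-x) := by simp_rw [Real.fourierInv_eq_fourier_neg, neg_neg]
    _ = _ := by rw [h, Real.fourierInv_eq_fourier_comp_neg]

theorem integrable_mul_fourier {w u : V → ℂ} (hw : Integrable w) (hu : Integrable u) :
    Integrable fun η => w η * 𝓕 u η :=
  hw.mul_bdd (c := ∫ y, ‖u y‖) (continuous_fourier_of_integrable hu).aestronglyMeasurable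
    (ae_of_all _ (norm_fourier_le u))

/-- Convolution with an inverse Fourier transform is a Fourier multiplier. -/
theorem integral_fourierInv_sub_mul {w u : V → ℂ} (hw : Integrable w) (hu : Integrable u) (x : V) :
    ∫ y, 𝓕⁻ w (x - y) * u y = 𝓕⁻ (fun η => w η * 𝓕 u η) x := by
  have hwx : Integrable (fun η => (Real.fourierChar (inner ℝ η x) : ℂ) * w η) := by
    have := (Real.fourierIntegral_convergent_iff (V := V) (μ := volume) (f := w) (-x)).2 hw
    simpa [Circle.smul_def] using this
  have e : ∀ y, 𝓕⁻ w (x - y) = 𝓕 (fun η => (Real.fourierChar (inner ℝ η x) : ℂ) * w η) y := by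
    intro y
    rw [Real.fourierInv_eq, Real.fourier_eq]
    refine integral_congr_ae (ae_of_all _ fun η => ?_)
    beta_reduce
    rw [show inner ℝ η (x - y) = -inner ℝ η y + inner ℝ η x by rw [inner_sub_right]; ring,
      AddChar.map_add_eq_mul]
    simp only [Circle.smul_def, smul_eq_mul, Circle.coe_mul, mul_assoc]
  simp_rw [e]
  rw [integral_fourier_mul_eq_flip hwx hu, Real.fourierInv_eq]
  refine integral_congr_ae (ae_of_all _ fun η => ?_)
  simp only [Circle.smul_def, smul_eq_mul, mul_assoc]

/-- The bilinear form `(u, v) ↦ ∫ w û v̂(-·)` of the Fourier multiplier `w`. -/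
noncomputable def multForm (w u v : V → ℂ) : ℂ := ∫ η, w η * 𝓕 u η * 𝓕 v (-η)

/-- Passes to the physical side, where the form has convolution kernel `𝓕⁻ w`; a sup bound on the
kernel is then an `L¹ × L¹` bound on the form. -/
theorem multForm_eq_integral {w u v : V → ℂ} (hw : Integrable w) (hu : Integrable u)
    (hv : Integrable v) : multForm w u v = ∫ x, (∫ y, 𝓕⁻ w (x - y) * u y) * v x := by
  simp_rw [integral_fourierInv_sub_mul hw hu]
  rw [integral_fourierInv_mul_eq_flip (integrable_mul_fourier hw hu) hv]
  simp_rw [Real.fourierInv_eq_fourier_neg]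
  rfl

theorem integrable_multForm {w u v : V → ℂ} (hw : Integrable w) (hu : Integrable u)
    (hv : Integrable v) : Integrable fun η => w η * 𝓕 u η * 𝓕 v (-η) :=
  (integrable_mul_fourier hw hu).mul_bdd (c := ∫ y, ‖v y‖)
    ((continuous_fourier_of_integrable hv).comp continuous_neg).aestronglyMeasurable
    (ae_of_all _ fun x => norm_fourier_le v (-x))

theorem fourier_add_apply {u v : V → ℂ} (hu : Integrable u) (hv : Integrable v) (η : V) :
    𝓕 (fun x => u x + v x) η = 𝓕 u η + 𝓕 v η := by
  simp only [Real.fourier_eq, smul_add]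
  exact integral_add ((Real.fourierIntegral_convergent_iff η).2 hu)
    ((Real.fourierIntegral_convergent_iff η).2 hv)

theorem fourier_const_mul_apply (c : ℂ) (u : V → ℂ) (η : V) :
    𝓕 (fun x => c * u x) η = c * 𝓕 u η := by
  simp only [Real.fourier_eq, ← integral_const_mul, Circle.smul_def, smul_eq_mul, mul_left_comm]

theorem isBoundedBilin_multForm {w : V → ℂ} (hw : Integrable w) {M : ℝ}
    (hM : ∀ x, ‖𝓕⁻ w x‖ ≤ M) : IsBoundedBilin volume volume (multForm w) M where
  add_left f f' g hf hf' hg := by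
    simp only [multForm, fourier_add_apply hf hf', mul_add, add_mul]
    exact integral_add (integrable_multForm hw hf hg) (integrable_multForm hw hf' hg)
  smul_left c f g _ _ := by
    simp only [multForm, fourier_const_mul_apply, ← integral_const_mul]
    congr 1; ext η; ring
  add_right f g g' hf hg hg' := by
    simp only [multForm, fourier_add_apply hg hg', mul_add]
    exact integral_add (integrable_multForm hw hf hg) (integrable_multForm hw hf hg')
  smul_right c f g _ _ := by
    simp only [multForm, fourier_const_mul_apply, ← integral_const_mul]
    congr 1; ext η; ring
  bound f g hf hg := by
    rw [multForm_eq_integral hw hf hg]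
    have h1 : ∀ x, ‖∫ y, 𝓕⁻ w (x - y) * f y‖ ≤ M * ∫ y, ‖f y‖ := fun x => by
      rw [← integral_const_mul]
      refine norm_integral_le_of_norm_le (hf.norm.const_mul M) (ae_of_all _ fun y => ?_)
      rw [norm_mul]
      exact mul_le_mul_of_nonneg_right (hM _) (norm_nonneg _)
    rw [← integral_const_mul]
    refine norm_integral_le_of_norm_le (hg.norm.const_mul _) (ae_of_all _ fun x => ?_)
    rw [norm_mul]
    exact mul_le_mul_of_nonneg_right (h1 x) (norm_nonneg _)

theorem fourier_conj (u : V → ℂ) (η : V) :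
    𝓕 (fun x => starRingEnd ℂ (u x)) η = starRingEnd ℂ (𝓕 u (-η)) := by
  simp only [Real.fourier_eq', ← integral_conj, smul_eq_mul, map_mul, ← Complex.exp_conj,
    inner_neg_right]
  congr 1; ext x; congr 2
  simp [Complex.conj_ofNat]

/-- **Plancherel's theorem** for integrable square-integrable functions. -/
theorem plancherel {u : V → ℂ} (hu : Integrable u) (hu2 : MemLp u 2) :
    MemLp (𝓕 u) 2 ∧ eLpNorm (𝓕 u) 2 volume = eLpNorm u 2 volume := by
  -- The `L²` Fourier transform and the Fourier integral have the same pairing with every test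
  -- function, by the multiplication formula, so they agree almost everywhere and the `L²` isometry
  -- carries over.
  have hae : (𝓕 (hu2.toLp u) : Lp ℂ 2 (volume : Measure V)) =ᵐ[volume] 𝓕 u := by
    refine ae_eq_of_integral_contDiff_smul_eq ((Lp.memLp _).locallyIntegrable (by norm_num))
      (continuous_fourier_of_integrable hu).locallyIntegrable fun g hg hgc => ?_
    have hg₁ : HasCompactSupport (Complex.ofRealCLM ∘ g) := hgc.comp_left rfl
    have hg₂ : ContDiff ℝ ∞ (Complex.ofRealCLM ∘ g) := by fun_prop
    set φ := hg₁.toSchwartzMap hg₂ with hφ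
    have h1 : ∫ x, g x • (𝓕 (hu2.toLp u) : Lp ℂ 2 (volume : Measure V)) x =
        (Lp.toTemperedDistribution (𝓕 (hu2.toLp u))) φ := by
      simp [hφ]
    rw [h1, ← Lp.fourier_toTemperedDistribution_eq, TemperedDistribution.fourier_apply,
      Lp.toTemperedDistribution_apply]
    calc ∫ x, (𝓕 φ) x • (hu2.toLp u) x = ∫ x, (𝓕 (φ : V → ℂ)) x * u x := by
          refine integral_congr_ae ?_
          filter_upwards [hu2.coeFn_toLp] with x hx
          rw [hx, smul_eq_mul, SchwartzMap.fourier_coe]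
      _ = ∫ x, φ x * 𝓕 u x := integral_fourier_mul_eq_flip φ.integrable hu
      _ = _ := by simp [hφ]
  constructor
  · exact (memLp_congr_ae hae).1 (Lp.memLp _)
  · rw [← eLpNorm_congr_ae hae, ← eLpNorm_congr_ae hu2.coeFn_toLp]
    have := Lp.norm_fourier_eq (hu2.toLp u)
    rw [Lp.norm_def, Lp.norm_def] at this
    exact (ENNReal.toReal_eq_toReal_iff' (Lp.memLp _).2.ne (Lp.memLp _).2.ne).1 this

theorem plancherel_integral {u : V → ℂ} (hu : Integrable u) (hu2 : MemLp u 2) :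
    Integrable (fun x => ‖𝓕 u x‖ ^ (2 : ℝ)) ∧
      ∫ x, ‖𝓕 u x‖ ^ (2 : ℝ) = ∫ x, ‖u x‖ ^ (2 : ℝ) := by
  obtain ⟨h1, h2⟩ := plancherel hu hu2
  have e1 := h1.eLpNorm_eq_integral_rpow_norm (by norm_num) (by norm_num)
  have e2 := hu2.eLpNorm_eq_integral_rpow_norm (by norm_num) (by norm_num)
  refine ⟨by simpa using h1.integrable_norm_rpow (by norm_num) (by norm_num), ?_⟩
  rw [h2, e2, ENNReal.ofReal_eq_ofReal_iff (by positivity) (by positivity)] at e1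
  have e := (Real.rpow_left_inj (integral_nonneg fun x => by positivity)
    (integral_nonneg fun x => by positivity) (by norm_num)).1 e1
  simpa using e.symm

theorem integrable_norm_rpow_of_bounded {X : Type*} [MeasurableSpace X] {μ : Measure X}
    {u : X → ℂ} (hu : Integrable u μ) {C : ℝ} (hC : ∀ x, ‖u x‖ ≤ C) {p : ℝ} (hp : 1 ≤ p) :
    Integrable (fun x => ‖u x‖ ^ p) μ := by
  refine (hu.norm.const_mul (C ^ (p - 1))).mono'
    (hu.1.norm.aemeasurable.pow_const p).aestronglyMeasurable (ae_of_all _ fun x => ?_)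
  rw [Real.norm_of_nonneg (by positivity)]
  calc ‖u x‖ ^ p = ‖u x‖ ^ (p - 1) * ‖u x‖ := by
        nth_rewrite 3 [← Real.rpow_one ‖u x‖]
        rw [← Real.rpow_add_of_nonneg (norm_nonneg _) (by linarith) zero_le_one, sub_add_cancel]
    _ ≤ _ := by gcongr; exact hC x

/-- Cauchy–Schwarz on the frequency side and Plancherel; this is the `L² × L²` endpoint for the
slices. -/
theorem norm_multForm_le {w u v : V → ℂ} {W : ℝ} (hW : 0 ≤ W) (hw : ∀ η, ‖w η‖ ≤ W)
    (hu : Integrable u) (hv : Integrable v) (hu2 : MemLp u 2) (hv2 : MemLp v 2) :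
    ‖multForm w u v‖ ≤ W * (∫ x, ‖u x‖ ^ (2 : ℝ)) ^ (1 / 2 : ℝ) *
      (∫ x, ‖v x‖ ^ (2 : ℝ)) ^ (1 / 2 : ℝ) := by
  obtain ⟨hu1, _⟩ := plancherel hu hu2
  obtain ⟨hv1, _⟩ := plancherel hv hv2
  have hv1' : MemLp (fun η => 𝓕 v (-η)) 2 :=
    hv1.comp_measurePreserving (Measure.measurePreserving_neg volume)
  have hH : ∫ η, ‖𝓕 u η‖ * ‖𝓕 v (-η)‖ ≤ (∫ η, ‖𝓕 u η‖ ^ (2 : ℝ)) ^ (1 / 2 : ℝ) *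
      (∫ η, ‖𝓕 v (-η)‖ ^ (2 : ℝ)) ^ (1 / 2 : ℝ) :=
    integral_mul_norm_le_Lp_mul_Lq (p := 2) (q := 2)
      (Real.holderConjugate_iff.2 ⟨by norm_num, by norm_num⟩) (by simpa using hu1)
      (by simpa using hv1')
  rw [integral_neg_eq_self (fun η => ‖𝓕 v η‖ ^ (2 : ℝ)) volume, (plancherel_integral hu hu2).2,
    (plancherel_integral hv hv2).2] at hH
  calc ‖multForm w u v‖ ≤ ∫ η, W * (‖𝓕 u η‖ * ‖𝓕 v (-η)‖) := by
        refine norm_integral_le_of_norm_le ?_ (ae_of_all _ fun η => ?_)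
        · exact (hu1.norm.integrable_mul hv1'.norm).const_mul W
        · rw [norm_mul, norm_mul, mul_assoc]
          exact mul_le_mul_of_nonneg_right (hw η) (by positivity)
    _ ≤ _ := by
        rw [integral_const_mul, mul_assoc]
        exact mul_le_mul_of_nonneg_left hH hW

end

/-! ### Van der Corput's lemma for the phase `α r + β / r`. -/

/-- A second derivative test: `van der Corput`'s lemma for the phase `α r + β / r` on `[1, 2]`,
with `β > 0`. -/
theorem norm_integral_oscillatory_le_of_pos {α β K : ℝ} (hβ : 0 < β) {c c' : ℝ → ℝ}
    (hc : ∀ r ∈ Set.Icc (1 : ℝ) 2, HasDerivAt c (c' r) r) (hc' : ContinuousOn c' (Set.Icc 1 2))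
    (hK : ∀ r ∈ Set.Icc (1 : ℝ) 2, |c r| ≤ K) (hK' : ∀ r ∈ Set.Icc (1 : ℝ) 2, |c' r| ≤ K) :
    ‖∫ r in (1 : ℝ)..2, (c r : ℂ) * Complex.exp ((α * r + β / r : ℝ) * Complex.I)‖ ≤
      40 * K / √β := by
  have hK0 : 0 ≤ K := (abs_nonneg _).trans (hK 1 (by norm_num))
  set b := √β with hb
  have hb0 : 0 < b := Real.sqrt_pos.2 hβ
  have hbb : b ^ 2 = β := Real.sq_sqrt hβ.le
  set φ : ℝ → ℝ := fun r => α * r + β / r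
  set φ' : ℝ → ℝ := fun r => α - β / r ^ 2
  set φ'' : ℝ → ℝ := fun r => 2 * β / r ^ 3
  have hpos : ∀ r ∈ Set.Icc (1 : ℝ) 2, 0 < r := fun r hr => by linarith [hr.1]
  have hφ : ∀ r ∈ Set.Icc (1 : ℝ) 2, HasDerivAt φ (φ' r) r := fun r hr => by
    have h0 := (hpos r hr).ne'
    have h := ((hasDerivAt_id r).const_mul α).add ((hasDerivAt_inv h0).const_mul β)
    refine h.congr_deriv ?_
    simp only [φ']; field_simp; ring
  have hφ' : ∀ r ∈ Set.Icc (1 : ℝ) 2, HasDerivAt φ' (φ'' r) r := fun r hr => by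
    have h0 := (hpos r hr).ne'
    have h := (((hasDerivAt_pow 2 r).inv (by positivity)).const_mul β).const_sub α
    refine h.congr_deriv ?_
    simp only [φ'']; field_simp; norm_num; ring
  have hD : ∀ r, 0 < φ' r ^ 2 + β := fun r => by positivity
  -- A regularised `1 / φ'`: it agrees with it up to constants when `|φ'| ≥ √β` and stays below `1 /
  -- (2√β)` everywhere, so one can integrate by parts across a stationary point without splitting
  -- the interval.
  set g : ℝ → ℝ := fun r => φ' r / (φ' r ^ 2 + β)
  set g' : ℝ → ℝ := fun r => φ'' r * (β - φ' r ^ 2) / (φ' r ^ 2 + β) ^ 2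
  have hg : ∀ r ∈ Set.Icc (1 : ℝ) 2, HasDerivAt g (g' r) r := fun r hr => by
    have h := (hφ' r hr).div (((hφ' r hr).pow 2).add_const β) (hD r).ne'
    refine h.congr_deriv ?_
    simp only [g', Pi.pow_apply]; push_cast; ring
  have hgle : ∀ r, |g r| ≤ 1 / (2 * b) := fun r => by
    simp only [g]
    rw [abs_div, abs_of_pos (hD r), div_le_div_iff₀ (hD r) (by positivity), ← hbb, ← sq_abs (φ' r)]
    nlinarith [sq_nonneg (|φ' r| - b)]
  have hφ''pos : ∀ r ∈ Set.Icc (1 : ℝ) 2, 0 < φ'' r := fun r hr => by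
    have := hpos r hr; positivity
  have hφ''ge : ∀ r ∈ Set.Icc (1 : ℝ) 2, β ≤ 4 * φ'' r := fun r hr => by
    have h0 := hpos r hr
    have h8 : r ^ 3 ≤ 8 := by
      have := pow_le_pow_left₀ h0.le hr.2 3; norm_num at this; exact this
    simp only [φ'']
    rw [mul_div_assoc', le_div_iff₀ (by positivity)]
    nlinarith
  have hg'le : ∀ r ∈ Set.Icc (1 : ℝ) 2, |g' r| ≤ φ'' r / (φ' r ^ 2 + β) := fun r hr => by
    simp only [g']
    rw [abs_div, abs_mul, abs_of_pos (hφ''pos r hr), abs_of_pos (pow_pos (hD r) 2),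
      div_le_div_iff₀ (pow_pos (hD r) 2) (hD r), mul_assoc, pow_two (φ' r ^ 2 + β), ← mul_assoc,
      ← mul_assoc]
    have : |β - φ' r ^ 2| ≤ φ' r ^ 2 + β := abs_le.2 ⟨by nlinarith [sq_nonneg (φ' r)],
      by nlinarith [sq_nonneg (φ' r)]⟩
    have h1 := mul_le_mul_of_nonneg_left this (mul_nonneg (hφ''pos r hr).le (hD r).le)
    linarith
  -- the primitive of the dominating function
  set A : ℝ → ℝ := fun r => K / (2 * b) * r + 5 * K * (Real.arctan (φ' r / b) / b)
  -- The first term dominates `c' g`. Of the five multiples of `K φ'' / (φ'² + β)`, four dominate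
  -- the remainder `β c / (φ'² + β)` through `β ≤ 4 φ''`, and one dominates `c g'`.
  set A' : ℝ → ℝ := fun r => K / (2 * b) + 5 * K * (φ'' r / (φ' r ^ 2 + β))
  have hA : ∀ r ∈ Set.Icc (1 : ℝ) 2, HasDerivAt A (A' r) r := fun r hr => by
    have h := ((hasDerivAt_id r).const_mul (K / (2 * b))).add
      (((((hφ' r hr).div_const b).arctan).div_const b).const_mul (5 * K))
    refine h.congr_deriv ?_
    simp only [A']
    have h1 : φ' r ^ 2 + b ^ 2 ≠ 0 := by rw [hbb]; exact (hD r).ne'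
    rw [← hbb]
    have h2 : 1 + (φ' r / b) ^ 2 = (φ' r ^ 2 + b ^ 2) / b ^ 2 := by field_simp; ring
    rw [h2]; field_simp
  set e : ℝ → ℂ := fun r => Complex.exp ((φ r : ℝ) * Complex.I)
  have he : ∀ r ∈ Set.Icc (1 : ℝ) 2, HasDerivAt e (e r * ((φ' r : ℝ) * Complex.I)) r :=
    fun r hr => ((hφ r hr).ofReal_comp.mul_const Complex.I).cexp
  have hen : ∀ r, ‖e r‖ = 1 := fun r => Complex.norm_exp_ofReal_mul_I _
  set H : ℝ → ℂ := fun r => -Complex.I * (((c r * g r : ℝ) : ℂ) * e r)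
  set H' : ℝ → ℂ := fun r => -Complex.I * (((c' r * g r + c r * g' r : ℝ) : ℂ) * e r +
    ((c r * g r : ℝ) : ℂ) * (e r * ((φ' r : ℝ) * Complex.I)))
  have hH : ∀ r ∈ Set.Icc (1 : ℝ) 2, HasDerivAt H (H' r) r := fun r hr =>
    ((((hc r hr).mul (hg r hr)).ofReal_comp).mul (he r hr)).const_mul _
  have hcc : ContinuousOn c (Set.Icc 1 2) := fun r hr => (hc r hr).continuousAt.continuousWithinAt
  have hec : ContinuousOn e (Set.Icc 1 2) := fun r hr => (he r hr).continuousAt.continuousWithinAt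
  have hφ'c : ContinuousOn φ' (Set.Icc 1 2) :=
    fun r hr => (hφ' r hr).continuousAt.continuousWithinAt
  have hgc : ContinuousOn g (Set.Icc 1 2) :=
    fun r hr => (hg r hr).continuousAt.continuousWithinAt
  have hφ''c : ContinuousOn φ'' (Set.Icc 1 2) :=
    continuousOn_const.div (continuousOn_id.pow 3) fun r hr => by
      have := hpos r hr; simpa using this.ne'
  have hg'c : ContinuousOn g' (Set.Icc 1 2) :=
    (hφ''c.mul (continuousOn_const.sub (hφ'c.pow 2))).div
      (((hφ'c.pow 2).add continuousOn_const).pow 2) fun r _ => (pow_pos (hD r) 2).ne'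
  have hA'c : ContinuousOn A' (Set.Icc 1 2) :=
    continuousOn_const.add (continuousOn_const.mul (hφ''c.div
      ((hφ'c.pow 2).add continuousOn_const) fun r _ => (hD r).ne'))
  have ofR : ∀ {u : ℝ → ℝ}, ContinuousOn u (Set.Icc 1 2) →
      ContinuousOn (fun r => (u r : ℂ)) (Set.Icc 1 2) :=
    fun hu => Complex.continuous_ofReal.comp_continuousOn hu
  have hH'c : ContinuousOn H' (Set.Icc 1 2) :=
    continuousOn_const.mul (((ofR ((hc'.mul hgc).add (hcc.mul hg'c))).mul hec).add
      ((ofR (hcc.mul hgc)).mul (hec.mul ((ofR hφ'c).mul continuousOn_const))))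
  have h12 : Set.uIcc (1 : ℝ) 2 = Set.Icc 1 2 := Set.uIcc_of_le (by norm_num)
  have iH : IntervalIntegrable H' volume 1 2 := (h12 ▸ hH'c).intervalIntegrable
  have iA : IntervalIntegrable A' volume 1 2 := (h12 ▸ hA'c).intervalIntegrable
  have iI : IntervalIntegrable (fun r => (c r : ℂ) * e r) volume 1 2 :=
    (h12 ▸ ((ofR hcc).mul hec)).intervalIntegrable
  have ftcH := intervalIntegral.integral_eq_sub_of_hasDerivAt (fun r hr => hH r (h12 ▸ hr)) iH
  have ftcA := intervalIntegral.integral_eq_sub_of_hasDerivAt (fun r hr => hA r (h12 ▸ hr)) iA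
  have hdiff : ‖∫ r in (1 : ℝ)..2, ((c r : ℂ) * e r - H' r)‖ ≤ A 2 - A 1 := by
    rw [← ftcA]
    refine intervalIntegral.norm_integral_le_of_norm_le (by norm_num) (ae_of_all _ ?_) iA
    intro r hr'
    have hr : r ∈ Set.Icc (1 : ℝ) 2 := Set.Ioc_subset_Icc_self hr'
    -- Since `φ' g = 1 - β / (φ'² + β)`, subtracting the exact derivative `H'` leaves that last
    -- fraction and the terms where the derivative falls on `c` or `g`.
    have e1 : (c r : ℂ) * e r - H' r =
        (((β / (φ' r ^ 2 + β) * c r : ℝ) : ℂ) +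
          Complex.I * ((c' r * g r + c r * g' r : ℝ) : ℂ)) * e r := by
      have h1 : c r * g r * φ' r = c r - β / (φ' r ^ 2 + β) * c r := by
        simp only [g]; field_simp [(hD r).ne']; ring
      have h2 : (c r : ℂ) * g r * φ' r = c r - ((β / (φ' r ^ 2 + β) * c r : ℝ) : ℂ) := by
        rw [← Complex.ofReal_sub, ← h1]; push_cast; ring
      simp only [H']
      rw [sub_eq_iff_eq_add]
      have hI : Complex.I * Complex.I = -1 := Complex.I_mul_I
      push_cast at h2 ⊢
      linear_combination (-e r) * h2 + (e r) * (c r * g r * φ' r) * hI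
    rw [e1, norm_mul, hen, mul_one]
    refine (norm_add_le _ _).trans ?_
    rw [norm_mul, Complex.norm_I, one_mul, Complex.norm_real, Complex.norm_real, Real.norm_eq_abs,
      Real.norm_eq_abs, abs_mul, abs_of_pos (div_pos hβ (hD r))]
    have t1 : β / (φ' r ^ 2 + β) * |c r| ≤ 4 * (φ'' r / (φ' r ^ 2 + β)) * K := by
      rw [mul_div_assoc']
      have := hD r
      exact mul_le_mul (div_le_div_of_nonneg_right (hφ''ge r hr) this.le) (hK r hr)
        (abs_nonneg _) (by have := hφ''pos r hr; positivity)
    have t2 : |c' r * g r| ≤ K * (1 / (2 * b)) := by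
      rw [abs_mul]; exact mul_le_mul (hK' r hr) (hgle r) (abs_nonneg _) hK0
    have t3 : |c r * g' r| ≤ K * (φ'' r / (φ' r ^ 2 + β)) := by
      rw [abs_mul]; exact mul_le_mul (hK r hr) (hg'le r hr) (abs_nonneg _) hK0
    have t4 := abs_add_le (c' r * g r) (c r * g' r)
    have t5 : K / (2 * b) = K * (1 / (2 * b)) := by ring
    simp only [A']
    rw [t5]; linarith
  have hHle : ∀ r ∈ Set.Icc (1 : ℝ) 2, ‖H r‖ ≤ K * (1 / (2 * b)) := fun r hr => by
    simp only [H]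
    rw [norm_mul, norm_neg, Complex.norm_I, one_mul, norm_mul, hen, mul_one, Complex.norm_real,
      Real.norm_eq_abs, abs_mul]
    exact mul_le_mul (hK r hr) (hgle r) (abs_nonneg _) hK0
  -- The arctangent varies by less than `π < 4` whatever `φ'` is, so the bound does not depend on
  -- `α`.
  have hAle : A 2 - A 1 ≤ K * (1 / (2 * b)) + 5 * K * (4 / b) := by
    have a1 := Real.arctan_lt_pi_div_two (φ' 2 / b)
    have a2 := Real.neg_pi_div_two_lt_arctan (φ' 1 / b)
    have a3 : Real.arctan (φ' 2 / b) / b - Real.arctan (φ' 1 / b) / b ≤ 4 / b := by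
      rw [← sub_div]
      exact div_le_div_of_nonneg_right (by linarith [Real.pi_lt_four]) hb0.le
    have := mul_le_mul_of_nonneg_left a3 (by positivity : 0 ≤ 5 * K)
    simp only [A]
    have t5 : K / (2 * b) = K * (1 / (2 * b)) := by ring
    rw [t5]; linarith
  rw [intervalIntegral.integral_sub iI iH, ftcH] at hdiff
  have h2 := hHle 2 (by norm_num)
  have h1 := hHle 1 (by norm_num)
  have n1 : ‖∫ r in (1 : ℝ)..2, (c r : ℂ) * e r‖ ≤
      ‖(∫ r in (1 : ℝ)..2, (c r : ℂ) * e r) - (H 2 - H 1)‖ + (‖H 2‖ + ‖H 1‖) := by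
    have := norm_add_le ((∫ r in (1 : ℝ)..2, (c r : ℂ) * e r) - (H 2 - H 1)) (H 2 - H 1)
    rw [sub_add_cancel] at this
    linarith [norm_sub_le (H 2) (H 1)]
  refine n1.trans ?_
  have : 40 * K / b = 80 * (K * (1 / (2 * b))) := by field_simp; ring
  have h3 : 5 * K * (4 / b) = 40 * (K * (1 / (2 * b))) := by field_simp; ring
  have h4 : 0 ≤ K * (1 / (2 * b)) := by positivity
  linarith

/-- `van der Corput`'s lemma for the phase `α r + β / r` on `[1, 2]`. -/
theorem norm_integral_oscillatory_le {α β K : ℝ} (hβ : β ≠ 0) {c c' : ℝ → ℝ}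
    (hc : ∀ r ∈ Set.Icc (1 : ℝ) 2, HasDerivAt c (c' r) r) (hc' : ContinuousOn c' (Set.Icc 1 2))
    (hK : ∀ r ∈ Set.Icc (1 : ℝ) 2, |c r| ≤ K) (hK' : ∀ r ∈ Set.Icc (1 : ℝ) 2, |c' r| ≤ K) :
    ‖∫ r in (1 : ℝ)..2, (c r : ℂ) * Complex.exp ((α * r + β / r : ℝ) * Complex.I)‖ ≤
      40 * K / √|β| := by
  rcases lt_or_gt_of_ne hβ with h | h
  -- The amplitude being real, conjugation reverses the sign of the phase and preserves the norm.
  · have key := norm_integral_oscillatory_le_of_pos (α := -α) (neg_pos.2 h) hc hc' hK hK'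
    rw [abs_of_neg h]
    refine le_trans (le_of_eq ?_) key
    rw [← RCLike.norm_conj, ← intervalIntegral.intervalIntegral_conj]
    congr 2; ext r
    simp only [map_mul, Complex.conj_ofReal, ← Complex.exp_conj, Complex.conj_I]
    congr 2; push_cast; ring
  · rw [abs_of_pos h]
    exact norm_integral_oscillatory_le_of_pos h hc hc' hK hK'

/-! ### Splitting coordinates, and complex Gaussians. -/

/-- Splitting off the `i`-th coordinate of Euclidean space. -/
noncomputable def splitEquiv {N : ℕ} (i : Fin (N + 1)) :
    EuclideanSpace ℝ (Fin (N + 1)) ≃ᵐ ℝ × EuclideanSpace ℝ (Fin N) :=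
  (MeasurableEquiv.toLp 2 (Fin (N + 1) → ℝ)).symm.trans
    ((MeasurableEquiv.piFinSuccAbove (fun _ => ℝ) i).trans
      ((MeasurableEquiv.refl ℝ).prodCongr (MeasurableEquiv.toLp 2 (Fin N → ℝ))))

theorem splitEquiv_apply {N : ℕ} (i : Fin (N + 1)) (x : EuclideanSpace ℝ (Fin (N + 1))) :
    splitEquiv i x = (x i, WithLp.toLp 2 fun j => x (i.succAbove j)) := rfl

theorem measurePreserving_splitEquiv {N : ℕ} (i : Fin (N + 1)) :
    MeasurePreserving (splitEquiv i) :=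
  (((MeasurePreserving.id volume).prod (PiLp.volume_preserving_toLp (Fin N))).comp
    (volume_preserving_piFinSuccAbove (fun _ => ℝ) i)).comp
    (PiLp.volume_preserving_ofLp (Fin (N + 1)))

theorem splitEquiv_symm_same {N : ℕ} (i : Fin (N + 1)) (q : ℝ × EuclideanSpace ℝ (Fin N)) :
    (splitEquiv i).symm q i = q.1 :=
  congrArg Prod.fst ((splitEquiv i).apply_symm_apply q)

theorem splitEquiv_symm_succAbove {N : ℕ} (i : Fin (N + 1)) (q : ℝ × EuclideanSpace ℝ (Fin N))
    (j : Fin N) : (splitEquiv i).symm q (i.succAbove j) = q.2 j := by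
  have h : (WithLp.toLp 2 fun j => (splitEquiv i).symm q (i.succAbove j)) = q.2 :=
    congrArg Prod.snd ((splitEquiv i).apply_symm_apply q)
  exact congrArg (fun v : EuclideanSpace ℝ (Fin N) => v j) h

theorem integral_split {N : ℕ} (i : Fin (N + 1)) {F : EuclideanSpace ℝ (Fin (N + 1)) → ℂ}
    (hF : Integrable F) :
    ∫ x, F x = ∫ t : ℝ, ∫ y, F ((splitEquiv i).symm (t, y)) := by
  have h := ((measurePreserving_splitEquiv i).symm _)
  rw [← h.integral_comp' F, Measure.volume_eq_prod, integral_prod]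
  exact (h.integrable_comp_emb (MeasurableEquiv.measurableEmbedding _)).2 hF

theorem inner_split {N : ℕ} (i : Fin (N + 1)) (x y : EuclideanSpace ℝ (Fin (N + 1))) :
    inner ℝ x y = x i * y i +
      inner ℝ (splitEquiv i x).2 (splitEquiv i y).2 := by
  simp only [PiLp.inner_apply, splitEquiv_apply, RCLike.inner_apply, conj_trivial]
  rw [Fin.sum_univ_succAbove _ i, mul_comm]

/-- The sign of the `i`-th square in `|η'|² - |η''|²`. -/
def sgn {n : ℕ} (k : ℕ) (i : Fin n) : ℝ := if (i : ℕ) + 1 < k then 1 else -1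

theorem abs_sgn {n : ℕ} (k : ℕ) (i : Fin n) : |sgn k i| = 1 := by
  unfold sgn; split_ifs <;> simp

theorem graphFun_eq {n : ℕ} (k : ℕ) (ρ : ℝ) (t : EuclideanSpace ℝ (Fin (n + 1))) :
    graphFun k ρ t = (∑ i : Fin n, sgn k i * t i.succ ^ 2 + ρ) / (2 * t 0) := by
  unfold graphFun normSqFst normSqSnd
  rw [← Finset.sum_sub_distrib]
  congr 3
  ext i
  unfold sgn
  by_cases h : (i : ℕ) + 1 < k
  · simp [h, not_le.2 h]
  · simp [h, not_lt.1 h]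

/-- The complex Gaussian integral. -/
theorem integral_gaussian_fourier {b : ℂ} (hb : 0 < b.re) (x : ℝ) :
    ∫ y : ℝ, Complex.exp (2 * Real.pi * Complex.I * (x * y)) *
      Complex.exp (-Real.pi * b * y ^ 2) =
      (1 / b) ^ (1 / 2 : ℂ) * Complex.exp (-Real.pi * x ^ 2 * (1 / b)) := by
  have hπ : (Real.pi : ℂ) ≠ 0 := by exact_mod_cast Real.pi_ne_zero
  have hb0 : b ≠ 0 := fun h => by simp [h] at hb
  have h := fourierIntegral_gaussian (b := Real.pi * b)
    (by rw [Complex.re_ofReal_mul]; positivity) (2 * Real.pi * x)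
  calc _ = ∫ y : ℝ, Complex.exp (Complex.I * (2 * Real.pi * x) * y) *
        Complex.exp (-(Real.pi * b) * y ^ 2) := by
        congr 1; ext y; congr 2 <;> ring
    _ = _ := by
        rw [h]
        congr 2
        · field_simp
        · field_simp; ring

/-- The reciprocal of the complex width `δ - i ε t / r` of a chirped Gaussian. -/
noncomputable def chirp (δ t ε r : ℝ) : ℂ := 1 / ((δ : ℂ) - Complex.I * ((ε * t / r : ℝ) : ℂ))

section chirp

variable {δ t ε r : ℝ}

theorem chirp_denom_ne (ht : t ≠ 0) (hε : |ε| = 1) (hr : 0 < r) :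
    (δ : ℂ) - Complex.I * ((ε * t / r : ℝ) : ℂ) ≠ 0 := by
  intro h
  have := congrArg Complex.im h
  have hε0 : ε ≠ 0 := fun h => by simp [h] at hε
  simp only [Complex.sub_im, Complex.ofReal_im, Complex.mul_im, Complex.I_re, Complex.I_im,
    Complex.ofReal_re, Complex.zero_im] at this
  have h2 : ε * t / r ≠ 0 := by positivity
  exact h2 (by linarith)

theorem norm_chirp_le (ht : t ≠ 0) (hε : |ε| = 1) (hr : r ∈ Set.Icc (1 : ℝ) 2) :
    ‖chirp δ t ε r‖ ≤ 2 / |t| := by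
  have hr0 : 0 < r := by linarith [hr.1]
  have ht0 : 0 < |t| := abs_pos.2 ht
  have h1 : |t| / r ≤ ‖(δ : ℂ) - Complex.I * ((ε * t / r : ℝ) : ℂ)‖ := by
    refine le_trans (le_of_eq ?_) (Complex.abs_im_le_norm _)
    simp [abs_div, abs_mul, hε, abs_of_pos hr0]
  rw [chirp, norm_div, norm_one]
  calc 1 / ‖(δ : ℂ) - Complex.I * ((ε * t / r : ℝ) : ℂ)‖ ≤ 1 / (|t| / r) :=
        one_div_le_one_div_of_le (by positivity) h1
    _ = r / |t| := by field_simp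
    _ ≤ _ := div_le_div_of_nonneg_right hr.2 ht0.le

theorem chirp_re_nonneg (hδ : 0 ≤ δ) : 0 ≤ (chirp δ t ε r).re := by
  rw [chirp, one_div, Complex.inv_re]
  exact div_nonneg (by simpa using hδ) (Complex.normSq_nonneg _)

/-- The exponential has modulus at most one because the chirp has nonnegative real part. The bound
is uniform in `δ`, so it also dominates the passage `δ → 0`. -/
theorem norm_chirp_gaussian_le (hδ : 0 ≤ δ) (ht : t ≠ 0) (hε : |ε| = 1)
    (hr : r ∈ Set.Icc (1 : ℝ) 2) (x : ℝ) :
    ‖chirp δ t ε r ^ (1 / 2 : ℂ) * Complex.exp (-Real.pi * x ^ 2 * chirp δ t ε r)‖ ≤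
      √(2 / |t|) := by
  rw [norm_mul, show (1 / 2 : ℂ) = ((1 / 2 : ℝ) : ℂ) by push_cast; rfl, Complex.norm_cpow_real,
    ← Real.sqrt_eq_rpow]
  have h1 : ‖Complex.exp (-Real.pi * x ^ 2 * chirp δ t ε r)‖ ≤ 1 := by
    rw [Complex.norm_exp, Real.exp_le_one_iff,
      show (-Real.pi * x ^ 2 * chirp δ t ε r : ℂ) =
        ((-(Real.pi * x ^ 2) : ℝ) : ℂ) * chirp δ t ε r by push_cast; ring, Complex.re_ofReal_mul]
    have := chirp_re_nonneg (t := t) (ε := ε) (r := r) hδ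
    have := Real.pi_pos
    have : 0 ≤ Real.pi * x ^ 2 * (chirp δ t ε r).re := by positivity
    linarith
  calc _ ≤ √(2 / |t|) * 1 :=
        mul_le_mul (Real.sqrt_le_sqrt (norm_chirp_le ht hε hr)) h1 (norm_nonneg _)
          (Real.sqrt_nonneg _)
    _ = _ := mul_one _

theorem chirp_zero (ht : t ≠ 0) (hε : |ε| = 1) (hr : 0 < r) :
    chirp 0 t ε r = r * (((ε / t : ℝ) : ℂ) * Complex.I) := by
  have hε2 : (ε : ℂ) ^ 2 = 1 := by
    have : ε ^ 2 = 1 := by rw [← sq_abs, hε]; norm_num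
    exact_mod_cast this
  have hd := chirp_denom_ne (δ := 0) ht hε hr
  rw [chirp, div_eq_iff hd]
  have h1 : (t : ℂ) ≠ 0 := by exact_mod_cast ht
  have h2 : (r : ℂ) ≠ 0 := by exact_mod_cast hr.ne'
  push_cast
  field_simp
  linear_combination (t : ℂ) * (ε : ℂ) ^ 2 * Complex.I_sq - t * hε2

/-- At `δ = 0` the chirp is a nonzero imaginary number, off the cut of the principal square root;
continuity of the root there allows `δ → 0`. -/
theorem chirp_zero_mem_slitPlane (ht : t ≠ 0) (hε : |ε| = 1) (hr : 0 < r) :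
    chirp 0 t ε r ∈ Complex.slitPlane := by
  rw [chirp_zero ht hε hr]
  right
  have hε0 : ε ≠ 0 := fun h => by simp [h] at hε
  simp only [← mul_assoc, ← Complex.ofReal_mul, Complex.mul_I_im, Complex.ofReal_re]
  positivity

theorem tendsto_chirp (ht : t ≠ 0) (hε : |ε| = 1) (hr : 0 < r) :
    Filter.Tendsto (fun δ => chirp δ t ε r) (nhds 0) (nhds (chirp 0 t ε r)) := by
  have h : ContinuousAt (fun δ : ℝ => chirp δ t ε r) 0 := by
    unfold chirp
    exact ContinuousAt.div continuousAt_const (by fun_prop) (chirp_denom_ne ht hε hr)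
  exact h

/-- A positive factor can be pulled out of the principal root, which separates the `r`-dependence
`√r` from a factor depending on `t` alone. -/
theorem chirp_zero_cpow (ht : t ≠ 0) (hε : |ε| = 1) (hr : 0 < r) :
    chirp 0 t ε r ^ (1 / 2 : ℂ) = √r * (((ε / t : ℝ) : ℂ) * Complex.I) ^ (1 / 2 : ℂ) := by
  have hε0 : ε ≠ 0 := fun h => by simp [h] at hε
  have hz : ((ε / t : ℝ) : ℂ) * Complex.I ≠ 0 :=
    mul_ne_zero (by exact_mod_cast div_ne_zero hε0 ht) Complex.I_ne_zero
  have hr' : (r : ℂ) ≠ 0 := by exact_mod_cast hr.ne'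
  rw [chirp_zero ht hε hr, Complex.cpow_def_of_ne_zero (mul_ne_zero hr' hz),
    Complex.log_ofReal_mul hr hz, add_mul, Complex.exp_add, ← Complex.cpow_def_of_ne_zero hz]
  congr 1
  rw [Real.sqrt_eq_rpow, Complex.ofReal_cpow hr.le, Complex.cpow_def_of_ne_zero hr',
    Complex.ofReal_log hr.le]
  push_cast; rfl

end chirp

/-! ### The model kernel and the dispersive estimate. -/

section

variable {n : ℕ} (k : ℕ) (ρ t : ℝ)

/-- The Gaussian regularization of `e^{2πi t 𝓖_ρ}` over the slab `η₁ ∈ [1, 2]`. -/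
noncomputable def regChirp (δ : ℝ) (η : EuclideanSpace ℝ (Fin (n + 1))) : ℂ :=
  Set.indicator {η : EuclideanSpace ℝ (Fin (n + 1)) | η 0 ∈ Set.Icc (1 : ℝ) 2} (fun η =>
    Complex.exp (2 * Real.pi * Complex.I * (t * graphFun k ρ η : ℝ)) *
      Complex.exp (-Real.pi * δ * (∑ i : Fin n, η i.succ ^ 2 : ℝ))) η

/-- The inverse Fourier transform of `regChirp`. -/
noncomputable def regKernel (δ : ℝ) (x : EuclideanSpace ℝ (Fin (n + 1))) : ℂ :=
  ∫ r in (1 : ℝ)..2, Complex.exp ((2 * Real.pi * (x 0 * r + t * ρ / (2 * r)) : ℝ) * Complex.I) *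
    ∏ i : Fin n, (chirp δ t (sgn k i) r ^ (1 / 2 : ℂ) *
      Complex.exp (-Real.pi * x i.succ ^ 2 * chirp δ t (sgn k i) r))

theorem measurable_graphFun : Measurable (graphFun (n := n) k ρ) := by
  have : graphFun (n := n) k ρ = fun t =>
      (∑ i : Fin n, sgn k i * t i.succ ^ 2 + ρ) / (2 * t 0) := by
    ext t; exact graphFun_eq k ρ t
  rw [this]; fun_prop

theorem measurableSet_slab :
    MeasurableSet {η : EuclideanSpace ℝ (Fin (n + 1)) | η 0 ∈ Set.Icc (1 : ℝ) 2} :=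
  measurableSet_Icc.preimage (by fun_prop : Measurable fun η : EuclideanSpace ℝ (Fin (n + 1)) => η 0)

theorem measurable_regChirp (δ : ℝ) : Measurable (regChirp (n := n) k ρ t δ) := by
  refine Measurable.indicator ?_ measurableSet_slab
  have := measurable_graphFun (n := n) k ρ
  fun_prop

theorem norm_regChirp_le (δ : ℝ) (η : EuclideanSpace ℝ (Fin (n + 1))) :
    ‖regChirp k ρ t δ η‖ ≤ Set.indicator (Set.Icc (1 : ℝ) 2) (fun _ => (1 : ℝ)) (η 0) *
      ∏ i : Fin n, Real.exp (-(Real.pi * δ) * η i.succ ^ 2) := by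
  by_cases h : η 0 ∈ Set.Icc (1 : ℝ) 2
  · rw [regChirp, Set.indicator_of_mem (by exact h), Set.indicator_of_mem h, one_mul, norm_mul,
      mul_comm (2 * (Real.pi : ℂ)) Complex.I, mul_assoc, mul_comm Complex.I,
      show (2 * (Real.pi : ℂ) * ((t * graphFun k ρ η : ℝ) : ℂ)) =
        ((2 * Real.pi * (t * graphFun k ρ η) : ℝ) : ℂ) by push_cast; ring,
      Complex.norm_exp_ofReal_mul_I, one_mul, ← Real.exp_sum, ← Finset.mul_sum, Complex.norm_exp]
    apply le_of_eq
    congr 1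
    rw [show (-(Real.pi : ℂ) * δ * ((∑ i : Fin n, η i.succ ^ 2 : ℝ) : ℂ)) =
      ((-(Real.pi * δ) * ∑ i : Fin n, η i.succ ^ 2 : ℝ) : ℂ) by push_cast; ring, Complex.ofReal_re]
  · rw [regChirp, Set.indicator_of_notMem (by exact h), Set.indicator_of_notMem h]
    simp

theorem integrable_regChirp {δ : ℝ} (hδ : 0 < δ) :
    Integrable (regChirp (n := n) k ρ t δ) := by
  have h1 : Integrable (Set.indicator (Set.Icc (1 : ℝ) 2) (fun _ => (1 : ℝ))) :=
    (integrable_indicator_iff measurableSet_Icc).2 (integrableOn_const (by simp))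
  have h2 : Integrable fun y : EuclideanSpace ℝ (Fin n) =>
      ∏ i : Fin n, Real.exp (-(Real.pi * δ) * y i ^ 2) := by
    have := Integrable.fintype_prod (ι := Fin n) (μ := fun _ => (volume : Measure ℝ))
      (f := fun _ y => Real.exp (-(Real.pi * δ) * y ^ 2))
      fun _ => integrable_exp_neg_mul_sq (by positivity)
    exact (PiLp.volume_preserving_ofLp (Fin n)).integrable_comp_of_integrable this
  have h3 := (measurePreserving_splitEquiv (0 : Fin (n + 1))).integrable_comp_of_integrable
    (h1.mul_prod h2)
  refine h3.mono' (measurable_regChirp k ρ t δ).aestronglyMeasurable (ae_of_all _ fun η => ?_)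
  refine (norm_regChirp_le k ρ t δ η).trans (le_of_eq ?_)
  simp [splitEquiv_apply]

/-- For fixed `η₁ = r` the exponent is a sum over the remaining coordinates, so the integral factors
into one-dimensional Gaussians of complex width `δ - i ε t / r`, leaving only the integral in `r`.
-/
theorem fourierInv_regChirp {δ : ℝ} (hδ : 0 < δ) (x : EuclideanSpace ℝ (Fin (n + 1))) :
    𝓕⁻ (regChirp k ρ t δ) x = regKernel k ρ t δ x := by
  have hint : Integrable fun v : EuclideanSpace ℝ (Fin (n + 1)) =>
      Complex.exp ((2 * Real.pi * inner ℝ v x : ℝ) * Complex.I) • regChirp k ρ t δ v := by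
    refine ((integrable_regChirp k ρ t hδ).bdd_mul (c := 1) ?_ (ae_of_all _ fun v => ?_))
    · fun_prop
    · rw [Complex.norm_exp_ofReal_mul_I]
  rw [Real.fourierInv_eq', integral_split 0 hint, regKernel,
    intervalIntegral.integral_of_le (by norm_num), ← integral_Icc_eq_integral_Ioc,
    ← integral_indicator measurableSet_Icc]
  congr 1
  ext r
  by_cases hr : r ∈ Set.Icc (1 : ℝ) 2
  · have hr0 : 0 < r := by linarith [hr.1]
    rw [Set.indicator_of_mem hr]
    have hb : ∀ i : Fin n, 0 < ((δ : ℂ) - Complex.I * ((sgn k i * t / r : ℝ) : ℂ)).re := fun i => by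
      simpa using hδ
    have hprod := integral_fintype_prod_volume_eq_prod (𝕜 := ℂ) (ι := Fin n) (E := fun _ => ℝ)
      fun i y => Complex.exp (2 * Real.pi * Complex.I * (x i.succ * y)) *
        Complex.exp (-Real.pi * ((δ : ℂ) - Complex.I * ((sgn k i * t / r : ℝ) : ℂ)) * y ^ 2)
    have hG : ∏ i : Fin n, (chirp δ t (sgn k i) r ^ (1 / 2 : ℂ) *
        Complex.exp (-Real.pi * x i.succ ^ 2 * chirp δ t (sgn k i) r)) = _ :=
      (Finset.prod_congr rfl fun i _ => (integral_gaussian_fourier (hb i) (x i.succ)).symm).trans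
        hprod.symm
    rw [hG, ← (PiLp.volume_preserving_ofLp (Fin n)).integral_comp'
      (f := (MeasurableEquiv.toLp 2 (Fin n → ℝ)).symm), ← integral_const_mul]
    congr 1
    ext y
    have e0 : (splitEquiv (0 : Fin (n + 1))).symm (r, y) 0 = r := splitEquiv_symm_same _ _
    have ei : ∀ i : Fin n, (splitEquiv (0 : Fin (n + 1))).symm (r, y) i.succ = y i := fun i =>
      splitEquiv_symm_succAbove (0 : Fin (n + 1)) (r, y) i
    rw [regChirp, Set.indicator_of_mem (by rw [Set.mem_ofPred_eq, e0]; exact hr), smul_eq_mul,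
      ← Complex.exp_add, ← Complex.exp_add]
    simp_rw [← Complex.exp_add]
    rw [← Complex.exp_sum, ← Complex.exp_add, graphFun_eq]
    congr 1
    simp only [PiLp.inner_apply, RCLike.inner_apply, conj_trivial, Fin.sum_univ_succ, e0, ei]
    have hr' : (r : ℂ) ≠ 0 := by exact_mod_cast hr0.ne'
    have e1 : ∀ i : Fin n, 2 * (Real.pi : ℂ) * Complex.I * (x i.succ * y i) +
        -Real.pi * ((δ : ℂ) - Complex.I * ((sgn k i * t / r : ℝ) : ℂ)) * y i ^ 2 =
        2 * (Real.pi : ℂ) * Complex.I * (x i.succ * y i) +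
        (-Real.pi * δ * y i ^ 2 + 2 * Real.pi * Complex.I * t * (sgn k i * y i ^ 2) / (2 * r)) := by
      intro i; push_cast; field_simp; ring
    have e2 : ∀ i : Fin n, ((MeasurableEquiv.toLp 2 (Fin n → ℝ)).symm y) i = y i := fun i => rfl
    simp only [e2, e1, Finset.sum_add_distrib, ← Finset.mul_sum, ← Finset.sum_div]
    push_cast
    field_simp
    ring
  · rw [Set.indicator_of_notMem hr]
    refine integral_eq_zero_of_ae (ae_of_all _ fun y => ?_)
    have e0 : (splitEquiv (0 : Fin (n + 1))).symm (r, y) 0 = r := splitEquiv_symm_same _ _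
    have h : (splitEquiv (0 : Fin (n + 1))).symm (r, y) ∉
        {η : EuclideanSpace ℝ (Fin (n + 1)) | η 0 ∈ Set.Icc (1 : ℝ) 2} := by
      rw [Set.mem_ofPred_eq, e0]; exact hr
    have h0 : regChirp k ρ t δ ((splitEquiv (0 : Fin (n + 1))).symm (r, y)) = 0 :=
      Set.indicator_of_notMem h _
    beta_reduce
    rw [h0, smul_zero]; rfl

end

section

variable {n : ℕ} (k : ℕ) (ρ : ℝ) {t : ℝ}

theorem norm_regKernel_integrand_le (ht : t ≠ 0) {δ : ℝ} (hδ : 0 ≤ δ)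
    (x : EuclideanSpace ℝ (Fin (n + 1))) {r : ℝ} (hr : r ∈ Set.Icc (1 : ℝ) 2) :
    ‖Complex.exp ((2 * Real.pi * (x 0 * r + t * ρ / (2 * r)) : ℝ) * Complex.I) *
    ∏ i : Fin n, (chirp δ t (sgn k i) r ^ (1 / 2 : ℂ) *
      Complex.exp (-Real.pi * x i.succ ^ 2 * chirp δ t (sgn k i) r))‖ ≤ √(2 / |t|) ^ n := by
  rw [norm_mul, Complex.norm_exp_ofReal_mul_I, one_mul, norm_prod]
  calc _ ≤ ∏ _i : Fin n, √(2 / |t|) := Finset.prod_le_prod (fun _ _ => norm_nonneg _)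
        fun i _ => norm_chirp_gaussian_le hδ ht (abs_sgn k i) hr _
    _ = _ := by rw [Finset.prod_const, Finset.card_univ, Fintype.card_fin]

/-- The interval `[1, 2]` has length one, so the sup bound of the integrand is already the
`|t|^{-n/2}` decay, uniform in `ρ`. -/
theorem norm_regKernel_le (ht : t ≠ 0) {δ : ℝ} (hδ : 0 ≤ δ) (x : EuclideanSpace ℝ (Fin (n + 1))) :
    ‖regKernel k ρ t δ x‖ ≤ √(2 / |t|) ^ n := by
  have := intervalIntegral.norm_integral_le_of_norm_le_const (a := 1) (b := 2)
    fun r hr => norm_regKernel_integrand_le k ρ ht hδ x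
      (Set.Ioc_subset_Icc_self (Set.uIoc_of_le (by norm_num : (1 : ℝ) ≤ 2) ▸ hr))
  norm_num at this
  simpa [regKernel] using this

theorem continuousOn_regKernel_integrand {δ : ℝ} (hδ : 0 < δ) (ht : t ≠ 0)
    (x : EuclideanSpace ℝ (Fin (n + 1))) :
    ContinuousOn (fun r : ℝ =>
      Complex.exp ((2 * Real.pi * (x 0 * r + t * ρ / (2 * r)) : ℝ) * Complex.I) *
    ∏ i : Fin n, (chirp δ t (sgn k i) r ^ (1 / 2 : ℂ) *
      Complex.exp (-Real.pi * x i.succ ^ 2 * chirp δ t (sgn k i) r))) (Set.Icc 1 2) := by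
  have hpos : ∀ r ∈ Set.Icc (1 : ℝ) 2, r ≠ 0 := fun r hr => by linarith [hr.1]
  have hc : ∀ i : Fin n, ContinuousOn (fun r => chirp δ t (sgn k i) r) (Set.Icc 1 2) := fun i => by
    unfold chirp
    refine continuousOn_const.div (continuousOn_const.sub (continuousOn_const.mul
      (Complex.continuous_ofReal.comp_continuousOn
        (continuousOn_const.div continuousOn_id hpos)))) fun r hr => ?_
    exact chirp_denom_ne ht (abs_sgn k i) (by linarith [hr.1])
  refine ContinuousOn.mul ?_ (continuousOn_finsetProd _ fun i _ => ContinuousOn.mul ?_ ?_)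
  · refine Complex.continuous_exp.comp_continuousOn (ContinuousOn.mul ?_ continuousOn_const)
    refine Complex.continuous_ofReal.comp_continuousOn (continuousOn_const.mul
      ((continuousOn_const.mul continuousOn_id).add (continuousOn_const.div
        (continuousOn_const.mul continuousOn_id) fun r hr => ?_)))
    exact mul_ne_zero two_ne_zero (hpos r hr)
  · refine (hc i).cpow continuousOn_const fun r hr => ?_
    left
    rw [chirp, one_div, Complex.inv_re]
    refine div_pos (by simpa using hδ) (Complex.normSq_pos.2 ?_)
    exact chirp_denom_ne ht (abs_sgn k i) (by linarith [hr.1])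
  · exact Complex.continuous_exp.comp_continuousOn (continuousOn_const.mul (hc i))

theorem tendsto_regKernel (ht : t ≠ 0) (x : EuclideanSpace ℝ (Fin (n + 1))) :
    Filter.Tendsto (fun δ => regKernel k ρ t δ x) (nhdsWithin 0 (Set.Ioi 0))
      (nhds (regKernel k ρ t 0 x)) := by
  refine intervalIntegral.tendsto_integral_filter_of_dominated_convergence
    (fun _ => √(2 / |t|) ^ n) ?_ ?_ intervalIntegrable_const ?_
  · filter_upwards [self_mem_nhdsWithin] with δ hδ
    rw [Set.uIoc_of_le (by norm_num)]
    exact ((continuousOn_regKernel_integrand k ρ hδ ht x).mono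
      Set.Ioc_subset_Icc_self).aestronglyMeasurable measurableSet_Ioc
  · filter_upwards [self_mem_nhdsWithin] with δ hδ
    refine ae_of_all _ fun r hr => norm_regKernel_integrand_le k ρ ht (le_of_lt hδ) x ?_
    exact Set.Ioc_subset_Icc_self (Set.uIoc_of_le (by norm_num : (1 : ℝ) ≤ 2) ▸ hr)
  · refine ae_of_all _ fun r hr => ?_
    have hr' : r ∈ Set.Icc (1 : ℝ) 2 :=
      Set.Ioc_subset_Icc_self (Set.uIoc_of_le (by norm_num : (1 : ℝ) ≤ 2) ▸ hr)
    have hr0 : 0 < r := by linarith [hr'.1]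
    refine Filter.Tendsto.const_mul _ (tendsto_finsetProd _ fun i _ => ?_)
    have h := (tendsto_chirp ht (abs_sgn k i) hr0).mono_left
      (nhdsWithin_le_nhds (s := Set.Ioi 0))
    exact (h.cpow tendsto_const_nhds (chirp_zero_mem_slitPlane ht (abs_sgn k i) hr0)).mul
      ((Complex.continuous_exp.tendsto _).comp (h.const_mul _))

/-- The limit kernel is an oscillatory integral with a phase that is linear up to the term
`t ρ / (2 r)`. -/
theorem regKernel_zero (ht : t ≠ 0) (x : EuclideanSpace ℝ (Fin (n + 1))) :
    regKernel k ρ t 0 x =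
      (∏ i : Fin n, (((sgn k i / t : ℝ) : ℂ) * Complex.I) ^ (1 / 2 : ℂ)) *
      ∫ r in (1 : ℝ)..2, ((√r ^ n : ℝ) : ℂ) *
        Complex.exp ((2 * Real.pi * (x 0 - ∑ i : Fin n, sgn k i * x i.succ ^ 2 / (2 * t)) * r +
          Real.pi * (t * ρ) / r : ℝ) * Complex.I) := by
  rw [regKernel, ← intervalIntegral.integral_const_mul]
  refine intervalIntegral.integral_congr fun r hr' => ?_
  have hr : r ∈ Set.Icc (1 : ℝ) 2 := by rwa [Set.uIcc_of_le (by norm_num)] at hr'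
  have hr0 : 0 < r := by linarith [hr.1]
  have hr1 : (r : ℂ) ≠ 0 := by exact_mod_cast hr0.ne'
  have ht1 : (t : ℂ) ≠ 0 := by exact_mod_cast ht
  have e1 : ∀ i : Fin n, chirp 0 t (sgn k i) r ^ (1 / 2 : ℂ) *
      Complex.exp (-Real.pi * x i.succ ^ 2 * chirp 0 t (sgn k i) r) =
      √r * (((sgn k i / t : ℝ) : ℂ) * Complex.I) ^ (1 / 2 : ℂ) *
      Complex.exp ((2 * Real.pi * (-(sgn k i * x i.succ ^ 2 / (2 * t))) * r : ℝ) * Complex.I) := by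
    intro i
    rw [chirp_zero_cpow ht (abs_sgn k i) hr0, chirp_zero ht (abs_sgn k i) hr0]
    congr 2
    push_cast
    field_simp
  beta_reduce
  rw [Finset.prod_congr rfl fun i _ => e1 i, Finset.prod_mul_distrib, Finset.prod_mul_distrib,
    ← Complex.exp_sum, Finset.prod_const, Finset.card_univ, Fintype.card_fin]
  rw [mul_left_comm, ← Complex.exp_add, ← Finset.sum_mul, ← add_mul]
  have e2 : ((2 * Real.pi * (x 0 * r + t * ρ / (2 * r)) : ℝ) : ℂ) +
      ∑ i : Fin n, ((2 * Real.pi * (-(sgn k i * x i.succ ^ 2 / (2 * t))) * r : ℝ) : ℂ) =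
      ((2 * Real.pi * (x 0 - ∑ i : Fin n, sgn k i * x i.succ ^ 2 / (2 * t)) * r +
          Real.pi * (t * ρ) / r : ℝ) : ℂ) := by
    rw [← Complex.ofReal_sum, ← Complex.ofReal_add]
    congr 1
    rw [← Finset.sum_mul, ← Finset.mul_sum, Finset.sum_neg_distrib]
    field_simp
    ring
  rw [e2]
  push_cast
  ring

/-- Van der Corput with `β = π t ρ`. All dependence on `x` sits in the coefficient of the linear
term, which the lemma ignores. -/
theorem norm_regKernel_zero_le (ht : t ≠ 0) (hρ : ρ ≠ 0) (x : EuclideanSpace ℝ (Fin (n + 1))) :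
    ‖regKernel k ρ t 0 x‖ ≤ √(1 / |t|) ^ n * (40 * ((n + 1) * 2 ^ n) / √|t * ρ|) := by
  have ht0 : 0 < |t| := abs_pos.2 ht
  have htρ : 0 < |t * ρ| := abs_pos.2 (mul_ne_zero ht hρ)
  have hprod : ‖∏ i : Fin n, (((sgn k i / t : ℝ) : ℂ) * Complex.I) ^ (1 / 2 : ℂ)‖ =
      √(1 / |t|) ^ n := by
    rw [norm_prod]
    refine (Finset.prod_congr rfl fun i _ => ?_).trans (b := ∏ _i : Fin n, √(1 / |t|))
      (by rw [Finset.prod_const, Finset.card_univ, Fintype.card_fin])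
    rw [show (1 / 2 : ℂ) = ((1 / 2 : ℝ) : ℂ) by push_cast; rfl, Complex.norm_cpow_real,
      ← Real.sqrt_eq_rpow, norm_mul, Complex.norm_I, mul_one, Complex.norm_real, Real.norm_eq_abs,
      abs_div, abs_sgn]
  rw [regKernel_zero k ρ ht, norm_mul, hprod]
  refine mul_le_mul_of_nonneg_left ?_ (by positivity)
  have hs : ∀ r ∈ Set.Icc (1 : ℝ) 2, 1 ≤ √r ∧ √r ≤ 2 := fun r hr =>
    ⟨Real.one_le_sqrt.2 hr.1, (Real.sqrt_le_left (by norm_num)).2 (by linarith [hr.2])⟩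
  have hn1 : (1 : ℝ) ≤ n + 1 := by linarith [(Nat.cast_nonneg n : (0 : ℝ) ≤ n)]
  -- The value of `K` covers both the amplitude `√r ^ n ≤ 2 ^ n` and its derivative, which is at
  -- most `n * 2 ^ n` as `1 ≤ √r ≤ 2`.
  have h := norm_integral_oscillatory_le
    (α := 2 * Real.pi * (x 0 - ∑ i : Fin n, sgn k i * x i.succ ^ 2 / (2 * t)))
    (β := Real.pi * (t * ρ)) (K := (n + 1) * 2 ^ n) (c := fun r => √r ^ n)
    (c' := fun r => n * √r ^ (n - 1) * (1 / (2 * √r)))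
    (mul_ne_zero Real.pi_ne_zero (mul_ne_zero ht hρ)) ?_ ?_ ?_ ?_
  · refine h.trans (div_le_div_of_nonneg_left (by positivity) (by positivity) ?_)
    apply Real.sqrt_le_sqrt
    rw [abs_mul Real.pi, abs_of_pos Real.pi_pos]
    exact le_mul_of_one_le_left htρ.le (by linarith [Real.pi_gt_three])
  · intro r hr
    exact (Real.hasDerivAt_sqrt (by linarith [hr.1])).pow n
  · refine ContinuousOn.mul (by fun_prop) (continuousOn_const.div (by fun_prop) fun r hr => ?_)
    have := (hs r hr).1
    positivity
  · intro r hr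
    obtain ⟨h1, h2⟩ := hs r hr
    rw [abs_of_nonneg (by positivity)]
    have := pow_le_pow_left₀ (by positivity) h2 n
    have h3 : (0 : ℝ) < 2 ^ n := by positivity
    nlinarith
  · intro r hr
    obtain ⟨h1, h2⟩ := hs r hr
    rw [abs_of_nonneg (by positivity)]
    have h4 : √r ^ (n - 1) ≤ 2 ^ n := (pow_le_pow_left₀ (by positivity) h2 _).trans
      (pow_le_pow_right₀ (by norm_num) (by omega))
    have h5 : 1 / (2 * √r) ≤ 1 := by
      rw [div_le_one (by positivity)]; linarith
    calc (n : ℝ) * √r ^ (n - 1) * (1 / (2 * √r)) ≤ (n : ℝ) * 2 ^ n * 1 := by gcongr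
      _ ≤ _ := by
        rw [mul_one]; gcongr; linarith

/-- The chirped amplitude `e^{2πi t 𝓖_ρ} û`. -/
noncomputable def chirped (t : ℝ) (β : EuclideanSpace ℝ (Fin (n + 1)) → ℂ)
    (η : EuclideanSpace ℝ (Fin (n + 1))) : ℂ :=
  Complex.exp (2 * Real.pi * Complex.I * (t * graphFun k ρ η : ℝ)) * β η

/-- The multiplier `e^{2πi t 𝓖_ρ}` need not be integrable over the slab. A Gaussian factor gives it
an honest kernel, and both sides of the convolution identity converge as `δ → 0⁺` by dominated
convergence. -/
theorem fourierInv_chirped_eq (ht : t ≠ 0) {u : EuclideanSpace ℝ (Fin (n + 1)) → ℂ}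
    (hu : Integrable u) (hu' : Integrable (𝓕 u))
    (hsupp : ∀ η : EuclideanSpace ℝ (Fin (n + 1)), η 0 ∉ Set.Icc (1 : ℝ) 2 → 𝓕 u η = 0)
    (x : EuclideanSpace ℝ (Fin (n + 1))) :
    𝓕⁻ (chirped k ρ t (𝓕 u)) x = ∫ y, regKernel k ρ t 0 (x - y) * u y := by
  have hpos : ∀ᶠ δ : ℝ in nhdsWithin 0 (Set.Ioi 0), 0 < δ := self_mem_nhdsWithin
  have hM : ∀ δ : ℝ, 0 ≤ δ → ∀ η : EuclideanSpace ℝ (Fin (n + 1)), ‖regChirp k ρ t δ η‖ ≤ 1 := by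
    intro δ hδ η
    refine (norm_regChirp_le k ρ t δ η).trans (mul_le_one₀ ?_ ?_ ?_)
    · exact Set.indicator_le_self' (fun _ _ => zero_le_one) _
    · exact Finset.prod_nonneg fun _ _ => (Real.exp_pos _).le
    · refine Finset.prod_le_one (fun _ _ => (Real.exp_pos _).le) fun i _ => ?_
      have := Real.pi_pos
      rw [Real.exp_le_one_iff, neg_mul, neg_nonpos]
      positivity
  have hlim1 : Filter.Tendsto (fun δ : ℝ => 𝓕⁻ (fun η => regChirp k ρ t δ η * 𝓕 u η) x)
      (nhdsWithin 0 (Set.Ioi 0)) (nhds (𝓕⁻ (chirped k ρ t (𝓕 u)) x)) := by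
    simp only [Real.fourierInv_eq']
    refine tendsto_integral_filter_of_dominated_convergence (fun η => ‖𝓕 u η‖) ?_ ?_ hu'.norm ?_
    · filter_upwards with δ
      have hc : Continuous fun v : EuclideanSpace ℝ (Fin (n + 1)) =>
          Complex.exp ((2 * Real.pi * inner ℝ v x : ℝ) * Complex.I) := by fun_prop
      refine hc.aestronglyMeasurable.smul
        ((measurable_regChirp k ρ t δ).aestronglyMeasurable.mul hu'.1)
    · filter_upwards [hpos] with δ hδ
      refine ae_of_all _ fun η => ?_
      rw [norm_smul, Complex.norm_exp_ofReal_mul_I, one_mul, norm_mul]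
      exact mul_le_of_le_one_left (norm_nonneg _) (hM δ hδ.le η)
    · refine ae_of_all _ fun η => ?_
      refine Filter.Tendsto.const_smul ?_ _
      by_cases hη : η 0 ∈ Set.Icc (1 : ℝ) 2
      · refine Filter.Tendsto.mul_const _ ?_
        have : ∀ δ : ℝ, regChirp k ρ t δ η =
            Complex.exp (2 * Real.pi * Complex.I * (t * graphFun k ρ η : ℝ)) *
            Complex.exp (-Real.pi * δ * (∑ i : Fin n, η i.succ ^ 2 : ℝ)) := fun δ => by
          rw [regChirp, Set.indicator_of_mem (by exact hη)]
        simp only [this]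
        have h0 : Continuous fun δ : ℝ =>
            Complex.exp (2 * Real.pi * Complex.I * (t * graphFun k ρ η : ℝ)) *
            Complex.exp (-Real.pi * δ * (∑ i : Fin n, η i.succ ^ 2 : ℝ)) := by fun_prop
        have := h0.tendsto 0
        simp only [Complex.ofReal_zero, mul_zero, zero_mul, Complex.exp_zero, mul_one] at this
        exact this.mono_left nhdsWithin_le_nhds
      · simp only [chirped, hsupp η hη, mul_zero]
        exact tendsto_const_nhds
  have hlim2 : Filter.Tendsto (fun δ : ℝ => ∫ y, 𝓕⁻ (regChirp k ρ t δ) (x - y) * u y)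
      (nhdsWithin 0 (Set.Ioi 0)) (nhds (∫ y, regKernel k ρ t 0 (x - y) * u y)) := by
    refine tendsto_integral_filter_of_dominated_convergence (fun y => √(2 / |t|) ^ n * ‖u y‖)
      ?_ ?_ (hu.norm.const_mul _) ?_
    · filter_upwards [hpos] with δ hδ
      refine AEStronglyMeasurable.mul (Continuous.aestronglyMeasurable ?_) hu.1
      exact (continuous_fourierInv_of_integrable (integrable_regChirp k ρ t hδ)).comp
        (by fun_prop : Continuous fun y => x - y)
    · filter_upwards [hpos] with δ hδ
      refine ae_of_all _ fun y => ?_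
      rw [norm_mul, fourierInv_regChirp k ρ t hδ]
      exact mul_le_mul_of_nonneg_right (norm_regKernel_le k ρ ht hδ.le _) (norm_nonneg _)
    · refine ae_of_all _ fun y => Filter.Tendsto.mul_const _ ?_
      refine (tendsto_regKernel k ρ ht (x - y)).congr' ?_
      filter_upwards [hpos] with δ hδ
      rw [fourierInv_regChirp k ρ t hδ]
  refine tendsto_nhds_unique hlim1 (hlim2.congr' ?_)
  filter_upwards [hpos] with δ hδ
  exact integral_fourierInv_sub_mul (integrable_regChirp k ρ t hδ) hu x

/-- The **dispersive estimate** in terms of an `L^∞` bound of the model kernel. -/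
theorem norm_fourierInv_chirped_le_of (ht : t ≠ 0) {u : EuclideanSpace ℝ (Fin (n + 1)) → ℂ}
    (hu : Integrable u) (hu' : Integrable (𝓕 u))
    (hsupp : ∀ η : EuclideanSpace ℝ (Fin (n + 1)), η 0 ∉ Set.Icc (1 : ℝ) 2 → 𝓕 u η = 0) {A : ℝ}
    (hA : ∀ x : EuclideanSpace ℝ (Fin (n + 1)), ‖regKernel k ρ t 0 x‖ ≤ A)
    (x : EuclideanSpace ℝ (Fin (n + 1))) :
    ‖𝓕⁻ (chirped k ρ t (𝓕 u)) x‖ ≤ A * ∫ y, ‖u y‖ := by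
  rw [fourierInv_chirped_eq k ρ ht hu hu' hsupp, ← integral_const_mul]
  refine norm_integral_le_of_norm_le (hu.norm.const_mul _) (ae_of_all _ fun y => ?_)
  rw [norm_mul]
  exact mul_le_mul_of_nonneg_right (hA _) (norm_nonneg _)

end

/-! ### Extension by zero across the boundary of a closed set, and temperate growth. -/

section

variable {E : Type*} [NormedAddCommGroup E] [NormedSpace ℝ E]

open Classical in
/-- The derivatives of `h` within `S`, extended by zero. -/
noncomputable def gluedSeries (S : Set E) (h : E → ℂ) (x : E) : FormalMultilinearSeries ℝ E ℂ :=
  fun N => if x ∈ S then iteratedFDerivWithin ℝ N h S x else 0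

theorem gluedSeries_of_mem {S : Set E} {h : E → ℂ} {x : E} (hx : x ∈ S) (N : ℕ) :
    gluedSeries S h x N = iteratedFDerivWithin ℝ N h S x := if_pos hx

theorem gluedSeries_of_notMem {S : Set E} {h : E → ℂ} {x : E} (hx : x ∉ S) (N : ℕ) :
    gluedSeries S h x N = 0 := if_neg hx

/-- If `f` is smooth and vanishes off a closed set `S` on which `g` is smooth, then `f g` has a
Taylor series on the whole space, given by the derivatives within `S`. -/
theorem hasFTaylorSeriesUpTo_mul_of_eq_zero {S : Set E} (hS : IsClosed S)
    (hSu : UniqueDiffOn ℝ S) {f g : E → ℂ} (hf : ContDiff ℝ ∞ f) (hf0 : ∀ x ∉ S, f x = 0)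
    (hg : ContDiffOn ℝ ∞ g S) :
    HasFTaylorSeriesUpTo ∞ (fun x => f x * g x) (gluedSeries S fun x => f x * g x) := by
  set h := fun x => f x * g x with hh
  have hhS : ContDiffOn ℝ ∞ h S := hf.contDiffOn.mul hg
  -- At a boundary point all derivatives of `f` vanish, by continuity from the complement. Leibniz's
  -- rule puts some derivative of `f` in every term, so the product is flat there.
  have hvan : ∀ x ∈ S, x ∈ closure Sᶜ → ∀ N : ℕ, iteratedFDerivWithin ℝ N h S x = 0 := by
    intro x hx hxc N
    have hD : ∀ i : ℕ, iteratedFDeriv ℝ i f x = 0 := by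
      intro i
      have hcont : Continuous (iteratedFDeriv ℝ i f) :=
        hf.continuous_iteratedFDeriv (mod_cast le_top)
      have hzero : ∀ y ∈ Sᶜ, iteratedFDeriv ℝ i f y = 0 := by
        intro y hy
        have hfy : Filter.EventuallyEq (nhds y) f fun _ => 0 := by
          filter_upwards [hS.isOpen_compl.mem_nhds hy] with z hz using hf0 z hz
        rw [← iteratedFDerivWithin_univ, Filter.EventuallyEq.iteratedFDerivWithin_eq
          (f := fun _ => (0 : ℂ)) (by rwa [nhdsWithin_univ]) (hf0 y hy), iteratedFDerivWithin_univ]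
        simp
      exact (isClosed_eq hcont continuous_const).closure_subset_iff.2 hzero hxc
    rw [← norm_le_zero_iff]
    refine (norm_iteratedFDerivWithin_mul_le hf.contDiffOn hg hSu hx
      (mod_cast le_top)).trans (le_of_eq (Finset.sum_eq_zero fun i _ => ?_))
    rw [iteratedFDerivWithin_eq_iteratedFDeriv hSu (hf.contDiffAt.of_le (mod_cast le_top)) hx, hD]
    simp
  rw [hasFTaylorSeriesUpTo_top_iff' le_rfl]
  refine ⟨fun x => ?_, fun m x => ?_⟩
  · by_cases hx : x ∈ S
    · simp [gluedSeries_of_mem hx, hh]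
    · simp [gluedSeries_of_notMem hx, hh, hf0 x hx]
  · by_cases hx : x ∈ S
    · rw [gluedSeries_of_mem hx, ← hasFDerivWithinAt_univ, ← Set.union_compl_self S]
      -- The derivative is checked within `S` and within its complement. The second check is vacuous
      -- away from the closure of the complement, and on that closure flatness makes both
      -- derivatives zero.
      refine HasFDerivWithinAt.union ?_ ?_
      · have := (hhS.ftaylorSeriesWithin hSu).fderivWithin m (mod_cast WithTop.coe_lt_top _) x hx
        exact this.congr (fun y hy => gluedSeries_of_mem hy m) (gluedSeries_of_mem hx m)
      · by_cases hxc : x ∈ closure Sᶜ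
        · rw [hvan x hx hxc]
          refine (hasFDerivWithinAt_const (0 : ContinuousMultilinearMap ℝ (fun _ : Fin m => E) ℂ)
            x Sᶜ).congr_of_eventuallyEq ?_ ?_ |>.congr_fderiv ?_
          · filter_upwards [self_mem_nhdsWithin] with y hy using gluedSeries_of_notMem hy m
          · rw [gluedSeries_of_mem hx, hvan x hx hxc]
          · ext; simp
        · exact HasFDerivWithinAt.of_notMem_closure hxc
    · rw [gluedSeries_of_notMem hx]
      refine (hasFDerivAt_const (0 : ContinuousMultilinearMap ℝ (fun _ : Fin m => E) ℂ)
        x).congr_of_eventuallyEq ?_ |>.congr_fderiv ?_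
      · filter_upwards [hS.isOpen_compl.mem_nhds hx] with y hy using gluedSeries_of_notMem hy m
      · ext; simp

theorem contDiff_mul_of_eq_zero {S : Set E} (hS : IsClosed S)
    (hSu : UniqueDiffOn ℝ S) {f g : E → ℂ} (hf : ContDiff ℝ ∞ f) (hf0 : ∀ x ∉ S, f x = 0)
    (hg : ContDiffOn ℝ ∞ g S) : ContDiff ℝ ∞ fun x => f x * g x := by
  exact (hasFTaylorSeriesUpTo_mul_of_eq_zero hS hSu hf hf0 hg).contDiff

/-- Smooth functions on `S` with polynomially bounded derivatives. -/
def TemperateOn {F : Type*} [NormedAddCommGroup F] [NormedSpace ℝ F] (S : Set E) (g : E → F) :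
    Prop :=
  ContDiffOn ℝ ∞ g S ∧ ∀ N : ℕ, ∃ (k : ℕ) (C : ℝ), ∀ x ∈ S,
    ‖iteratedFDerivWithin ℝ N g S x‖ ≤ C * (1 + ‖x‖) ^ k

/-- The product and chain rule estimates need one bound for all orders up to `N`; `1 ≤ C` ensures
that the bound is at most each of its positive powers. -/
theorem TemperateOn.uniform {F : Type*} [NormedAddCommGroup F] [NormedSpace ℝ F] {S : Set E}
    {g : E → F} (hg : TemperateOn S g) (N : ℕ) : ∃ (k : ℕ) (C : ℝ), 1 ≤ C ∧ ∀ i ≤ N, ∀ x ∈ S,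
    ‖iteratedFDerivWithin ℝ i g S x‖ ≤ C * (1 + ‖x‖) ^ k := by
  choose k C h using hg.2
  refine ⟨∑ i ∈ Finset.range (N + 1), k i, 1 + ∑ i ∈ Finset.range (N + 1), |C i|, ?_, ?_⟩
  · have : 0 ≤ ∑ i ∈ Finset.range (N + 1), |C i| := Finset.sum_nonneg fun _ _ => abs_nonneg _
    linarith
  · intro i hi x hx
    have hi' : i ∈ Finset.range (N + 1) := Finset.mem_range.2 (by omega)
    have h1 : (1 : ℝ) ≤ 1 + ‖x‖ := by linarith [norm_nonneg x]
    refine (h i x hx).trans (mul_le_mul ?_ ?_ (by positivity) ?_)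
    · have := Finset.single_le_sum (f := fun i => |C i|) (fun _ _ => abs_nonneg _) hi'
      linarith [le_abs_self (C i)]
    · exact pow_le_pow_right₀ h1 (Finset.single_le_sum (f := k) (fun _ _ => Nat.zero_le _) hi')
    · have : 0 ≤ ∑ i ∈ Finset.range (N + 1), |C i| := Finset.sum_nonneg fun _ _ => abs_nonneg _
      linarith

theorem _root_.Function.HasTemperateGrowth.temperateOn {F : Type*} [NormedAddCommGroup F]
    [NormedSpace ℝ F] {S : Set E} (hSu : UniqueDiffOn ℝ S) {g : E → F}
    (hg : g.HasTemperateGrowth) : TemperateOn S g := by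
  refine ⟨hg.1.contDiffOn, fun N => ?_⟩
  obtain ⟨k, C, h⟩ := hg.2 N
  refine ⟨k, C, fun x hx => ?_⟩
  rw [iteratedFDerivWithin_eq_iteratedFDeriv hSu (hg.1.contDiffAt.of_le (mod_cast le_top)) hx]
  exact h x

theorem TemperateOn.mul {A : Type*} [NormedRing A] [NormedAlgebra ℝ A] {S : Set E}
    (hSu : UniqueDiffOn ℝ S) {f g : E → A} (hf : TemperateOn S f) (hg : TemperateOn S g) :
    TemperateOn S fun x => f x * g x := by
  refine ⟨hf.1.mul hg.1, fun N => ?_⟩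
  obtain ⟨k, C, hC, h⟩ := hf.uniform N
  obtain ⟨k', C', hC', h'⟩ := hg.uniform N
  refine ⟨k + k', ∑ i ∈ Finset.range (N + 1), (N.choose i : ℝ) * (C * C'), fun x hx => ?_⟩
  refine (norm_iteratedFDerivWithin_mul_le hf.1 hg.1 hSu hx (mod_cast le_top)).trans ?_
  rw [Finset.sum_mul]
  refine Finset.sum_le_sum fun i hi => ?_
  have hi' : i ≤ N := by have := Finset.mem_range.1 hi; omega
  calc _ ≤ (N.choose i : ℝ) * (C * (1 + ‖x‖) ^ k) * (C' * (1 + ‖x‖) ^ k') :=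
        mul_le_mul (mul_le_mul_of_nonneg_left (h i hi' x hx) (by positivity))
          (h' _ (by omega) x hx) (norm_nonneg _) (by positivity)
    _ = _ := by rw [pow_add]; ring

theorem TemperateOn.add {F : Type*} [NormedAddCommGroup F] [NormedSpace ℝ F] {S : Set E}
    (hSu : UniqueDiffOn ℝ S) {f g : E → F} (hf : TemperateOn S f) (hg : TemperateOn S g) :
    TemperateOn S fun x => f x + g x := by
  refine ⟨hf.1.add hg.1, fun N => ?_⟩
  obtain ⟨k, C, hC, h⟩ := hf.uniform N
  obtain ⟨k', C', hC', h'⟩ := hg.uniform N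
  refine ⟨k + k', C + C', fun x hx => ?_⟩
  have h1 : (1 : ℝ) ≤ 1 + ‖x‖ := by linarith [norm_nonneg x]
  rw [show (fun x => f x + g x) = f + g from rfl,
    iteratedFDerivWithin_add_apply (hf.1.of_le (mod_cast le_top) x hx)
      (hg.1.of_le (mod_cast le_top) x hx) hSu hx]
  refine (norm_add_le _ _).trans ?_
  have e1 : C * (1 + ‖x‖) ^ k ≤ C * (1 + ‖x‖) ^ (k + k') :=
    mul_le_mul_of_nonneg_left (pow_le_pow_right₀ h1 (by omega)) (by linarith)
  have e2 : C' * (1 + ‖x‖) ^ k' ≤ C' * (1 + ‖x‖) ^ (k + k') :=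
    mul_le_mul_of_nonneg_left (pow_le_pow_right₀ h1 (by omega)) (by linarith)
  linarith [h N le_rfl x hx, h' N le_rfl x hx]

/-- The composition of a Schwartz function with a temperate function on `S`. -/
theorem TemperateOn.schwartz_comp {S : Set E} (hSu : UniqueDiffOn ℝ S) {φ : E → ℝ}
    (hφ : TemperateOn S φ) (ψ : 𝓢(ℝ, ℂ)) : TemperateOn S fun x => ψ (φ x) := by
  have hψ : ContDiff ℝ ∞ ψ := ψ.smooth ⊤
  refine ⟨hψ.comp_contDiffOn hφ.1, fun N => ?_⟩
  obtain ⟨k, C, hC, h⟩ := hφ.uniform N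
  -- Only boundedness of the derivatives of `ψ` is used, that is, the Schwartz seminorms of weight
  -- `0`.
  have hb : ∀ i : ℕ, ∃ B : ℝ, ∀ y, ‖iteratedFDeriv ℝ i ψ y‖ ≤ B := fun i => by
    obtain ⟨B, hB⟩ := ψ.decay 0 i
    exact ⟨B, fun y => by simpa using hB.2 y⟩
  choose B hB using hb
  refine ⟨k * N, N.factorial * (∑ i ∈ Finset.range (N + 1), B i) * C ^ N, fun x hx => ?_⟩
  have h1 : (1 : ℝ) ≤ 1 + ‖x‖ := by linarith [norm_nonneg x]
  have hB0 : ∀ i, 0 ≤ B i := fun i => (norm_nonneg _).trans (hB i 0)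
  have := norm_iteratedFDerivWithin_comp_le (g := ψ) (f := φ) (n := N) (s := S) (t := Set.univ)
    (C := ∑ i ∈ Finset.range (N + 1), B i) (D := C * (1 + ‖x‖) ^ k) hψ.contDiffOn hφ.1
    (mod_cast le_top) uniqueDiffOn_univ hSu (Set.mapsTo_univ _ _) hx ?_ ?_
  · refine this.trans (le_of_eq ?_)
    rw [mul_pow, pow_mul]; ring
  · intro i hi
    rw [iteratedFDerivWithin_univ]
    exact (hB i _).trans (Finset.single_le_sum (f := B) (fun i _ => hB0 i)
      (Finset.mem_range.2 (by omega)))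
  · intro i hi1 hi
    refine (h i hi x hx).trans (le_self_pow₀ ?_ (by omega))
    exact one_le_mul_of_one_le_of_one_le hC (one_le_pow₀ h1)

/-- `L ⁻¹' D` may be unbounded, but the derivatives of `f ∘ L` at `x` are controlled by those of `f`
at `L x`, which ranges over a compact set; the growth exponent is therefore `0`. -/
theorem temperateOn_of_isCompact {G F : Type*} [NormedAddCommGroup F] [NormedSpace ℝ F]
    [NormedAddCommGroup G] [NormedSpace ℝ G] {D : Set G} (hD : IsCompact D)
    (hDu : UniqueDiffOn ℝ D) (L : E →L[ℝ] G) (hSu : UniqueDiffOn ℝ (L ⁻¹' D)) {f : G → F}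
    (hf : ContDiffOn ℝ ∞ f D) : TemperateOn (L ⁻¹' D) fun x => f (L x) := by
  refine ⟨hf.comp L.contDiff.contDiffOn (Set.mapsTo_preimage _ _), fun N => ?_⟩
  obtain ⟨C, hC⟩ := hD.exists_bound_of_continuousOn
    (hf.continuousOn_iteratedFDerivWithin (m := N) (mod_cast le_top) hDu)
  refine ⟨0, C * ‖L‖ ^ N, fun x hx => ?_⟩
  have := L.iteratedFDerivWithin_comp_right hf hDu hSu (x := x) hx (i := N) (mod_cast le_top)
  rw [show (fun x => f (L x)) = f ∘ L from rfl, this]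
  refine (ContinuousMultilinearMap.norm_compContinuousLinearMap_le _ _).trans ?_
  simp only [Finset.prod_const, Finset.card_univ, Fintype.card_fin, pow_zero, mul_one]
  exact mul_le_mul_of_nonneg_right (hC _ hx) (by positivity)

theorem hasTemperateGrowth_mul_of_eq_zero {S : Set E} (hS : IsClosed S)
    (hSu : UniqueDiffOn ℝ S) {f g : E → ℂ} (hf : f.HasTemperateGrowth) (hf0 : ∀ x ∉ S, f x = 0)
    (hg : TemperateOn S g) : (fun x => f x * g x).HasTemperateGrowth := by
  have hT := hasFTaylorSeriesUpTo_mul_of_eq_zero hS hSu hf.1 hf0 hg.1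
  refine ⟨hT.contDiff, fun N => ?_⟩
  obtain ⟨k, C, hC, h⟩ := ((hf.temperateOn hSu).mul hSu hg).uniform N
  refine ⟨k, C, fun x => ?_⟩
  rw [← hT.eq_iteratedFDeriv (mod_cast le_top) x]
  by_cases hx : x ∈ S
  · rw [gluedSeries_of_mem hx]
    exact h N le_rfl x hx
  · rw [gluedSeries_of_notMem hx, norm_zero]
    positivity

end

/-! ### Geometry of `𝓓`, and regularity of the symbol and of the slice amplitudes. -/

section

variable {n : ℕ} (k : ℕ)

theorem continuous_normSqFst : Continuous (normSqFst (n := n) k) := by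
  unfold normSqFst
  refine continuous_finsetSum _ fun i _ => ?_
  split_ifs <;> fun_prop

theorem continuous_normSqSnd : Continuous (normSqSnd (n := n) k) := by
  unfold normSqSnd
  refine continuous_finsetSum _ fun i _ => ?_
  split_ifs <;> fun_prop

theorem isClosed_domainD : IsClosed (domainD (n := n) k) :=
  (isClosed_le (continuous_normSqFst k) continuous_const).inter
    ((isClosed_le (continuous_normSqSnd k) continuous_const).inter
      (isClosed_Icc.preimage (by fun_prop : Continuous fun t : EuclideanSpace ℝ (Fin (n + 1)) => t 0)))

theorem norm_sq_eq (t : EuclideanSpace ℝ (Fin (n + 1))) :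
    ‖t‖ ^ 2 = t 0 ^ 2 + (normSqFst k t + normSqSnd k t) := by
  rw [EuclideanSpace.norm_sq_eq, Fin.sum_univ_succ, normSqFst, normSqSnd, ← Finset.sum_add_distrib]
  simp only [Real.norm_eq_abs, sq_abs]
  congr 1
  refine Finset.sum_congr rfl fun i _ => ?_
  by_cases h : (i : ℕ) + 1 < k
  · simp [h, not_le.2 h]
  · simp [h, not_lt.1 h]

theorem isCompact_domainD : IsCompact (domainD (n := n) k) := by
  refine Metric.isCompact_of_isClosed_isBounded (isClosed_domainD k) ?_
  refine (Metric.isBounded_closedBall (x := (0 : EuclideanSpace ℝ (Fin (n + 1))))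
    (r := 3)).subset fun t ht => ?_
  obtain ⟨h1, h2, h3, h4⟩ := ht
  rw [mem_closedBall_zero_iff]
  refine abs_le_of_sq_le_sq' ?_ (by norm_num) |>.2
  rw [norm_sq_eq k]
  nlinarith

theorem sq_convex_comb {a b x y : ℝ} (ha : 0 ≤ a) (hb : 0 ≤ b) (hab : a + b = 1) :
    (a * x + b * y) ^ 2 ≤ a * x ^ 2 + b * y ^ 2 := by
  have : a * x ^ 2 + b * y ^ 2 - (a * x + b * y) ^ 2 = a * b * (x - y) ^ 2 := by
    have : b = 1 - a := by linarith
    rw [this]; ring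
  have h := mul_nonneg (mul_nonneg ha hb) (sq_nonneg (x - y))
  linarith

theorem convex_domainD : Convex ℝ (domainD (n := n) k) := by
  intro x hx y hy a b ha hb hab
  obtain ⟨x1, x2, x3, x4⟩ := hx
  obtain ⟨y1, y2, y3, y4⟩ := hy
  refine ⟨?_, ?_, ?_, ?_⟩
  · calc normSqFst k (a • x + b • y) ≤ a * normSqFst k x + b * normSqFst k y := by
          unfold normSqFst
          rw [Finset.mul_sum, Finset.mul_sum, ← Finset.sum_add_distrib]
          refine Finset.sum_le_sum fun i _ => ?_
          split_ifs
          · simpa using sq_convex_comb ha hb hab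
          · simp
      _ ≤ 1 := by nlinarith
  · calc normSqSnd k (a • x + b • y) ≤ a * normSqSnd k x + b * normSqSnd k y := by
          unfold normSqSnd
          rw [Finset.mul_sum, Finset.mul_sum, ← Finset.sum_add_distrib]
          refine Finset.sum_le_sum fun i _ => ?_
          split_ifs
          · simpa using sq_convex_comb ha hb hab
          · simp
      _ ≤ 1 := by nlinarith
  · simp only [PiLp.add_apply, PiLp.smul_apply, smul_eq_mul]; nlinarith
  · simp only [PiLp.add_apply, PiLp.smul_apply, smul_eq_mul]; nlinarith

theorem mem_interior_domainD : EuclideanSpace.single 0 (3 / 2 : ℝ) ∈ interior (domainD (n := n) k) := by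
  have hopen : IsOpen {t : EuclideanSpace ℝ (Fin (n + 1)) |
      normSqFst k t < 1 ∧ normSqSnd k t < 1 ∧ t 0 ∈ Set.Ioo (1 : ℝ) 2} :=
    (isOpen_lt (continuous_normSqFst k) continuous_const).inter
      ((isOpen_lt (continuous_normSqSnd k) continuous_const).inter
        (isOpen_Ioo.preimage
          (by fun_prop : Continuous fun t : EuclideanSpace ℝ (Fin (n + 1)) => t 0)))
  refine interior_maximal (t := _) ?_ hopen ?_
  · rintro t ⟨h1, h2, h3⟩
    exact ⟨h1.le, h2.le, Set.Ioo_subset_Icc_self h3⟩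
  · have h1 : normSqFst k (EuclideanSpace.single (0 : Fin (n + 1)) (3 / 2 : ℝ)) = 0 :=
      Finset.sum_eq_zero fun i _ => by simp [Fin.succ_ne_zero]
    have h2 : normSqSnd k (EuclideanSpace.single (0 : Fin (n + 1)) (3 / 2 : ℝ)) = 0 :=
      Finset.sum_eq_zero fun i _ => by simp [Fin.succ_ne_zero]
    refine ⟨by rw [h1]; norm_num, by rw [h2]; norm_num, ?_, ?_⟩ <;> norm_num [PiLp.single_apply]

theorem uniqueDiffOn_domainD : UniqueDiffOn ℝ (domainD (n := n) k) :=
  uniqueDiffOn_convex (convex_domainD k) ⟨_, mem_interior_domainD k⟩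

/-- The projection `tilde` as a continuous linear map. -/
noncomputable def tildeCLM : EuclideanSpace ℝ (Fin (n + 2)) →L[ℝ] EuclideanSpace ℝ (Fin (n + 1)) :=
  LinearMap.toContinuousLinearMap
    { toFun := tilde
      map_add' := fun _ _ => rfl
      map_smul' := fun _ _ => rfl }

theorem tildeCLM_apply (η : EuclideanSpace ℝ (Fin (n + 2))) : tildeCLM η = tilde η := rfl

theorem splitEquiv_last (η : EuclideanSpace ℝ (Fin (n + 2))) :
    splitEquiv (Fin.last (n + 1)) η = (η (Fin.last (n + 1)), tilde η) := by
  rw [splitEquiv_apply]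
  simp only [Fin.succAbove_last]
  rfl

theorem tilde_symm (q : ℝ × EuclideanSpace ℝ (Fin (n + 1))) :
    tilde ((splitEquiv (Fin.last (n + 1))).symm q) = q.2 := by
  have h := (splitEquiv (Fin.last (n + 1))).apply_symm_apply q
  rw [splitEquiv_last] at h
  exact congrArg Prod.snd h

theorem uniqueDiffOn_preimage_domainD :
    UniqueDiffOn ℝ ((tildeCLM (n := n)) ⁻¹' domainD k) := by
  refine uniqueDiffOn_convex ((convex_domainD k).linear_preimage (tildeCLM (n := n)).toLinearMap) ?_
  refine ⟨(splitEquiv (Fin.last (n + 1))).symm (0, EuclideanSpace.single 0 (3 / 2 : ℝ)), ?_⟩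
  refine preimage_interior_subset_interior_preimage (tildeCLM (n := n)).continuous ?_
  rw [Set.mem_preimage, tildeCLM_apply, tilde_symm]
  exact mem_interior_domainD k

theorem isClosed_preimage_domainD : IsClosed ((tildeCLM (n := n)) ⁻¹' domainD k) :=
  (isClosed_domainD k).preimage (tildeCLM (n := n)).continuous

theorem contDiffOn_graphFun (ρ : ℝ) : ContDiffOn ℝ ∞ (graphFun (n := n) k ρ) (domainD k) := by
  have : graphFun (n := n) k ρ = fun t =>
      (∑ i : Fin n, sgn k i * t i.succ ^ 2 + ρ) / (2 * t 0) := by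
    ext t; exact graphFun_eq k ρ t
  rw [this]
  refine ContDiffOn.div (ContDiff.contDiffOn (by fun_prop)) (ContDiff.contDiffOn (by fun_prop)) ?_
  intro t ht
  have := ht.2.2.1
  positivity

variable {χ : EuclideanSpace ℝ (Fin (n + 1)) → ℂ} {m : EuclideanSpace ℝ (Fin (n + 1)) → ℝ} {k}

theorem eq_zero_of_notMem_domainD (hχD : tsupport χ ⊆ domainD k)
    {t : EuclideanSpace ℝ (Fin (n + 1))} (ht : t ∉ domainD k) : χ t = 0 :=
  image_eq_zero_of_notMem_tsupport fun h => ht (hχD h)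

theorem hasCompactSupport_of_tsupport_subset (hχD : tsupport χ ⊆ domainD k) :
    HasCompactSupport χ :=
  (isCompact_domainD k).of_isClosed_subset (isClosed_tsupport χ) hχD

/-- Over `𝓓` the argument of `ψ` is affine in `η_d`, with coefficients smooth on the compact set
`𝓓`. The cutoff makes the extension by zero smooth even though `m` is controlled on `𝓓` only. -/
theorem hasTemperateGrowth_symbol (hχ : ContDiff ℝ ∞ χ) (hχD : tsupport χ ⊆ domainD k)
    (hm : ContDiffOn ℝ ∞ m (domainD k)) (ψ : 𝓢(ℝ, ℂ)) (ρ lam : ℝ) :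
    (symbol k χ m ψ ρ lam).HasTemperateGrowth := by
  have hu := uniqueDiffOn_preimage_domainD (n := n) k
  have hcut : (fun η : EuclideanSpace ℝ (Fin (n + 2)) => χ (tildeCLM η)).HasTemperateGrowth :=
    ((hasCompactSupport_of_tsupport_subset hχD).hasTemperateGrowth hχ).comp
      tildeCLM.hasTemperateGrowth
  refine hasTemperateGrowth_mul_of_eq_zero (isClosed_preimage_domainD k) hu hcut
    (fun η hη => eq_zero_of_notMem_domainD hχD hη) (TemperateOn.schwartz_comp hu ?_ ψ)
  have h1 : TemperateOn (tildeCLM (n := n) ⁻¹' domainD k) fun η => lam⁻¹ * m (tildeCLM η) :=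
    temperateOn_of_isCompact (f := fun t => lam⁻¹ * m t) (isCompact_domainD k)
      (uniqueDiffOn_domainD k) _ hu (contDiffOn_const.mul hm)
  have h2 : TemperateOn (tildeCLM (n := n) ⁻¹' domainD k) fun η =>
      -(lam⁻¹ * m (tildeCLM η) * graphFun k ρ (tildeCLM η)) :=
    temperateOn_of_isCompact (f := fun t => -(lam⁻¹ * m t * graphFun k ρ t)) (isCompact_domainD k)
      (uniqueDiffOn_domainD k) _ hu ((contDiffOn_const.mul hm).mul (contDiffOn_graphFun k ρ)).neg
  have h3 : TemperateOn (tildeCLM (n := n) ⁻¹' domainD k) fun η => η (Fin.last (n + 1)) :=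
    Function.HasTemperateGrowth.temperateOn hu
      (EuclideanSpace.proj (𝕜 := ℝ) (Fin.last (n + 1))).hasTemperateGrowth
  have h := (h1.mul hu h3).add hu h2
  have e : (fun η : EuclideanSpace ℝ (Fin (n + 2)) =>
      lam⁻¹ * (m (tilde η) * (η (Fin.last (n + 1)) - graphFun k ρ (tilde η)))) = fun η =>
      lam⁻¹ * m (tildeCLM η) * η (Fin.last (n + 1)) +
        -(lam⁻¹ * m (tildeCLM η) * graphFun k ρ (tildeCLM η)) := by
    funext η
    simp only [tildeCLM_apply]
    ring
  rw [e]
  exact h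

/-- The amplitude `χ(η) m(η)⁻¹ Φ(s / m(η))` of the slices of the kernel. -/
noncomputable def amp (χ : EuclideanSpace ℝ (Fin (n + 1)) → ℂ)
    (m : EuclideanSpace ℝ (Fin (n + 1)) → ℝ) (Φ : ℝ → ℂ) (s : ℝ)
    (η : EuclideanSpace ℝ (Fin (n + 1))) : ℂ :=
  χ η * (((m η)⁻¹ : ℝ) * Φ (s * (m η)⁻¹))

/-- The parameter `s` is stored as an extra coordinate, so that estimates uniform in `s` can be read
off from a single function of `n + 2` variables. -/
theorem contDiff_joint_amp (hχ : ContDiff ℝ ∞ χ) (hχD : tsupport χ ⊆ domainD k)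
    (hm : ContDiffOn ℝ ∞ m (domainD k)) (hmD : ∀ t ∈ domainD k, m t ≠ 0)
    {Φ : ℝ → ℂ} (hΦ : ContDiff ℝ ∞ Φ) :
    ContDiff ℝ ∞ fun q : EuclideanSpace ℝ (Fin (n + 2)) =>
      amp χ m Φ (q (Fin.last (n + 1))) (tildeCLM q) := by
  refine contDiff_mul_of_eq_zero (isClosed_preimage_domainD k) (uniqueDiffOn_preimage_domainD k)
    (hχ.comp tildeCLM.contDiff) (fun η hη => eq_zero_of_notMem_domainD hχD hη) ?_
  have h1 : ContDiffOn ℝ ∞ (fun q : EuclideanSpace ℝ (Fin (n + 2)) => (m (tildeCLM q))⁻¹)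
      (tildeCLM ⁻¹' domainD k) :=
    (hm.comp tildeCLM.contDiff.contDiffOn (Set.mapsTo_preimage _ _)).inv fun q hq => hmD _ hq
  have h2 : ContDiffOn ℝ ∞ (fun q : EuclideanSpace ℝ (Fin (n + 2)) => q (Fin.last (n + 1)))
      (tildeCLM ⁻¹' domainD k) := ContDiff.contDiffOn (by fun_prop)
  exact (Complex.ofRealCLM.contDiff.comp_contDiffOn h1).mul (hΦ.comp_contDiffOn (h2.mul h1))

theorem amp_eq_zero_of_lt (hχD : tsupport χ ⊆ domainD k)
    (hmD : ∀ t ∈ domainD k, 1 / 2 ≤ m t ∧ m t ≤ 2) {Φ : ℝ → ℂ} {a : ℝ}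
    (hΦa : ∀ s, a < |s| → Φ s = 0) {s : ℝ} (hs : 2 * a < |s|) (η : EuclideanSpace ℝ (Fin (n + 1))) :
    amp χ m Φ s η = 0 := by
  by_cases hη : η ∈ domainD k
  · obtain ⟨h1, h2⟩ := hmD η hη
    have h0 : 0 < m η := by linarith
    rw [amp, hΦa, mul_zero, mul_zero]
    rw [abs_mul, abs_inv, abs_of_pos h0, ← div_eq_mul_inv, lt_div_iff₀ h0]
    rcases le_or_gt a 0 with ha | ha
    · rcases eq_or_lt_of_le ha with rfl | ha'
      · linarith
      · exact (mul_neg_of_neg_of_pos ha' h0).trans_le (abs_nonneg s)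
    · nlinarith
  · rw [amp, eq_zero_of_notMem_domainD hχD hη, zero_mul]

theorem hasCompactSupport_joint_amp (hχD : tsupport χ ⊆ domainD k)
    (hmD : ∀ t ∈ domainD k, 1 / 2 ≤ m t ∧ m t ≤ 2) {Φ : ℝ → ℂ} {a : ℝ}
    (hΦa : ∀ s, a < |s| → Φ s = 0) :
    HasCompactSupport fun q : EuclideanSpace ℝ (Fin (n + 2)) =>
      amp χ m Φ (q (Fin.last (n + 1))) (tildeCLM q) := by
  refine HasCompactSupport.intro (K := {q | tildeCLM q ∈ domainD k ∧
    q (Fin.last (n + 1)) ∈ Set.Icc (-(2 * a)) (2 * a)}) ?_ ?_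
  · refine Metric.isCompact_of_isClosed_isBounded ((isClosed_preimage_domainD k).inter
      (isClosed_Icc.preimage (by fun_prop : Continuous fun q : EuclideanSpace ℝ (Fin (n + 2)) =>
        q (Fin.last (n + 1))))) ?_
    refine (Metric.isBounded_closedBall (x := (0 : EuclideanSpace ℝ (Fin (n + 2))))
      (r := 3 + 2 * |a|)).subset fun q hq => ?_
    obtain ⟨⟨h1, h2, h3, h4⟩, h5⟩ := hq
    rw [mem_closedBall_zero_iff]
    refine abs_le_of_sq_le_sq' ?_ (by positivity) |>.2
    have e : ‖q‖ ^ 2 = ‖tildeCLM q‖ ^ 2 + q (Fin.last (n + 1)) ^ 2 := by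
      rw [EuclideanSpace.norm_sq_eq, EuclideanSpace.norm_sq_eq, Fin.sum_univ_castSucc]
      simp only [Real.norm_eq_abs, sq_abs]
      rfl
    have h6 : q (Fin.last (n + 1)) ^ 2 ≤ (2 * |a|) ^ 2 := by
      refine sq_le_sq' ?_ ?_
      · linarith [h5.1, le_abs_self a]
      · linarith [h5.2, le_abs_self a]
    rw [e, norm_sq_eq k]
    nlinarith [abs_nonneg a]
  · intro q hq
    by_cases h1 : tildeCLM q ∈ domainD k
    · refine amp_eq_zero_of_lt hχD hmD hΦa ?_ _
      by_contra h
      exact hq ⟨h1, abs_le.1 (not_lt.1 h)⟩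
    · rw [amp, eq_zero_of_notMem_domainD hχD h1, zero_mul]

end

/-! ### Slicing in the last variable. -/

section

variable {n : ℕ}

/-- The slice `F(·, t)` of a function at the value `t` of the last coordinate. -/
noncomputable def slice (F : EuclideanSpace ℝ (Fin (n + 2)) → ℂ) (t : ℝ)
    (y : EuclideanSpace ℝ (Fin (n + 1))) : ℂ := F ((splitEquiv (Fin.last (n + 1))).symm (t, y))

theorem integrable_slice_prod {F : EuclideanSpace ℝ (Fin (n + 2)) → ℂ} (hF : Integrable F) :
    Integrable (fun q : ℝ × EuclideanSpace ℝ (Fin (n + 1)) => slice F q.1 q.2)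
      ((volume : Measure ℝ).prod volume) :=
  (((measurePreserving_splitEquiv (Fin.last (n + 1))).symm _).integrable_comp_emb
    (MeasurableEquiv.measurableEmbedding _)).2 hF

theorem integrable_of_slice_prod {F : EuclideanSpace ℝ (Fin (n + 2)) → ℂ}
    (hF : Integrable (fun q : ℝ × EuclideanSpace ℝ (Fin (n + 1)) => slice F q.1 q.2)
      ((volume : Measure ℝ).prod volume)) : Integrable F :=
  (((measurePreserving_splitEquiv (Fin.last (n + 1))).symm _).integrable_comp_emb
    (MeasurableEquiv.measurableEmbedding _)).1 hF

theorem inner_symm (q r : ℝ × EuclideanSpace ℝ (Fin (n + 1))) :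
    inner ℝ ((splitEquiv (Fin.last (n + 1))).symm q) ((splitEquiv (Fin.last (n + 1))).symm r) =
      q.1 * r.1 + inner ℝ q.2 r.2 := by
  rw [inner_split (Fin.last (n + 1)), splitEquiv_symm_same, splitEquiv_symm_same,
    MeasurableEquiv.apply_symm_apply, MeasurableEquiv.apply_symm_apply]

theorem symm_neg (q : ℝ × EuclideanSpace ℝ (Fin (n + 1))) :
    (splitEquiv (Fin.last (n + 1))).symm (-q) = -(splitEquiv (Fin.last (n + 1))).symm q := by
  rw [MeasurableEquiv.symm_apply_eq, splitEquiv_last]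
  have h := splitEquiv_last ((splitEquiv (Fin.last (n + 1))).symm q)
  rw [MeasurableEquiv.apply_symm_apply] at h
  conv_lhs => rw [h]
  rfl

theorem symm_sub (q r : ℝ × EuclideanSpace ℝ (Fin (n + 1))) :
    (splitEquiv (Fin.last (n + 1))).symm (q - r) =
      (splitEquiv (Fin.last (n + 1))).symm q - (splitEquiv (Fin.last (n + 1))).symm r := by
  rw [MeasurableEquiv.symm_apply_eq, splitEquiv_last]
  have h := splitEquiv_last ((splitEquiv (Fin.last (n + 1))).symm q)
  have h' := splitEquiv_last ((splitEquiv (Fin.last (n + 1))).symm r)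
  rw [MeasurableEquiv.apply_symm_apply] at h h'
  conv_lhs => rw [h, h']
  rfl

/-- The Fourier transform as an iterated Fourier transform. -/
theorem fourier_split {F : EuclideanSpace ℝ (Fin (n + 2)) → ℂ} (hF : Integrable F) (τ : ℝ)
    (ξ : EuclideanSpace ℝ (Fin (n + 1))) :
    𝓕 F ((splitEquiv (Fin.last (n + 1))).symm (τ, ξ)) =
      𝓕 (fun y => 𝓕 (fun t => slice F t y) τ) ξ := by
  have hint := (Real.fourierIntegral_convergent_iff
    ((splitEquiv (Fin.last (n + 1))).symm (τ, ξ))).2 hF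
  rw [Real.fourier_eq, integral_split (Fin.last (n + 1)) hint,
    integral_integral_swap (integrable_slice_prod hint), Real.fourier_eq]
  congr 1; ext y
  rw [Real.fourier_eq, Circle.smul_def, ← integral_smul]
  congr 1; ext t
  rw [inner_symm, neg_add, AddChar.map_add_eq_mul, Circle.smul_def, Circle.smul_def,
    Circle.coe_mul, smul_smul, mul_comm]
  simp only [slice, RCLike.inner_apply, conj_trivial, mul_comm]

theorem fourierInv_split {F : EuclideanSpace ℝ (Fin (n + 2)) → ℂ} (hF : Integrable F) (τ : ℝ)
    (ξ : EuclideanSpace ℝ (Fin (n + 1))) :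
    𝓕⁻ F ((splitEquiv (Fin.last (n + 1))).symm (τ, ξ)) =
      𝓕⁻ (fun y => 𝓕⁻ (fun t => slice F t y) τ) ξ := by
  rw [Real.fourierInv_eq_fourier_neg, ← symm_neg, Prod.neg_mk, fourier_split hF,
    Real.fourierInv_eq_fourier_neg]
  simp_rw [Real.fourierInv_eq_fourier_neg]

/-- Slices of Schwartz functions are Fourier transforms of uniformly integrable functions. -/
theorem exists_fourier_eq_slice (J : 𝓢(EuclideanSpace ℝ (Fin (n + 2)), ℂ)) (s : ℝ) :
    ∃ u : EuclideanSpace ℝ (Fin (n + 1)) → ℂ, Integrable u ∧ 𝓕 u = slice J s ∧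
      ∫ y, ‖u y‖ ≤ ∫ x, ‖(𝓕⁻ J : 𝓢(EuclideanSpace ℝ (Fin (n + 2)), ℂ)) x‖ := by
  set G := (𝓕⁻ J : 𝓢(EuclideanSpace ℝ (Fin (n + 2)), ℂ)) with hG
  have hGi : Integrable (G : EuclideanSpace ℝ (Fin (n + 2)) → ℂ) := G.integrable
  have hGp := integrable_slice_prod hGi
  have hu : Integrable fun y => 𝓕 (fun t => slice G t y) s := by
    have h1 : Integrable (fun q : ℝ × EuclideanSpace ℝ (Fin (n + 1)) =>
        Real.fourierChar (-(inner ℝ q.1 s)) • slice G q.1 q.2)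
        ((volume : Measure ℝ).prod volume) := by
      refine hGp.mono ?_ (ae_of_all _ fun q => by simp)
      refine AEStronglyMeasurable.smul ?_ hGp.1
      exact (by fun_prop : Continuous fun q : ℝ × EuclideanSpace ℝ (Fin (n + 1)) =>
        (Real.fourierChar (-(inner ℝ q.1 s)) : ℂ)).aestronglyMeasurable
    simpa only [Real.fourier_eq] using h1.integral_prod_right
  -- `u` is the Fourier transform of `G` in the last variable alone, bounded at `y` by `∫ ‖G(t, y)‖
  -- dt`; integrating in `y` gives a bound free of `s`.
  refine ⟨fun y => 𝓕 (fun t => slice G t y) s, hu, ?_, ?_⟩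
  · ext ξ
    rw [← fourier_split hGi, ← SchwartzMap.fourier_coe, hG, FourierTransform.fourier_fourierInv_eq]
    rfl
  · have h2 : ∫ x, ‖G x‖ = ∫ y, ∫ t, ‖slice G t y‖ := by
      rw [← ((measurePreserving_splitEquiv (Fin.last (n + 1))).symm _).integral_comp'
        (fun x => ‖G x‖), Measure.volume_eq_prod]
      exact integral_prod_symm _ hGp.norm
    rw [h2]
    exact integral_mono hu.norm hGp.norm.integral_prod_right fun y => norm_fourier_le _ _

end

/-! ### Slices of the kernel and the `L¹ → L^∞` bound. -/

section

variable {n : ℕ}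

/-- Translation by `𝓖_ρ` in `η_d` produces the chirp `e^{2πi t 𝓖_ρ}`, and dilation by `m / λ`
produces the amplitude `amp`. -/
theorem fourierInv_comp_affine (f : ℝ → ℂ) {c : ℝ} (hc : 0 < c) (G t : ℝ) :
    𝓕⁻ (fun τ => f (c * (τ - G))) t =
      Complex.exp (2 * Real.pi * Complex.I * ((t * G : ℝ) : ℂ)) * ((c⁻¹ : ℝ) * 𝓕⁻ f (t * c⁻¹)) := by
  rw [Real.fourierInv_eq', Real.fourierInv_eq']
  set h : ℝ → ℂ := fun σ => Complex.exp (2 * Real.pi * Complex.I * ((t * G : ℝ) : ℂ)) *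
    (Complex.exp (↑(2 * Real.pi * inner ℝ σ (t * c⁻¹)) * Complex.I) • f σ) with hh
  have e : ∀ τ : ℝ, Complex.exp (↑(2 * Real.pi * inner ℝ τ t) * Complex.I) • f (c * (τ - G)) =
      h (c * (τ - G)) := by
    intro τ
    rw [hh]
    simp only [smul_eq_mul]
    rw [← mul_assoc, ← Complex.exp_add]
    congr 2
    simp only [RCLike.inner_apply, conj_trivial]
    have hc' : (c : ℂ) ≠ 0 := by exact_mod_cast hc.ne'
    push_cast
    field_simp
    ring
  simp_rw [e]
  rw [integral_sub_right_eq_self (fun τ => h (c * τ)) G, Measure.integral_comp_mul_left h c, hh,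
    integral_const_mul, abs_of_pos (inv_pos.2 hc), Complex.real_smul]
  ring

theorem integral_norm_comp_affine (f : ℝ → ℂ) {c : ℝ} (hc : 0 < c) (G : ℝ) :
    ∫ τ, ‖f (c * (τ - G))‖ = c⁻¹ * ∫ τ, ‖f τ‖ := by
  rw [integral_sub_right_eq_self (fun τ => ‖f (c * τ)‖) G,
    Measure.integral_comp_mul_left (fun τ => ‖f τ‖) c, abs_of_pos (inv_pos.2 hc), smul_eq_mul]

/-- The hypotheses on the ingredients of the symbol. -/
structure Admissible (k : ℕ) (χ : EuclideanSpace ℝ (Fin (n + 1)) → ℂ)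
    (m : EuclideanSpace ℝ (Fin (n + 1)) → ℝ) (ψ : 𝓢(ℝ, ℂ)) (a : ℝ) : Prop where
  smooth : ContDiff ℝ ∞ χ
  support : tsupport χ ⊆ domainD k
  smooth_weight : ContDiffOn ℝ ∞ m (domainD k)
  weight : ∀ t ∈ domainD k, 1 / 2 ≤ m t ∧ m t ≤ 2
  fourier_support : ∀ s, a < |s| → 𝓕⁻ (ψ : ℝ → ℂ) s = 0

/-- The multiplier in the first variables that is the slice at `t` of the kernel. -/
noncomputable def sliceMult (k : ℕ) (χ : EuclideanSpace ℝ (Fin (n + 1)) → ℂ)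
    (m : EuclideanSpace ℝ (Fin (n + 1)) → ℝ) (ψ : 𝓢(ℝ, ℂ)) (ρ lam t : ℝ)
    (ξ : EuclideanSpace ℝ (Fin (n + 1))) : ℂ :=
  lam * chirped k ρ t (amp χ m (𝓕⁻ (ψ : ℝ → ℂ)) (lam * t)) ξ

theorem symbol_symm (k : ℕ) (χ : EuclideanSpace ℝ (Fin (n + 1)) → ℂ)
    (m : EuclideanSpace ℝ (Fin (n + 1)) → ℝ) (ψ : 𝓢(ℝ, ℂ)) (ρ lam τ : ℝ)
    (ξ : EuclideanSpace ℝ (Fin (n + 1))) :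
    slice (symbol k χ m ψ ρ lam) τ ξ =
      χ ξ * ψ (lam⁻¹ * m ξ * (τ - graphFun k ρ ξ)) := by
  rw [slice, symbol, tilde_symm, splitEquiv_symm_same, mul_assoc]

namespace Admissible

variable {k : ℕ} {χ : EuclideanSpace ℝ (Fin (n + 1)) → ℂ}
  {m : EuclideanSpace ℝ (Fin (n + 1)) → ℝ} {ψ : 𝓢(ℝ, ℂ)} {a : ℝ}

theorem weight_pos (h : Admissible k χ m ψ a) {t : EuclideanSpace ℝ (Fin (n + 1))} (ht : t ∈ domainD k) : 0 < m t := by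
  linarith [(h.weight t ht).1]

/-- All amplitudes are slices of one smooth compactly supported function, whence an `L¹` bound
uniform in `s`. Used at `s = lam * t`, it makes later constants independent of `lam` and `t`. -/
theorem exists_fourier_eq_amp (h : Admissible k χ m ψ a) : ∃ A : ℝ, 0 < A ∧ ∀ s, ∃ u : EuclideanSpace ℝ (Fin (n + 1)) → ℂ,
    Integrable u ∧ 𝓕 u = amp χ m (𝓕⁻ (ψ : ℝ → ℂ)) s ∧ ∫ y, ‖u y‖ ≤ A := by
  have hΦ : ContDiff ℝ ∞ (𝓕⁻ (ψ : ℝ → ℂ)) := by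
    have := (𝓕⁻ ψ : 𝓢(ℝ, ℂ)).smooth ⊤
    rwa [SchwartzMap.fourierInv_coe] at this
  have h1 := contDiff_joint_amp h.smooth h.support h.smooth_weight
    (fun t ht => (h.weight_pos ht).ne') hΦ
  have h2 := hasCompactSupport_joint_amp (Φ := 𝓕⁻ (ψ : ℝ → ℂ)) h.support h.weight
    h.fourier_support
  set J := h2.toSchwartzMap h1 with hJ
  set I := ∫ x, ‖(𝓕⁻ J : 𝓢(EuclideanSpace ℝ (Fin (n + 2)), ℂ)) x‖
  have hI : 0 ≤ I := integral_nonneg fun x => norm_nonneg _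
  refine ⟨I + 1, by positivity, fun s => ?_⟩
  obtain ⟨u, hu, hu1, hu2⟩ := exists_fourier_eq_slice J s
  refine ⟨u, hu, ?_, hu2.trans (by linarith)⟩
  rw [hu1]
  ext ξ
  simp only [slice, hJ, HasCompactSupport.toSchwartzMap_toFun, tildeCLM_apply, tilde_symm,
    splitEquiv_symm_same]

theorem integrable_amp (h : Admissible k χ m ψ a) (s : ℝ) : Integrable (amp χ m (𝓕⁻ (ψ : ℝ → ℂ)) s) := by
  obtain ⟨A, -, hA⟩ := h.exists_fourier_eq_amp
  obtain ⟨u, hu, hu1, -⟩ := hA s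
  rw [← hu1]
  refine (continuous_fourier_of_integrable hu).integrable_of_hasCompactSupport ?_
  refine HasCompactSupport.intro (isCompact_domainD k) fun x hx => ?_
  rw [hu1, amp, eq_zero_of_notMem_domainD h.support hx, zero_mul]

theorem integrable_sliceMult (h : Admissible k χ m ψ a) (ρ lam t : ℝ) : Integrable (sliceMult k χ m ψ ρ lam t) := by
  refine Integrable.const_mul ?_ _
  refine (h.integrable_amp (lam * t)).bdd_mul (c := 1) ?_ (ae_of_all _ fun x => ?_)
  · have := measurable_graphFun (n := n) k ρ
    exact (by fun_prop : Measurable _).aestronglyMeasurable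
  · rw [← Complex.ofReal_ofNat, ← Complex.ofReal_mul, mul_right_comm, ← Complex.ofReal_mul,
      Complex.norm_exp_ofReal_mul_I]

theorem integrable_symbol (h : Admissible k χ m ψ a) (ρ : ℝ) {lam : ℝ} (hlam : 0 < lam) :
    Integrable (symbol k χ m ψ ρ lam) := by
  refine integrable_of_slice_prod ?_
  have hcont : Continuous (symbol k χ m ψ ρ lam) :=
    (hasTemperateGrowth_symbol h.smooth h.support h.smooth_weight ψ ρ lam).1.continuous
  have hmeas : Measurable fun q : ℝ × EuclideanSpace ℝ (Fin (n + 1)) =>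
      slice (symbol k χ m ψ ρ lam) q.1 q.2 :=
    hcont.measurable.comp (splitEquiv (Fin.last (n + 1))).symm.measurable
  have hχ := hasCompactSupport_of_tsupport_subset h.support
  have hχi : Integrable χ := h.smooth.continuous.integrable_of_hasCompactSupport hχ
  refine (integrable_prod_iff' hmeas.aestronglyMeasurable).2 ⟨ae_of_all _ fun ξ => ?_, ?_⟩
  · simp only [symbol_symm]
    by_cases hξ : ξ ∈ domainD k
    · have hc : lam⁻¹ * m ξ ≠ 0 := mul_ne_zero (inv_ne_zero hlam.ne') (h.weight_pos hξ).ne'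
      exact ((ψ.integrable.comp_mul_left' hc).comp_sub_right (graphFun k ρ ξ)).const_mul _
    · simp [eq_zero_of_notMem_domainD h.support hξ]
  -- The factor `2 * lam` bounds the Jacobian `lam / m`, because `m ≥ 1/2`.
  · refine (hχi.norm.const_mul (2 * lam * ∫ τ, ‖ψ τ‖)).mono'
      hmeas.norm.aestronglyMeasurable.prod_swap.integral_prod_right' (ae_of_all _ fun ξ => ?_)
    have hψ0 : 0 ≤ ∫ τ, ‖ψ τ‖ := integral_nonneg fun _ => norm_nonneg _
    simp only [symbol_symm, norm_mul]
    rw [integral_const_mul]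
    by_cases hξ : ξ ∈ domainD k
    · have hm := h.weight_pos hξ
      rw [integral_norm_comp_affine _ (mul_pos (inv_pos.2 hlam) hm),
        Real.norm_of_nonneg (by positivity), mul_comm]
      refine mul_le_mul_of_nonneg_right (mul_le_mul_of_nonneg_right ?_ hψ0) (norm_nonneg _)
      rw [mul_inv, inv_inv, mul_comm (2 : ℝ)]
      refine mul_le_mul_of_nonneg_left ?_ hlam.le
      rw [inv_le_comm₀ hm two_pos]
      linarith [(h.weight ξ hξ).1]
    · simp [eq_zero_of_notMem_domainD h.support hξ]

/-- The slices of the kernel are inverse Fourier transforms in the first variables. -/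
theorem slice_fourierInv_symbol (h : Admissible k χ m ψ a) (ρ : ℝ) {lam : ℝ} (hlam : 0 < lam) (t : ℝ) :
    slice (𝓕⁻ (symbol k χ m ψ ρ lam)) t = 𝓕⁻ (sliceMult k χ m ψ ρ lam t) := by
  ext y
  rw [slice, fourierInv_split (h.integrable_symbol ρ hlam)]
  refine congrFun (congrArg _ (funext fun ξ => ?_)) y
  simp only [symbol_symm]
  have e : 𝓕⁻ (fun τ => χ ξ * ψ (lam⁻¹ * m ξ * (τ - graphFun k ρ ξ))) t =
      χ ξ * 𝓕⁻ (fun τ => ψ (lam⁻¹ * m ξ * (τ - graphFun k ρ ξ))) t := by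
    simp only [Real.fourierInv_eq', smul_eq_mul, mul_left_comm _ (χ ξ), integral_const_mul]
  rw [e, sliceMult, chirped, amp]
  by_cases hξ : ξ ∈ domainD k
  · have hm := h.weight_pos hξ
    rw [fourierInv_comp_affine _ (mul_pos (inv_pos.2 hlam) hm), mul_inv, inv_inv,
      show t * (lam * (m ξ)⁻¹) = lam * t * (m ξ)⁻¹ by ring]
    push_cast
    ring
  · rw [eq_zero_of_notMem_domainD h.support hξ]
    simp

/-- One function `u` with `𝓕 u` equal to the amplitude serves both endpoints: its `L¹` norm bounds
the multiplier in sup norm, and convolution with `u` preserves the sup bound of the model kernel.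
The sharp cutoff `η₁ ∈ [1, 2]` in that kernel is harmless because the amplitude lives on `𝓓`. -/
theorem exists_sliceMult_bound (h : Admissible k χ m ψ a) : ∃ A : ℝ, 0 < A ∧
    ∀ ρ lam t : ℝ, 0 < lam → (∀ ξ, ‖sliceMult k χ m ψ ρ lam t ξ‖ ≤ lam * A) ∧
      ∀ M : ℝ, 0 ≤ M → t ≠ 0 → (∀ x : EuclideanSpace ℝ (Fin (n + 1)), ‖regKernel k ρ t 0 x‖ ≤ M) →
        ∀ y, ‖𝓕⁻ (sliceMult k χ m ψ ρ lam t) y‖ ≤ lam * (M * A) := by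
  obtain ⟨A, hA, H⟩ := h.exists_fourier_eq_amp
  refine ⟨A, hA, fun ρ lam t hlam => ?_⟩
  obtain ⟨u, hu, hu1, hu2⟩ := H (lam * t)
  refine ⟨fun ξ => ?_, fun M hM ht hK y => ?_⟩
  · rw [sliceMult, ← hu1, norm_mul, Complex.norm_real, Real.norm_of_nonneg hlam.le]
    refine mul_le_mul_of_nonneg_left ?_ hlam.le
    refine le_trans (le_of_eq ?_) ((norm_fourier_le u ξ).trans hu2)
    rw [chirped, norm_mul, ← Complex.ofReal_ofNat, ← Complex.ofReal_mul, mul_right_comm,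
      ← Complex.ofReal_mul, Complex.norm_exp_ofReal_mul_I, one_mul]
  · have e : 𝓕⁻ (sliceMult k χ m ψ ρ lam t) y = lam * 𝓕⁻ (chirped k ρ t (𝓕 u)) y := by
      simp only [Real.fourierInv_eq', sliceMult, ← hu1, smul_eq_mul, mul_left_comm _ (lam : ℂ),
        integral_const_mul]
    rw [e, norm_mul, Complex.norm_real, Real.norm_of_nonneg hlam.le]
    refine mul_le_mul_of_nonneg_left ?_ hlam.le
    refine (norm_fourierInv_chirped_le_of k ρ ht hu ?_ ?_ hK y).trans
      (mul_le_mul_of_nonneg_left hu2 hM)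
    · rw [hu1]; exact h.integrable_amp _
    · intro η hη
      rw [hu1, amp, eq_zero_of_notMem_domainD h.support (fun hD => hη hD.2.2), zero_mul]

theorem sliceMult_eq_zero (h : Admissible k χ m ψ a) {b : ℝ}
    (hb : ∀ s, |s| < b → 𝓕⁻ (ψ : ℝ → ℂ) s = 0) (ρ : ℝ) {lam t : ℝ} (ht : |lam * t| < b / 2) :
    sliceMult k χ m ψ ρ lam t = 0 := by
  ext ξ
  rw [sliceMult, chirped, amp]
  by_cases hξ : ξ ∈ domainD k
  · have hm := h.weight_pos hξ
    rw [hb]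
    · simp
    · rw [abs_mul, abs_inv, abs_of_pos hm, ← div_eq_mul_inv, div_lt_iff₀ hm]
      have := (h.weight ξ hξ).1
      have := abs_nonneg (lam * t)
      nlinarith
  · simp [eq_zero_of_notMem_domainD h.support hξ]

/-- Slices with `|lam * t| < b / 2` vanish since `m ≥ 1/2`. For the others `1 / |t| ≤ 2 * lam / b`,
which converts decay in `t` into the power `lam ^ (N / 2)`. -/
theorem exists_kernel_bound (h : Admissible k χ m ψ a) {b : ℝ} (hb0 : 0 < b)
    (hb : ∀ s, |s| < b → 𝓕⁻ (ψ : ℝ → ℂ) s = 0) {N : ℝ} (hN : 0 ≤ N) : ∃ A : ℝ, 0 < A ∧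
    ∀ ρ lam B : ℝ, 0 < lam → 0 ≤ B →
      (∀ t : ℝ, t ≠ 0 → ∀ x : EuclideanSpace ℝ (Fin (n + 1)),
        ‖regKernel k ρ t 0 x‖ ≤ B * |t| ^ (-(N / 2))) →
      ∀ x, ‖𝓕⁻ (symbol k χ m ψ ρ lam) x‖ ≤ A * (B * lam ^ (1 + N / 2)) := by
  obtain ⟨A, hA, H⟩ := h.exists_sliceMult_bound
  refine ⟨A * (2 / b) ^ (N / 2), by positivity, fun ρ lam B hlam hB hK x => ?_⟩
  obtain ⟨⟨t, y⟩, rfl⟩ := (splitEquiv (Fin.last (n + 1))).symm.surjective x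
  have e := congrFun (h.slice_fourierInv_symbol ρ hlam t) y
  rw [slice] at e
  rw [e]
  rcases lt_or_ge |lam * t| (b / 2) with ht | ht
  · rw [h.sliceMult_eq_zero hb ρ ht]
    have : 𝓕⁻ (0 : EuclideanSpace ℝ (Fin (n + 1)) → ℂ) y = 0 := by
      simp [Real.fourierInv_eq']
    rw [this, norm_zero]
    positivity
  · have ht0 : t ≠ 0 := by
      rintro rfl
      simp at ht
      linarith
    have hpos : 0 < |t| := abs_pos.2 ht0
    refine ((H ρ lam t hlam).2 _ (by positivity) ht0 (hK t ht0) y).trans ?_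
    have e2 : |t| ^ (-(N / 2)) ≤ (2 / b) ^ (N / 2) * lam ^ (N / 2) := by
      rw [Real.rpow_neg hpos.le, ← Real.inv_rpow hpos.le, ← Real.mul_rpow (by positivity) hlam.le]
      refine Real.rpow_le_rpow (by positivity) ?_ (by positivity)
      rw [abs_mul, abs_of_pos hlam] at ht
      rw [inv_le_comm₀ hpos (by positivity), mul_inv, inv_div]
      rw [inv_eq_one_div, mul_one_div, div_le_iff₀ hlam, mul_comm]
      exact ht
    calc lam * (B * |t| ^ (-(N / 2)) * A)
        ≤ lam * (B * ((2 / b) ^ (N / 2) * lam ^ (N / 2)) * A) := by gcongr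
      _ = _ := by rw [Real.rpow_add hlam, Real.rpow_one]; ring

end Admissible

end

/-! ### Superposition of slices, and the quadratic form bound. -/

section

variable {n : ℕ}

theorem measurable_slice_prod {F : EuclideanSpace ℝ (Fin (n + 2)) → ℂ} (hF : Measurable F) :
    Measurable fun q : ℝ × EuclideanSpace ℝ (Fin (n + 1)) => slice F q.1 q.2 :=
  hF.comp (splitEquiv (Fin.last (n + 1))).symm.measurable

theorem measurable_slice {F : EuclideanSpace ℝ (Fin (n + 2)) → ℂ} (hF : Measurable F) (t : ℝ) :
    Measurable (slice F t) :=
  (measurable_slice_prod hF).comp measurable_prodMk_left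

theorem _root_.Measurable.slice {F : EuclideanSpace ℝ (Fin (n + 2)) → ℂ} (hF : Measurable F)
    {X : Type*} [MeasurableSpace X] {f : X → ℝ} {g : X → EuclideanSpace ℝ (Fin (n + 1))}
    (hf : Measurable f) (hg : Measurable g) : Measurable fun x => slice F (f x) (g x) :=
  (measurable_slice_prod hF).comp (hf.prodMk hg)

theorem ae_integrable_slice {F : EuclideanSpace ℝ (Fin (n + 2)) → ℂ} (hF : Integrable F) :
    ∀ᵐ t, Integrable (slice F t) :=
  (integrable_slice_prod hF).prod_right_ae

/-- A multiplier form is the superposition of the forms of the slices of its kernel. -/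
theorem multForm_split {w : EuclideanSpace ℝ (Fin (n + 2)) → ℂ} (hw : Integrable w)
    {W : ℝ → EuclideanSpace ℝ (Fin (n + 1)) → ℂ} (hW : ∀ t, Integrable (W t))
    (hwW : ∀ t, slice (𝓕⁻ w) t = 𝓕⁻ (W t)) {u v : EuclideanSpace ℝ (Fin (n + 2)) → ℂ}
    (hum : Measurable u) (hvm : Measurable v) (hu : Integrable u) (hv : Integrable v) :
    multForm w u v = ∫ t, ∫ s, multForm (W (t - s)) (slice u s) (slice v t) := by
  obtain ⟨K, hK⟩ : ∃ K, K = 𝓕⁻ w := ⟨_, rfl⟩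
  have hKc : Continuous K := hK ▸ continuous_fourierInv_of_integrable hw
  obtain ⟨M, hM⟩ : ∃ M, ∀ x, ‖K x‖ ≤ M := ⟨∫ y, ‖w y‖, fun x => by
    rw [hK, Real.fourierInv_eq_fourier_neg]; exact norm_fourier_le w _⟩
  have hKu : ∀ x, Integrable fun z => K (x - z) * u z := fun x =>
    hu.bdd_mul (by fun_prop : Continuous fun z => K (x - z)).aestronglyMeasurable
      (ae_of_all _ fun z => hM _)
  set H : EuclideanSpace ℝ (Fin (n + 2)) → ℂ := fun x => ∫ z, K (x - z) * u z with hH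
  have hHv : Integrable fun x => H x * v x := by
    have e : H = 𝓕⁻ (fun η => w η * 𝓕 u η) := funext fun x => by
      rw [hH, hK]; exact integral_fourierInv_sub_mul hw hu x
    refine hv.bdd_mul (c := M * ∫ z, ‖u z‖) ?_ (ae_of_all _ fun x => ?_)
    · rw [e]
      exact (continuous_fourierInv_of_integrable (integrable_mul_fourier hw hu)).aestronglyMeasurable
    · rw [hH, ← integral_const_mul]
      refine norm_integral_le_of_norm_le (hu.norm.const_mul M) (ae_of_all _ fun z => ?_)
      rw [norm_mul]
      exact mul_le_mul_of_nonneg_right (hM _) (norm_nonneg _)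
  rw [multForm_eq_integral hw hu hv, ← hK, integral_split (Fin.last (n + 1)) hHv]
  refine integral_congr_ae ?_
  filter_upwards [ae_integrable_slice hv] with t hvt
  have hHs : ∀ y, H ((splitEquiv (Fin.last (n + 1))).symm (t, y)) =
      ∫ s, ∫ z, slice K (t - s) (y - z) * slice u s z := by
    intro y
    rw [hH]
    beta_reduce
    rw [integral_split (Fin.last (n + 1)) (hKu _)]
    simp only [← symm_sub, Prod.mk_sub_mk, slice]
  -- The kernel is bounded by `M`, so `M` times `‖v(y, t)‖` times the `L¹` norm of the slice of `u`
  -- at `s` is an integrable majorant, which justifies Fubini.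
  have hswap : Integrable (Function.uncurry fun y s =>
      ∫ z, slice K (t - s) (y - z) * slice u s z * slice v t y)
      ((volume : Measure (EuclideanSpace ℝ (Fin (n + 1)))).prod (volume : Measure ℝ)) := by
    have hmeas : Measurable fun q : (EuclideanSpace ℝ (Fin (n + 1)) × ℝ) ×
        EuclideanSpace ℝ (Fin (n + 1)) =>
        slice K (t - q.1.2) (q.1.1 - q.2) * slice u q.1.2 q.2 * slice v t q.1.1 := by
      refine Measurable.mul (Measurable.mul ?_ ?_) ?_
      · exact hKc.measurable.slice (by fun_prop) (by fun_prop)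
      · exact hum.slice (by fun_prop) (by fun_prop)
      · exact (measurable_slice hvm t).comp (by fun_prop)
    have hus : Integrable fun s => ∫ z, ‖slice u s z‖ :=
      (integrable_slice_prod hu).norm.integral_prod_left
    refine (((hvt.norm.mul_prod hus)).const_mul M).mono'
      hmeas.stronglyMeasurable.integral_prod_right'.aestronglyMeasurable ?_
    filter_upwards [Measure.quasiMeasurePreserving_snd.ae (ae_integrable_slice hu)] with q hq
    change Integrable (slice u q.2) at hq
    rw [mul_comm ‖slice v t q.1‖, ← mul_assoc, ← integral_const_mul, ← integral_mul_const]
    refine norm_integral_le_of_norm_le ((hq.norm.const_mul M).mul_const _)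
      (ae_of_all _ fun z => ?_)
    beta_reduce
    rw [norm_mul, norm_mul]
    exact mul_le_mul_of_nonneg_right (mul_le_mul_of_nonneg_right (hM _) (norm_nonneg _))
      (norm_nonneg _)
  calc ∫ y, H ((splitEquiv (Fin.last (n + 1))).symm (t, y)) *
        v ((splitEquiv (Fin.last (n + 1))).symm (t, y)) =
        ∫ y, ∫ s, ∫ z, slice K (t - s) (y - z) * slice u s z * slice v t y := by
        congr 1; ext y
        rw [hHs, ← integral_mul_const]
        congr 1; ext s
        rw [← integral_mul_const]
        rfl
    _ = ∫ s, ∫ y, ∫ z, slice K (t - s) (y - z) * slice u s z * slice v t y :=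
        integral_integral_swap hswap
    _ = _ := by
        refine integral_congr_ae ?_
        filter_upwards [ae_integrable_slice hu] with s hus
        rw [multForm_eq_integral (hW _) hus hvt, ← hwW, ← hK]
        simp only [← integral_mul_const]

namespace Admissible

variable {k : ℕ} {χ : EuclideanSpace ℝ (Fin (n + 1)) → ℂ}
  {m : EuclideanSpace ℝ (Fin (n + 1)) → ℝ} {ψ : 𝓢(ℝ, ℂ)} {a : ℝ}

/-- Interpolation at `θ = α` raises `|t|^{-N/2}` to the power `1 - α = 2 / (N + 2)`, which is
exactly `|t|^{-α}`. The resulting exponent, `1 / r = 1 - α / 2`, is the one at which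
Hardy–Littlewood–Sobolev handles the kernel `|t|^{-α}`; this double match dictates `α = N / (N +
2)`. -/
theorem exists_sliceMult_form_bound (h : Admissible k χ m ψ a) {N α r : ℝ} (hN : 0 < N)
    (hα : α = N / (N + 2)) (hr : r = 2 / (2 - α)) : ∃ A : ℝ, 0 < A ∧
    ∀ ρ lam B : ℝ, 0 < lam → 0 ≤ B →
      (∀ t : ℝ, t ≠ 0 → ∀ x : EuclideanSpace ℝ (Fin (n + 1)),
        ‖regKernel k ρ t 0 x‖ ≤ B * |t| ^ (-(N / 2))) →
      ∀ t : ℝ, t ≠ 0 → ∀ f g : EuclideanSpace ℝ (Fin (n + 1)) → ℂ, Measurable f → Measurable g →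
        Integrable f → Integrable g → (∃ C, ∀ x, ‖f x‖ ≤ C) → (∃ C, ∀ x, ‖g x‖ ≤ C) →
        ‖multForm (sliceMult k χ m ψ ρ lam t) f g‖ ≤ A * (lam * B ^ (1 - α)) * |t| ^ (-α) *
          ((∫ x, ‖f x‖ ^ r) ^ (1 / r) * (∫ x, ‖g x‖ ^ r) ^ (1 / r)) := by
  obtain ⟨A, hA, H⟩ := h.exists_sliceMult_bound
  refine ⟨A, hA, fun ρ lam B hlam hB hK t ht f g hfm hgm hf hg hfb hgb => ?_⟩
  obtain ⟨H1, H2⟩ := H ρ lam t hlam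
  have htp : 0 < |t| := abs_pos.2 ht
  have hα0 : 0 ≤ α := by rw [hα]; positivity
  have hα1 : 1 - α = 2 / (N + 2) := by rw [hα]; field_simp; ring
  have hα1' : α ≤ 1 := by
    have : 0 < 2 / (N + 2) := by positivity
    linarith
  have h2α : 0 < 2 - α := by linarith
  have hr' : 1 / r = 1 - α + α / 2 := by rw [hr]; field_simp; ring
  have hr1 : 1 ≤ r := by rw [hr, le_div_iff₀ h2α]; linarith
  have hbil := isBoundedBilin_multForm (h.integrable_sliceMult ρ lam t)
    (H2 (B * |t| ^ (-(N / 2))) (by positivity) ht (hK t ht))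
  have key := hbil.riesz_thorin (by positivity) (p₁ := 2) (r₁ := 2) (M₁ := lam * A) (by norm_num)
    (by norm_num) (by positivity) (fun f g hf hg => norm_multForm_le (by positivity) H1 hf hg
      ((SimpleFunc.memLp_iff_integrable (by norm_num) (by norm_num)).2 hf) ((SimpleFunc.memLp_iff_integrable (by norm_num) (by norm_num)).2 hg))
    hr1 hr1 hα0 hα1' hr' hr' hfm hgm hf hg hfb hgb
  have e : (lam * (B * |t| ^ (-(N / 2)) * A)) ^ (1 - α) * (lam * A) ^ α =
      A * (lam * B ^ (1 - α)) * |t| ^ (-α) := by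
    rw [show lam * (B * |t| ^ (-(N / 2)) * A) = (lam * A) * (B * |t| ^ (-(N / 2))) by ring,
      Real.mul_rpow (by positivity) (by positivity), mul_right_comm,
      ← Real.rpow_add (by positivity), Real.mul_rpow hB (by positivity), ← Real.rpow_mul htp.le,
      show -(N / 2) * (1 - α) = -α by rw [hα1, hα]; field_simp, show 1 - α + α = 1 by ring,
      Real.rpow_one]
    ring
  rwa [e, mul_assoc] at key

end Admissible

end

section

variable {n : ℕ}

/-- The same exponent `r` occurs in `t` and in the slices, so the mixed norm collapses to the full
`L^r` norm by Fubini. -/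
theorem lintegral_slice_rpow {g : EuclideanSpace ℝ (Fin (n + 2)) → ℂ} {r : ℝ} (hr : 0 < r)
    (hg : Integrable fun x => ‖g x‖ ^ r) :
    ∫⁻ t, ENNReal.ofReal ((∫ y, ‖slice g t y‖ ^ r) ^ (1 / r)) ^ r =
      ENNReal.ofReal (∫ x, ‖g x‖ ^ r) := by
  have hmp := (measurePreserving_splitEquiv (Fin.last (n + 1))).symm _
  have hint : Integrable (fun q : ℝ × EuclideanSpace ℝ (Fin (n + 1)) => ‖slice g q.1 q.2‖ ^ r)
      ((volume : Measure ℝ).prod volume) :=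
    (hmp.integrable_comp_emb (MeasurableEquiv.measurableEmbedding _)).2 hg
  have e : ∀ t, ENNReal.ofReal ((∫ y, ‖slice g t y‖ ^ r) ^ (1 / r)) ^ r =
      ENNReal.ofReal (∫ y, ‖slice g t y‖ ^ r) := by
    intro t
    have h0 : 0 ≤ ∫ y, ‖slice g t y‖ ^ r := integral_nonneg fun y => by positivity
    rw [ENNReal.ofReal_rpow_of_nonneg (by positivity) hr.le, ← Real.rpow_mul h0,
      one_div_mul_cancel hr.ne', Real.rpow_one]
  simp_rw [e]
  rw [← ofReal_integral_eq_lintegral_ofReal hint.integral_prod_left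
    (ae_of_all _ fun t => integral_nonneg fun y => by positivity)]
  rw [← integral_prod _ hint, ← hmp.integral_comp' (fun x => ‖g x‖ ^ r)]
  rfl

theorem multForm_eq_zero_of_ae_eq_zero {w g : EuclideanSpace ℝ (Fin (n + 2)) → ℂ} (hg : g =ᵐ[volume] 0)
    (u : EuclideanSpace ℝ (Fin (n + 2)) → ℂ) : multForm w u g = 0 := by
  have : 𝓕 g = 0 := by
    ext ξ
    rw [Real.fourier_eq, Pi.zero_apply, ← integral_zero (EuclideanSpace ℝ (Fin (n + 2))) ℂ]
    refine integral_congr_ae ?_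
    filter_upwards [hg] with x hx
    simp [hx]
  simp [multForm, this]

namespace Admissible

variable {k : ℕ} {χ : EuclideanSpace ℝ (Fin (n + 1)) → ℂ}
  {m : EuclideanSpace ℝ (Fin (n + 1)) → ℝ} {ψ : 𝓢(ℝ, ℂ)} {a : ℝ}

/-- The slices of `g` and of its conjugate have equal norms, so a single function `F(t)`, the `L^r`
norm of the slice at `t`, enters the Hardy–Littlewood–Sobolev integral twice. -/
theorem exists_quadratic_bound (h : Admissible k χ m ψ a) {N α r : ℝ} (hN : 0 < N)
    (hα : α = N / (N + 2)) (hr : r = 2 / (2 - α)) : ∃ A : ℝ, 0 < A ∧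
    ∀ ρ lam B : ℝ, 0 < lam → 0 ≤ B →
      (∀ t : ℝ, t ≠ 0 → ∀ x : EuclideanSpace ℝ (Fin (n + 1)),
        ‖regKernel k ρ t 0 x‖ ≤ B * |t| ^ (-(N / 2))) →
      ∀ g : EuclideanSpace ℝ (Fin (n + 2)) → ℂ, Measurable g → Integrable g →
        (∃ C, ∀ x, ‖g x‖ ≤ C) →
        ‖multForm (symbol k χ m ψ ρ lam) (fun x => starRingEnd ℂ (g x)) g‖ ≤
          A * (lam * B ^ (1 - α)) * (∫ x, ‖g x‖ ^ r) ^ (2 / r) := by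
  obtain ⟨A, hA, H⟩ := h.exists_sliceMult_form_bound hN hα hr
  have hα0 : 0 < α := by rw [hα]; positivity
  have hα1 : α < 1 := by rw [hα, div_lt_one (by positivity)]; linarith
  have h1α : 0 < 1 - α := by linarith
  have h2α : 0 < 2 - α := by linarith
  have hr1 : 1 ≤ r := by rw [hr, le_div_iff₀ h2α]; linarith
  have hr0 : 0 < r := by linarith
  refine ⟨A * (2 * (2 / (1 - α) + 2 ^ (α / 2))), by positivity,
    fun ρ lam B hlam hB hK g hgm hg hgb => ?_⟩
  obtain ⟨D, hD⟩ := hgb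
  have hgr := integrable_norm_rpow_of_bounded hg hD hr1
  set I := ∫ x, ‖g x‖ ^ r with hI
  have hI0 : 0 ≤ I := integral_nonneg fun x => by positivity
  -- The Hardy–Littlewood–Sobolev bound is available for `I > 0`; if `I = 0` then `g` vanishes
  -- almost everywhere.
  rcases hI0.eq_or_lt with h0 | hIpos
  · rw [multForm_eq_zero_of_ae_eq_zero, norm_zero]
    · positivity
    · have := (integral_eq_zero_iff_of_nonneg (fun x => by positivity) hgr).1 h0.symm
      filter_upwards [this] with x hx
      simpa [Real.rpow_eq_zero_iff_of_nonneg, hr0.ne'] using hx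
  set F : ℝ → ℝ≥0∞ := fun t => ENNReal.ofReal ((∫ y, ‖slice g t y‖ ^ r) ^ (1 / r)) with hF
  have hFm : Measurable F := by
    have h1 : Measurable fun q : ℝ × EuclideanSpace ℝ (Fin (n + 1)) => ‖slice g q.1 q.2‖ ^ r :=
      (measurable_slice_prod hgm).norm.pow_const r
    exact (h1.stronglyMeasurable.integral_prod_right'.measurable.pow_const _).ennreal_ofReal
  have hHLS := lintegral_riesz_le hα0 hα1 hr hFm (fun t => ENNReal.ofReal_ne_top) hIpos
    (lintegral_slice_rpow hr0 hgr).le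
  set c := A * (lam * B ^ (1 - α)) with hc
  have hc0 : 0 ≤ c := by positivity
  have hconj : Measurable fun x => starRingEnd ℂ (g x) := by fun_prop
  have hconji : Integrable fun x => starRingEnd ℂ (g x) :=
    hg.congr' hconj.aestronglyMeasurable (ae_of_all _ fun x => by simp)
  have hbound : ∀ᵐ t, ∀ᵐ s, ‖multForm (sliceMult k χ m ψ ρ lam (t - s))
      (slice (fun x => starRingEnd ℂ (g x)) s) (slice g t)‖ₑ ≤
      ENNReal.ofReal c * (F t * F s * ENNReal.ofReal (|s - t| ^ (-α))) := by
    filter_upwards [ae_integrable_slice hg] with t ht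
    -- The diagonal `s = t`, where the dispersive bound says nothing, is a null set.
    filter_upwards [ae_integrable_slice hconji, compl_mem_ae_iff.2 (measure_singleton t)]
      with s hs hst
    have hts : t - s ≠ 0 := sub_ne_zero.2 fun e => hst e.symm
    have key := H ρ lam B hlam hB hK (t - s) hts _ _ (measurable_slice hconj s)
      (measurable_slice hgm t) hs ht ⟨D, fun x => by simpa [slice] using hD _⟩
      ⟨D, fun x => hD _⟩
    rw [← ofReal_norm, hF]
    beta_reduce
    rw [← ENNReal.ofReal_mul (by positivity), ← ENNReal.ofReal_mul (by positivity),
      ← ENNReal.ofReal_mul hc0]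
    refine ENNReal.ofReal_le_ofReal (key.trans (le_of_eq ?_))
    rw [abs_sub_comm s t]
    simp only [slice, RCLike.norm_conj]
    ring
  rw [multForm_split (h.integrable_symbol ρ hlam) (h.integrable_sliceMult ρ lam)
    (h.slice_fourierInv_symbol ρ hlam) hconj hgm hconji hg, ← ENNReal.ofReal_le_ofReal_iff
    (by positivity), ofReal_norm]
  calc _ ≤ ∫⁻ t, ∫⁻ s, ‖multForm (sliceMult k χ m ψ ρ lam (t - s))
          (slice (fun x => starRingEnd ℂ (g x)) s) (slice g t)‖ₑ :=
        (enorm_integral_le_lintegral_enorm _).trans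
          (lintegral_mono fun t => enorm_integral_le_lintegral_enorm _)
    _ ≤ ∫⁻ t, ∫⁻ s, ENNReal.ofReal c * (F t * F s * ENNReal.ofReal (|s - t| ^ (-α))) := by
        refine lintegral_mono_ae ?_
        filter_upwards [hbound] with t ht using lintegral_mono_ae ht
    _ = ENNReal.ofReal c * ∫⁻ t, ∫⁻ s, F t * F s * ENNReal.ofReal (|s - t| ^ (-α)) := by
        simp_rw [lintegral_const_mul' _ _ ENNReal.ofReal_ne_top]
    _ ≤ _ := by
        refine (mul_le_mul_right hHLS _).trans (le_of_eq ?_)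
        rw [← ENNReal.ofReal_mul hc0]
        congr 1
        rw [hc]; ring

end Admissible

end

/-! ### The `L²` endpoint by the TT* method. -/

section

variable {n : ℕ}

/-- The square `|ψ|²` of a Schwartz function. -/
noncomputable def normSqSchwartz (ψ : 𝓢(ℝ, ℂ)) : 𝓢(ℝ, ℂ) :=
  SchwartzMap.pairing (ContinuousLinearMap.mul ℝ ℂ) ψ
    (SchwartzMap.postcompCLM (Complex.conjCLE : ℂ →L[ℝ] ℂ) ψ)

theorem normSqSchwartz_apply (ψ : 𝓢(ℝ, ℂ)) (x : ℝ) :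
    normSqSchwartz ψ x = ψ x * starRingEnd ℂ (ψ x) := rfl

/-- The inverse transform of `|ψ|²` is the convolution of `𝓕⁻ ψ` with its conjugate reflection, so
the radius of the support at most doubles. -/
theorem fourierInv_normSqSchwartz_eq_zero {ψ : 𝓢(ℝ, ℂ)} {a : ℝ}
    (h : ∀ s, a < |s| → 𝓕⁻ (ψ : ℝ → ℂ) s = 0) {s : ℝ} (hs : 2 * a < |s|) :
    𝓕⁻ (normSqSchwartz ψ : ℝ → ℂ) s = 0 := by
  set Θ : ℝ → ℂ := fun x => starRingEnd ℂ (𝓕 (ψ : ℝ → ℂ) x) with hΘ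
  have hΘi : Integrable Θ := by
    have h1 : Integrable (𝓕 (ψ : ℝ → ℂ)) := by
      rw [← SchwartzMap.fourier_coe]; exact (𝓕 ψ : 𝓢(ℝ, ℂ)).integrable
    exact (Complex.conjCLE : ℂ →L[ℝ] ℂ).integrable_comp h1
  have e : (normSqSchwartz ψ : ℝ → ℂ) = fun x => ψ x * 𝓕 Θ x := by
    ext x
    rw [normSqSchwartz_apply, hΘ, fourier_conj, ← Real.fourierInv_eq_fourier_neg]
    have : 𝓕⁻ (𝓕 (ψ : ℝ → ℂ)) = ψ := by
      rw [← SchwartzMap.fourier_coe, ← SchwartzMap.fourierInv_coe,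
        FourierTransform.fourierInv_fourier_eq]
    rw [this]
  rw [e, ← integral_fourierInv_sub_mul ψ.integrable hΘi, ← integral_zero ℝ ℂ]
  congr 1; ext y
  by_cases hy : a < |y|
  · have : Θ y = 0 := by
      rw [hΘ]
      beta_reduce
      rw [← neg_neg y, ← Real.fourierInv_eq_fourier_neg, h _ (by rwa [abs_neg]), map_zero]
    rw [this, mul_zero]
  · rw [h, zero_mul]
    have := abs_sub_abs_le_abs_sub s y
    linarith

/-- The square `|χ|²`. -/
noncomputable def normSqFun (χ : EuclideanSpace ℝ (Fin (n + 1)) → ℂ)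
    (η : EuclideanSpace ℝ (Fin (n + 1))) : ℂ := χ η * starRingEnd ℂ (χ η)

theorem symbol_normSq (k : ℕ) (χ : EuclideanSpace ℝ (Fin (n + 1)) → ℂ)
    (m : EuclideanSpace ℝ (Fin (n + 1)) → ℝ) (ψ : 𝓢(ℝ, ℂ)) (ρ lam : ℝ)
    (η : EuclideanSpace ℝ (Fin (n + 2))) :
    symbol k (normSqFun χ) m (normSqSchwartz ψ) ρ lam η =
      ((‖symbol k χ m ψ ρ lam η‖ ^ 2 : ℝ) : ℂ) := by
  rw [← Complex.normSq_eq_norm_sq, ← Complex.mul_conj]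
  simp only [symbol, normSqFun, normSqSchwartz_apply, map_mul]
  ring

namespace Admissible

variable {k : ℕ} {χ : EuclideanSpace ℝ (Fin (n + 1)) → ℂ}
  {m : EuclideanSpace ℝ (Fin (n + 1)) → ℝ} {ψ : 𝓢(ℝ, ℂ)} {a : ℝ}

/-- The TT* symbol stays in the same class, with `2 * a` for `a`. Vanishing of the transform near
`0` is lost under squaring, which is why it is kept out of `Admissible`; the quadratic bound does
without it. -/
theorem normSq (h : Admissible k χ m ψ a) :
    Admissible k (normSqFun χ) m (normSqSchwartz ψ) (2 * a) where
  smooth := h.smooth.mul ((Complex.conjCLE : ℂ →L[ℝ] ℂ).contDiff.comp h.smooth)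
  support := (tsupport_mul_subset_left (f := χ) (g := fun η => starRingEnd ℂ (χ η))).trans h.support
  smooth_weight := h.smooth_weight
  weight := h.weight
  fourier_support _ hs := fourierInv_normSqSchwartz_eq_zero h.fourier_support hs

/-- The estimate from `L²`. -/
theorem exists_multForm_bound_two (h : Admissible k χ m ψ a) {N α r : ℝ} (hN : 0 < N)
    (hα : α = N / (N + 2)) (hr : r = 2 / (2 - α)) : ∃ A : ℝ, 0 < A ∧
    ∀ ρ lam B : ℝ, 0 < lam → 0 ≤ B →
      (∀ t : ℝ, t ≠ 0 → ∀ x : EuclideanSpace ℝ (Fin (n + 1)),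
        ‖regKernel k ρ t 0 x‖ ≤ B * |t| ^ (-(N / 2))) →
      ∀ f g : EuclideanSpace ℝ (Fin (n + 2)) → ℂ, Integrable f → MemLp f 2 →
        Measurable g → Integrable g → (∃ C, ∀ x, ‖g x‖ ≤ C) →
        ‖multForm (symbol k χ m ψ ρ lam) f g‖ ≤
          A * (lam ^ (1 / 2 : ℝ) * B ^ ((1 - α) / 2)) * (∫ x, ‖f x‖ ^ (2 : ℝ)) ^ (1 / 2 : ℝ) *
            (∫ x, ‖g x‖ ^ r) ^ (1 / r) := by
  obtain ⟨A, hA, H⟩ := h.normSq.exists_quadratic_bound hN hα hr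
  refine ⟨A ^ (1 / 2 : ℝ), by positivity, fun ρ lam B hlam hB hK f g hf hf2 hgm hg hgb => ?_⟩
  have key := H ρ lam B hlam hB hK g hgm hg hgb
  set w := symbol k χ m ψ ρ lam with hw
  have hgconj : Integrable fun x => starRingEnd ℂ (g x) :=
    (Complex.conjCLE : ℂ →L[ℝ] ℂ).integrable_comp hg
  have hwc : Continuous w :=
    (hasTemperateGrowth_symbol h.smooth h.support h.smooth_weight ψ ρ lam).1.continuous
  have hi : Integrable fun η => ‖w η * 𝓕 g (-η)‖ ^ (2 : ℝ) := by
    refine (integrable_multForm (h.normSq.integrable_symbol ρ hlam) hgconj hg).norm.congr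
      (ae_of_all _ fun η => ?_)
    beta_reduce
    rw [symbol_normSq, fourier_conj, norm_mul, norm_mul, Complex.norm_real,
      Real.norm_of_nonneg (by positivity), RCLike.norm_conj, Real.rpow_two, norm_mul]
    ring
  -- The form of `|w|²` at `(ḡ, g)` is the squared `L²` norm of `w(η) 𝓕 g(-η)`, so the quadratic
  -- bound controls precisely the second factor of the Cauchy–Schwarz inequality below.
  have e : multForm (symbol k (normSqFun χ) m (normSqSchwartz ψ) ρ lam)
      (fun x => starRingEnd ℂ (g x)) g = ((∫ η, ‖w η * 𝓕 g (-η)‖ ^ (2 : ℝ) : ℝ) : ℂ) := by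
    rw [multForm, ← integral_complex_ofReal]
    congr 1; ext η
    rw [symbol_normSq, fourier_conj, mul_assoc, mul_comm (starRingEnd ℂ _), Complex.mul_conj,
      Complex.normSq_eq_norm_sq, ← Complex.ofReal_mul, norm_mul, Real.rpow_two, mul_pow]
  rw [e, Complex.norm_real, Real.norm_of_nonneg (integral_nonneg fun η => by positivity)] at key
  have hmem : MemLp (fun η => w η * 𝓕 g (-η)) 2 := by
    refine (integrable_norm_rpow_iff ?_ (by norm_num) (by norm_num)).1 (by simpa using hi)
    exact (hwc.mul ((continuous_fourier_of_integrable hg).comp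
      continuous_neg)).aestronglyMeasurable
  obtain ⟨hf1, -⟩ := plancherel hf hf2
  have hH : ∫ η, ‖𝓕 f η‖ * ‖w η * 𝓕 g (-η)‖ ≤ (∫ η, ‖𝓕 f η‖ ^ (2 : ℝ)) ^ (1 / 2 : ℝ) *
      (∫ η, ‖w η * 𝓕 g (-η)‖ ^ (2 : ℝ)) ^ (1 / 2 : ℝ) :=
    integral_mul_norm_le_Lp_mul_Lq (p := 2) (q := 2)
      (Real.holderConjugate_iff.2 ⟨by norm_num, by norm_num⟩) (by simpa using hf1)
      (by simpa using hmem)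
  rw [(plancherel_integral hf hf2).2] at hH
  have hI : 0 ≤ ∫ x, ‖g x‖ ^ r := integral_nonneg fun x => by positivity
  calc ‖multForm w f g‖ ≤ ∫ η, ‖𝓕 f η‖ * ‖w η * 𝓕 g (-η)‖ := by
        refine norm_integral_le_of_norm_le (hf1.norm.integrable_mul hmem.norm)
          (ae_of_all _ fun η => le_of_eq ?_)
        rw [norm_mul, norm_mul, norm_mul]; ring
    _ ≤ _ := hH
    _ ≤ (∫ x, ‖f x‖ ^ (2 : ℝ)) ^ (1 / 2 : ℝ) *
        (A * (lam * B ^ (1 - α)) * (∫ x, ‖g x‖ ^ r) ^ (2 / r)) ^ (1 / 2 : ℝ) := by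
        gcongr
    _ = _ := by
        rw [Real.mul_rpow (by positivity) (by positivity), Real.mul_rpow hA.le (by positivity),
          Real.mul_rpow hlam.le (by positivity), ← Real.rpow_mul hB, ← Real.rpow_mul hI]
        rw [show (1 - α) * (1 / 2 : ℝ) = (1 - α) / 2 by ring,
          show 2 / r * (1 / 2 : ℝ) = 1 / r by ring]
        ring

end Admissible

end

/-! ### Duality and density: from form bounds to operator bounds. -/

section

variable {V : Type*} [NormedAddCommGroup V] [ProperSpace V]
  [MeasurableSpace V] [BorelSpace V] {μ : Measure V}
  [IsFiniteMeasureOnCompacts μ]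

/-- The converse of Hölder's inequality for continuous functions. -/
theorem eLpNorm_le_of_forall_integral_le {h : V → ℂ} (hc : Continuous h) {q s A : ℝ} (hA : 0 ≤ A)
    (hq : 2 ≤ q) (hqs : 1 / q + 1 / s = 1)
    (H : ∀ g : V → ℂ, Measurable g → Integrable g μ → (∃ C, ∀ x, ‖g x‖ ≤ C) →
      ‖∫ x, h x * g x ∂μ‖ ≤ A * (∫ x, ‖g x‖ ^ s ∂μ) ^ (1 / s)) :
    eLpNorm h (ENNReal.ofReal q) μ ≤ ENNReal.ofReal A := by
  have hq0 : 0 < q := by linarith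
  have hs : 1 / s = 1 - 1 / q := by linarith
  have hs0 : 0 < s := by
    rw [← one_div_pos, hs, sub_pos, div_lt_one hq0]; linarith
  have hs' : (q - 1) * s = q := by
    field_simp at hqs; linarith
  have hpow : ∀ x, ‖h x‖ ^ (q - 2) * ‖h x‖ ^ (2 : ℝ) = ‖h x‖ ^ q := fun x => by
    rw [← Real.rpow_add_of_nonneg (norm_nonneg _) (by linarith) (by norm_num)]
    congr 1; ring
  have hnc : Continuous fun x => ‖h x‖ ^ q :=
    hc.norm.rpow_const fun _ => Or.inr hq0.le
  have hball : ∀ N : ℕ, ∫ x in Metric.closedBall 0 (N : ℝ), ‖h x‖ ^ q ∂μ ≤ A ^ q := by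
    intro N
    set S : Set V := Metric.closedBall 0 (N : ℝ)
    have hS : IsCompact S := isCompact_closedBall _ _
    have hSm : MeasurableSet S := hS.measurableSet
    -- The extremiser of Hölder's inequality, continuous because `q ≥ 2`. It is cut off to a ball
    -- because `h` is not yet known to lie in `L^q`; the bound is uniform in the radius.
    set g₀ : V → ℂ := fun x => ((‖h x‖ ^ (q - 2) : ℝ) : ℂ) * starRingEnd ℂ (h x) with hg₀
    have hg₀c : Continuous g₀ :=
      (Complex.continuous_ofReal.comp (hc.norm.rpow_const fun _ => Or.inr (by linarith))).mul
        (Complex.continuous_conj.comp hc)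
    have hg₀n : ∀ x, ‖g₀ x‖ = ‖h x‖ ^ (q - 1) := by
      intro x
      rw [hg₀]
      beta_reduce
      rw [norm_mul, Complex.norm_real, Real.norm_of_nonneg (by positivity), RCLike.norm_conj]
      nth_rewrite 2 [← Real.rpow_one ‖h x‖]
      rw [← Real.rpow_add_of_nonneg (norm_nonneg _) (by linarith) (by norm_num)]
      congr 1; ring
    obtain ⟨C, hC⟩ := hS.exists_bound_of_continuousOn hg₀c.continuousOn
    have key := H (S.indicator g₀) (hg₀c.measurable.indicator hSm)
      ((hg₀c.continuousOn.integrableOn_compact hS).integrable_indicator hSm)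
      ⟨max C 0, fun x => by
        by_cases hx : x ∈ S
        · rw [Set.indicator_of_mem hx]; exact (hC x hx).trans (le_max_left _ _)
        · rw [Set.indicator_of_notMem hx, norm_zero]; exact le_max_right _ _⟩
    have e1 : ∫ x, h x * S.indicator g₀ x ∂μ = ((∫ x in S, ‖h x‖ ^ q ∂μ : ℝ) : ℂ) := by
      rw [← integral_indicator hSm, ← integral_complex_ofReal]
      congr 1; ext x
      by_cases hx : x ∈ S
      · rw [Set.indicator_of_mem hx, Set.indicator_of_mem hx, hg₀, ← hpow]
        beta_reduce
        rw [mul_left_comm, Complex.mul_conj, Complex.normSq_eq_norm_sq, Real.rpow_two]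
        push_cast
        rfl
      · rw [Set.indicator_of_notMem hx, Set.indicator_of_notMem hx, mul_zero, Complex.ofReal_zero]
    have e2 : ∫ x, ‖S.indicator g₀ x‖ ^ s ∂μ = ∫ x in S, ‖h x‖ ^ q ∂μ := by
      rw [← integral_indicator hSm]
      congr 1; ext x
      by_cases hx : x ∈ S
      · rw [Set.indicator_of_mem hx, Set.indicator_of_mem hx, hg₀n,
          ← Real.rpow_mul (norm_nonneg _), hs']
      · rw [Set.indicator_of_notMem hx, Set.indicator_of_notMem hx, norm_zero,
          Real.zero_rpow hs0.ne']
    set J := ∫ x in S, ‖h x‖ ^ q ∂μ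
    have hJ : 0 ≤ J := integral_nonneg fun x => by positivity
    rw [e1, e2, Complex.norm_real, Real.norm_of_nonneg hJ] at key
    rcases hJ.eq_or_lt with h0 | hpos
    · rw [← h0]; positivity
    · have h1 : J ^ (1 / q) ≤ A := by
        have e3 : J = J ^ (1 / q) * J ^ (1 / s) := by
          rw [← Real.rpow_add hpos, hqs, Real.rpow_one]
        nth_rewrite 1 [e3] at key
        exact le_of_mul_le_mul_right key (by positivity)
      calc J = (J ^ (1 / q)) ^ q := by
            rw [← Real.rpow_mul hJ, one_div_mul_cancel hq0.ne', Real.rpow_one]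
        _ ≤ A ^ q := Real.rpow_le_rpow (by positivity) h1 hq0.le
  have hcov : AECover μ Filter.atTop fun N : ℕ => Metric.closedBall (0 : V) (N : ℝ) :=
    aecover_closedBall tendsto_natCast_atTop_atTop
  have hint : Integrable (fun x => ‖h x‖ ^ q) μ := by
    refine hcov.integrable_of_integral_norm_bounded (A ^ q)
      (fun N => hnc.continuousOn.integrableOn_compact (isCompact_closedBall _ _))
      (Filter.Eventually.of_forall fun N => ?_)
    refine le_trans (le_of_eq ?_) (hball N)
    congr 1; ext x
    rw [Real.norm_of_nonneg (by positivity)]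
  have hle : ∫ x, ‖h x‖ ^ q ∂μ ≤ A ^ q :=
    le_of_tendsto (hcov.integral_tendsto_of_countably_generated hint)
      (Filter.Eventually.of_forall hball)
  have hmem : MemLp h (ENNReal.ofReal q) μ := by
    refine (integrable_norm_rpow_iff hc.aestronglyMeasurable (by simpa using hq0)
      ENNReal.ofReal_ne_top).1 ?_
    rwa [ENNReal.toReal_ofReal hq0.le]
  rw [hmem.eLpNorm_eq_integral_rpow_norm (by simpa using hq0) ENNReal.ofReal_ne_top,
    ENNReal.toReal_ofReal hq0.le]
  refine ENNReal.ofReal_le_ofReal ?_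
  calc _ ≤ (A ^ q) ^ q⁻¹ :=
        Real.rpow_le_rpow (integral_nonneg fun x => by positivity) hle (by positivity)
    _ = A := by rw [← Real.rpow_mul hA, mul_inv_cancel₀ hq0.ne', Real.rpow_one]

theorem eLpNorm_top_le_of_forall_integral_le {h : V → ℂ} (hc : Continuous h) {A : ℝ} (hA : 0 ≤ A)
    (H : ∀ g : V → ℂ, Measurable g → Integrable g μ → (∃ C, ∀ x, ‖g x‖ ≤ C) →
      ‖∫ x, h x * g x ∂μ‖ ≤ A * ∫ x, ‖g x‖ ∂μ) :
    eLpNorm h ⊤ μ ≤ ENNReal.ofReal A := by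
  have hae : ∀ᵐ x ∂μ, ∀ N : ℕ, x ∈ Metric.closedBall (0 : V) N → ‖h x‖ ≤ A := by
    rw [ae_all_iff]
    intro N
    -- Testing with the conjugate of `h` on `S` gives `∫_S (‖h‖² - A ‖h‖) ≤ 0`, while the integrand
    -- is positive there; hence `S` is null.
    set S : Set V := Metric.closedBall 0 (N : ℝ) ∩ {x | A < ‖h x‖}
    have hB : IsCompact (Metric.closedBall (0 : V) (N : ℝ)) := isCompact_closedBall _ _
    have hSm : MeasurableSet S :=
      hB.measurableSet.inter (isOpen_lt continuous_const hc.norm).measurableSet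
    have hcc : Continuous fun x => starRingEnd ℂ (h x) := Complex.continuous_conj.comp hc
    obtain ⟨C, hC⟩ := hB.exists_bound_of_continuousOn hcc.continuousOn
    have hI : ∀ f : V → ℝ, Continuous f → IntegrableOn f S μ := fun f hf =>
      (hf.continuousOn.integrableOn_compact hB).mono_set Set.inter_subset_left
    have key := H (S.indicator fun x => starRingEnd ℂ (h x)) (hcc.measurable.indicator hSm)
      (((hcc.continuousOn.integrableOn_compact hB).mono_set
        Set.inter_subset_left).integrable_indicator hSm)
      ⟨max C 0, fun x => by
        by_cases hx : x ∈ S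
        · rw [Set.indicator_of_mem hx]; exact (hC x hx.1).trans (le_max_left _ _)
        · rw [Set.indicator_of_notMem hx, norm_zero]; exact le_max_right _ _⟩
    have e1 : ∫ x, h x * S.indicator (fun x => starRingEnd ℂ (h x)) x ∂μ =
        ((∫ x in S, ‖h x‖ ^ 2 ∂μ : ℝ) : ℂ) := by
      rw [← integral_indicator hSm, ← integral_complex_ofReal]
      congr 1; ext x
      by_cases hx : x ∈ S
      · rw [Set.indicator_of_mem hx, Set.indicator_of_mem hx, Complex.mul_conj,
          Complex.normSq_eq_norm_sq]
      · rw [Set.indicator_of_notMem hx, Set.indicator_of_notMem hx, mul_zero, Complex.ofReal_zero]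
    have e2 : ∫ x, ‖S.indicator (fun x => starRingEnd ℂ (h x)) x‖ ∂μ = ∫ x in S, ‖h x‖ ∂μ := by
      rw [← integral_indicator hSm]
      congr 1; ext x
      by_cases hx : x ∈ S
      · rw [Set.indicator_of_mem hx, Set.indicator_of_mem hx, RCLike.norm_conj]
      · rw [Set.indicator_of_notMem hx, Set.indicator_of_notMem hx, norm_zero]
    rw [e1, e2, Complex.norm_real, Real.norm_of_nonneg (integral_nonneg fun x => by positivity),
      ← integral_const_mul, ← sub_nonpos, ← integral_sub (hI _ (by fun_prop)) (hI _ (by fun_prop))]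
      at key
    have hnn : 0 ≤ᵐ[μ.restrict S] fun x => ‖h x‖ ^ 2 - A * ‖h x‖ := by
      filter_upwards [ae_restrict_mem hSm] with x hx
      have h1 : A < ‖h x‖ := hx.2
      have h2 := norm_nonneg (h x)
      simp only [Pi.zero_apply]
      nlinarith
    have hz := (integral_eq_zero_iff_of_nonneg_ae hnn
      ((hI _ (by fun_prop)).sub (hI _ (by fun_prop)))).1
      (le_antisymm key (integral_nonneg_of_ae hnn))
    filter_upwards [(ae_restrict_iff' hSm).1 hz] with x hx hxB
    by_contra hlt
    have h1 : A < ‖h x‖ := not_le.1 hlt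
    have h2 := hx ⟨hxB, h1⟩
    simp only [Pi.zero_apply] at h2
    nlinarith
  have : ∀ᵐ x ∂μ, ‖h x‖ ≤ A := by
    filter_upwards [hae] with x hx
    obtain ⟨N, hN⟩ := exists_nat_ge ‖x‖
    exact hx N (by simpa using hN)
  rw [eLpNorm_exponent_top]
  exact eLpNormEssSup_le_of_ae_bound this

end

/-- Two uses of the multiplication formula move the multiplier from the test function to `F`, so on
integrable functions the operator yields the continuous function `𝓕⁻ (w 𝓕 F)`. -/
theorem fourierMultiplierCLM_toTemperedDistribution_apply {d : ℕ}
    {w : EuclideanSpace ℝ (Fin d) → ℂ} (hw : w.HasTemperateGrowth) (hwi : Integrable w)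
    {p : ℝ≥0∞} [Fact (1 ≤ p)] {F : Lp ℂ p (volume : Measure (EuclideanSpace ℝ (Fin d)))}
    (hF : Integrable F) (φ : 𝓢(EuclideanSpace ℝ (Fin d), ℂ)) :
    TemperedDistribution.fourierMultiplierCLM ℂ w (Lp.toTemperedDistribution F) φ =
      ∫ x, φ x * 𝓕⁻ (fun η => w η * 𝓕 (F : EuclideanSpace ℝ (Fin d) → ℂ) η) x := by
  rw [TemperedDistribution.fourierMultiplierCLM_apply_apply, Lp.toTemperedDistribution_apply]
  simp only [smul_eq_mul]
  have e : ∀ η, (SchwartzMap.smulLeftCLM ℂ w (𝓕⁻ φ) : 𝓢(EuclideanSpace ℝ (Fin d), ℂ)) η =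
      w η * 𝓕⁻ (φ : EuclideanSpace ℝ (Fin d) → ℂ) η := fun η => by
    rw [SchwartzMap.smulLeftCLM_apply_apply hw, SchwartzMap.fourierInv_coe, smul_eq_mul]
  rw [SchwartzMap.fourier_coe, integral_fourier_mul_eq_flip (SchwartzMap.integrable _) hF]
  simp only [e]
  rw [← integral_fourierInv_mul_eq_flip φ.integrable (integrable_mul_fourier hwi hF)]
  congr 1; ext η
  ring

/-- An operator on tempered distributions that is bounded on a dense subgroup of `L^p` is
bounded on `L^p`. -/
theorem lpLqBound_of_dense {d : ℕ}
    {T : 𝓢'(EuclideanSpace ℝ (Fin d), ℂ) →L[ℂ] 𝓢'(EuclideanSpace ℝ (Fin d), ℂ)}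
    {p q : ℝ≥0∞} [Fact (1 ≤ p)] [Fact (1 ≤ q)] {A : ℝ} (hA : 0 ≤ A)
    {S : AddSubgroup (Lp ℂ p (volume : Measure (EuclideanSpace ℝ (Fin d))))}
    (hS : Dense (S : Set (Lp ℂ p (volume : Measure (EuclideanSpace ℝ (Fin d))))))
    (h : ∀ f ∈ S, ∃ g : Lp ℂ q (volume : Measure (EuclideanSpace ℝ (Fin d))),
      T (Lp.toTemperedDistribution f) = Lp.toTemperedDistribution g ∧ ‖g‖ ≤ A * ‖f‖) :
    LpLqBound T p q A := by
  intro f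
  obtain ⟨u, huS, hu⟩ := mem_closure_iff_seq_limit.1 (hS f)
  choose g hg hgA using fun j => h (u j) (huS j)
  set Λp := Lp.toTemperedDistributionCLM ℂ (volume : Measure (EuclideanSpace ℝ (Fin d))) p with hΛp
  set Λq := Lp.toTemperedDistributionCLM ℂ (volume : Measure (EuclideanSpace ℝ (Fin d))) q with hΛq
  -- Injectivity identifies the function representing `T (u i - u j)` with `g i - g j`, so the bound
  -- on `S` makes `g` a Cauchy sequence.
  have hinj : Function.Injective Λq :=
    LinearMap.ker_eq_bot.1 Lp.ker_toTemperedDistributionCLM_eq_bot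
  have hg' : ∀ j, T (Λp (u j)) = Λq (g j) := hg
  have hdist : ∀ i j, dist (g i) (g j) ≤ A * dist (u i) (u j) := by
    intro i j
    obtain ⟨g', hg1, hg2⟩ := h (u i - u j) (S.sub_mem (huS i) (huS j))
    have e : Λq g' = Λq (g i - g j) := by
      have hg1' : T (Λp (u i - u j)) = Λq g' := hg1
      rw [← hg1', map_sub, map_sub, map_sub, hg', hg']
    rw [dist_eq_norm, dist_eq_norm, ← hinj e]
    exact hg2
  have hcauchy : CauchySeq g := by
    have hu' : CauchySeq u := hu.cauchySeq
    rw [Metric.cauchySeq_iff'] at hu' ⊢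
    intro ε hε
    obtain ⟨N, hN⟩ := hu' (ε / (A + 1)) (by positivity)
    refine ⟨N, fun j hj => (hdist j N).trans_lt ?_⟩
    have h1 := hN j hj
    rw [lt_div_iff₀ (by positivity)] at h1
    have := dist_nonneg (x := u j) (y := u N)
    nlinarith
  obtain ⟨G, hG⟩ := cauchySeq_tendsto_of_complete hcauchy
  refine ⟨G, ?_, le_of_tendsto_of_tendsto' hG.norm (hu.norm.const_mul A) hgA⟩
  ext φ
  have h1 : Filter.Tendsto (fun j => T (Λp (u j)) φ) Filter.atTop (nhds (T (Λp f) φ)) :=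
    (((PointwiseConvergenceCLM.evalCLM (RingHom.id ℂ) ℂ φ).continuous.comp
      (T.continuous.comp Λp.continuous)).tendsto f).comp hu
  have h2 : Filter.Tendsto (fun j => Λq (g j) φ) Filter.atTop (nhds (Λq G φ)) :=
    (((PointwiseConvergenceCLM.evalCLM (RingHom.id ℂ) ℂ φ).continuous.comp
      Λq.continuous).tendsto G).comp hG
  simp only [hg'] at h1
  exact tendsto_nhds_unique h1 h2

theorem norm_lp_eq_integral {d : ℕ} {p : ℝ≥0∞} (hp0 : p ≠ 0) (hp : p ≠ ⊤)
    (F : Lp ℂ p (volume : Measure (EuclideanSpace ℝ (Fin d)))) :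
    ‖F‖ = (∫ x, ‖F x‖ ^ p.toReal) ^ (1 / p.toReal) := by
  rw [Lp.norm_def, (Lp.memLp F).eLpNorm_eq_integral_rpow_norm hp0 hp, ENNReal.toReal_ofReal
    (by positivity), one_div]

/-- A bound for the form of a multiplier gives a bound for the multiplier operator. -/
theorem lpLqBound_of_multForm {d : ℕ} {w : EuclideanSpace ℝ (Fin d) → ℂ}
    (hw : w.HasTemperateGrowth) (hwi : Integrable w) {p q : ℝ≥0∞} [hp1 : Fact (1 ≤ p)]
    [hq1 : Fact (1 ≤ q)] (hp : p ≠ ⊤) (hq : q⁻¹.toReal ≤ 1 / 2) {s : ℝ}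
    (hs : 1 / s = 1 - q⁻¹.toReal) {A : ℝ} (hA : 0 ≤ A)
    (H : ∀ f g : EuclideanSpace ℝ (Fin d) → ℂ, Measurable f → Measurable g → Integrable f →
      Integrable g → (∃ C, ∀ x, ‖f x‖ ≤ C) → (∃ C, ∀ x, ‖g x‖ ≤ C) →
      ‖multForm w f g‖ ≤ A * (∫ x, ‖f x‖ ^ p.toReal) ^ (1 / p.toReal) *
        (∫ x, ‖g x‖ ^ s) ^ (1 / s)) :
    LpLqBound (TemperedDistribution.fourierMultiplierCLM ℂ w) p q A := by
  have hp0 : p ≠ 0 := fun h => by simpa [h] using hp1.out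
  have hq0 : q ≠ 0 := fun h => by simpa [h] using hq1.out
  -- For `p < ∞` the simple functions in `L^p` are dense, and they are bounded and integrable, hence
  -- within reach of the form bound.
  refine lpLqBound_of_dense hA (Lp.simpleFunc.dense hp) fun F hF => ?_
  set f := Lp.simpleFunc.toSimpleFunc (⟨F, hF⟩ : Lp.simpleFunc ℂ p volume) with hf
  have hfF : f =ᵐ[volume] F := Lp.simpleFunc.toSimpleFunc_eq_toFun ⟨F, hF⟩
  have hfi : Integrable f := (SimpleFunc.memLp_iff_integrable hp0 hp).1
    (Lp.simpleFunc.memLp (⟨F, hF⟩ : Lp.simpleFunc ℂ p volume))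
  have hFi : Integrable F := hfi.congr hfF
  set h : EuclideanSpace ℝ (Fin d) → ℂ := 𝓕⁻ (fun η => w η * 𝓕 (f : EuclideanSpace ℝ (Fin d) → ℂ) η) with hh
  have hhc : Continuous h := continuous_fourierInv_of_integrable (integrable_mul_fourier hwi hfi)
  have hfou : 𝓕 (F : EuclideanSpace ℝ (Fin d) → ℂ) = 𝓕 (f : EuclideanSpace ℝ (Fin d) → ℂ) := by
    ext ξ
    rw [Real.fourier_eq, Real.fourier_eq]
    refine integral_congr_ae ?_
    filter_upwards [hfF] with x hx
    rw [hx]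
  have hnorm : ‖F‖ = (∫ x, ‖f x‖ ^ p.toReal) ^ (1 / p.toReal) := by
    rw [norm_lp_eq_integral hp0 hp]
    congr 1
    refine integral_congr_ae ?_
    filter_upwards [hfF] with x hx
    rw [hx]
  have hpair : ∀ g : EuclideanSpace ℝ (Fin d) → ℂ, Measurable g → Integrable g →
      (∃ C, ∀ x, ‖g x‖ ≤ C) → ‖∫ x, h x * g x‖ ≤ A * ‖F‖ * (∫ x, ‖g x‖ ^ s) ^ (1 / s) := by
    intro g hgm hg hgb
    have := H f g f.measurable hgm hfi hg f.exists_forall_norm_le hgb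
    rw [multForm_eq_integral hwi hfi hg] at this
    simp_rw [integral_fourierInv_sub_mul hwi hfi] at this
    rwa [hnorm]
  have hle : eLpNorm h q volume ≤ ENNReal.ofReal (A * ‖F‖) := by
    by_cases hqt : q = ⊤
    · subst hqt
      refine eLpNorm_top_le_of_forall_integral_le hhc (by positivity) fun g hgm hg hgb => ?_
      have hs1 : s = 1 := by
        simp only [ENNReal.inv_top, ENNReal.toReal_zero, sub_zero] at hs
        rw [one_div, inv_eq_one] at hs
        exact hs
      simpa [hs1] using hpair g hgm hg hgb
    · have hq' : 0 < q.toReal := ENNReal.toReal_pos hq0 hqt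
      rw [ENNReal.toReal_inv] at hq hs
      rw [← ENNReal.ofReal_toReal hqt]
      refine eLpNorm_le_of_forall_integral_le hhc (by positivity) (s := s) ?_ ?_ hpair
      · rw [inv_le_comm₀ hq' (by norm_num)] at hq
        linarith
      · rw [hs, one_div]; ring
  have hmem : MemLp h q := ⟨hhc.aestronglyMeasurable, hle.trans_lt ENNReal.ofReal_lt_top⟩
  refine ⟨hmem.toLp h, ?_, ?_⟩
  · ext φ
    rw [fourierMultiplierCLM_toTemperedDistribution_apply hw hwi hFi,
      Lp.toTemperedDistribution_apply, hfou]
    refine integral_congr_ae ?_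
    filter_upwards [hmem.coeFn_toLp] with x hx
    rw [hx, smul_eq_mul]
  · rw [Lp.norm_toLp]
    exact ENNReal.toReal_le_of_le_ofReal (by positivity) hle

/-! ### Interpolation between the endpoints, with constants uniform in `p`. -/

section

variable {n : ℕ}

/-- Removes `p` from the interpolated constant. -/
theorem rpow_mul_rpow_le_max {A₁ A₂ θ : ℝ} (h₁ : 0 < A₁) (h₂ : 0 < A₂) (hθ0 : 0 ≤ θ)
    (hθ1 : θ ≤ 1) : A₁ ^ (1 - θ) * A₂ ^ θ ≤ max A₁ A₂ := by
  have hm : 0 < max A₁ A₂ := lt_max_of_lt_left h₁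
  calc A₁ ^ (1 - θ) * A₂ ^ θ ≤ max A₁ A₂ ^ (1 - θ) * max A₁ A₂ ^ θ := by
        gcongr
        · exact le_max_left _ _
        · exact le_max_right _ _
    _ = max A₁ A₂ := by
        rw [← Real.rpow_add hm, sub_add_cancel, Real.rpow_one]

namespace Admissible

variable {k : ℕ} {χ : EuclideanSpace ℝ (Fin (n + 1)) → ℂ}
  {m : EuclideanSpace ℝ (Fin (n + 1)) → ℝ} {ψ : 𝓢(ℝ, ℂ)} {a : ℝ}

/-- Interpolates the kernel bound at `p = 1` with the TT* bound at `p = 2`, at `θ = 2 - 2 / p`. With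
`1 - 1 / s` in the role of `1 / q`, the powers of `B` combine to `1 / p - 1 / q`, and those of
`lam`, namely `1 + N / 2` and `1 / 2`, to `(N + 1) / p - N / 2`. -/
theorem exists_multForm_bound (h : Admissible k χ m ψ a) {b : ℝ} (hb0 : 0 < b)
    (hb : ∀ s, |s| < b → 𝓕⁻ (ψ : ℝ → ℂ) s = 0) {N : ℝ} (hN : 0 < N) : ∃ A : ℝ, 0 < A ∧
    ∀ ρ lam B : ℝ, 0 < lam → 0 < B →
      (∀ t : ℝ, t ≠ 0 → ∀ x : EuclideanSpace ℝ (Fin (n + 1)),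
        ‖regKernel k ρ t 0 x‖ ≤ B * |t| ^ (-(N / 2))) →
      ∀ p s : ℝ, 1 ≤ p → p ≤ 2 → 1 / s = 1 - N / (N + 2) * (1 - 1 / p) →
      ∀ f g : EuclideanSpace ℝ (Fin (n + 2)) → ℂ, Measurable f → Measurable g → Integrable f →
        Integrable g → (∃ C, ∀ x, ‖f x‖ ≤ C) → (∃ C, ∀ x, ‖g x‖ ≤ C) →
        ‖multForm (symbol k χ m ψ ρ lam) f g‖ ≤
          A * (B ^ (1 / p - (1 - 1 / s)) * lam ^ ((N + 1) * (1 / p) - N / 2)) *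
            (∫ x, ‖f x‖ ^ p) ^ (1 / p) * (∫ x, ‖g x‖ ^ s) ^ (1 / s) := by
  obtain ⟨A₁, hA₁, H₁⟩ := h.exists_kernel_bound hb0 hb hN.le
  obtain ⟨A₂, hA₂, H₂⟩ := h.exists_multForm_bound_two hN rfl rfl
  refine ⟨max A₁ A₂, lt_max_of_lt_left hA₁,
    fun ρ lam B hlam hB hK p s hp1 hp2 hs f g hfm hgm hf hg hfb hgb => ?_⟩
  have hp0 : 0 < p := by linarith
  have hx1 : 1 / p ≤ 1 := by rw [div_le_one hp0]; exact hp1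
  have hx2 : 1 / 2 ≤ 1 / p := one_div_le_one_div_of_le hp0 hp2
  set x := 1 / p with hx
  set α := N / (N + 2) with hα
  have hα0 : 0 < α := by positivity
  have hα1 : α < 1 := by rw [hα, div_lt_one (by positivity)]; linarith
  have h2α : 0 < 2 - α := by linarith
  have hr1 : 1 ≤ 2 / (2 - α) := by rw [le_div_iff₀ h2α]; linarith
  have hαx : α * (1 - x) ≤ 1 / 2 := by nlinarith
  have hαx0 : 0 ≤ α * (1 - x) := mul_nonneg hα0.le (by linarith)
  have hs0 : 0 < s := by
    rw [← one_div_pos, hs]; linarith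
  have hs1 : 1 ≤ s := by
    rw [← div_le_one hs0, hs]; linarith
  have hbil := isBoundedBilin_multForm (h.integrable_symbol ρ hlam) (H₁ ρ lam B hlam hB.le hK)
  have key := hbil.riesz_thorin (by positivity) (p₁ := 2) (r₁ := 2 / (2 - α)) (p := p) (r := s)
    (θ := 2 - 2 * x) (M₁ := A₂ * (lam ^ (1 / 2 : ℝ) * B ^ ((1 - α) / 2))) (by norm_num)
    hr1 (by positivity) (fun f g hf hg => H₂ ρ lam B hlam hB.le hK f g hf
      ((SimpleFunc.memLp_iff_integrable (by norm_num) (by norm_num)).2 hf)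
      g.measurable hg g.exists_forall_norm_le)
    hp1 hs1 (by linarith) (by linarith) (by rw [← hx]; ring)
    (by rw [hs]; field_simp; ring) hfm hgm hf hg hfb hgb
  refine key.trans ?_
  have e : (A₁ * (B * lam ^ (1 + N / 2))) ^ (1 - (2 - 2 * x)) *
      (A₂ * (lam ^ (1 / 2 : ℝ) * B ^ ((1 - α) / 2))) ^ (2 - 2 * x) =
      A₁ ^ (1 - (2 - 2 * x)) * A₂ ^ (2 - 2 * x) *
        (B ^ (x - (1 - 1 / s)) * lam ^ ((N + 1) * x - N / 2)) := by
    rw [Real.mul_rpow hA₁.le (by positivity), Real.mul_rpow hB.le (by positivity),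
      Real.mul_rpow hA₂.le (by positivity), Real.mul_rpow (by positivity) (by positivity),
      ← Real.rpow_mul hlam.le, ← Real.rpow_mul hlam.le, ← Real.rpow_mul hB.le,
      show x - (1 - 1 / s) = (1 - (2 - 2 * x)) + (1 - α) / 2 * (2 - 2 * x) by rw [hs]; ring,
      show (N + 1) * x - N / 2 = (1 + N / 2) * (1 - (2 - 2 * x)) + 1 / 2 * (2 - 2 * x) by ring,
      Real.rpow_add hB, Real.rpow_add hlam]
    ring
  rw [e]
  gcongr
  exact rpow_mul_rpow_le_max hA₁ hA₂ (by linarith) (by linarith)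

theorem exists_lpLqBound (h : Admissible k χ m ψ a) {b : ℝ} (hb0 : 0 < b)
    (hb : ∀ s, |s| < b → 𝓕⁻ (ψ : ℝ → ℂ) s = 0) {N : ℝ} (hN : 0 < N) : ∃ A : ℝ, 0 < A ∧
    ∀ ρ lam B : ℝ, 0 < lam → 0 < B →
      (∀ t : ℝ, t ≠ 0 → ∀ x : EuclideanSpace ℝ (Fin (n + 1)),
        ‖regKernel k ρ t 0 x‖ ≤ B * |t| ^ (-(N / 2))) →
      ∀ (p q : ℝ≥0∞) [Fact (1 ≤ p)] [Fact (1 ≤ q)], p ≤ 2 →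
        q⁻¹.toReal = N / (N + 2) * (1 - p⁻¹.toReal) →
        LpLqBound (multOp k χ m ψ ρ lam) p q
          (A * (B ^ (p⁻¹.toReal - q⁻¹.toReal) * lam ^ ((N + 1) * p⁻¹.toReal - N / 2))) := by
  obtain ⟨A, hA, H⟩ := h.exists_multForm_bound hb0 hb hN
  refine ⟨A, hA, fun ρ lam B hlam hB hK p q hp1 hq1 hp2 hpq => ?_⟩
  have hpt : p ≠ ⊤ := (hp2.trans_lt (by norm_num)).ne
  have hP1 : 1 ≤ p.toReal := by
    have := ENNReal.toReal_mono hpt hp1.out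
    simpa using this
  have hP2 : p.toReal ≤ 2 := by
    have := ENNReal.toReal_mono (by norm_num) hp2
    simpa using this
  have hx : p⁻¹.toReal = 1 / p.toReal := by rw [ENNReal.toReal_inv, one_div]
  have hx2 : 1 / 2 ≤ 1 / p.toReal := one_div_le_one_div_of_le (by linarith) hP2
  have hα1 : N / (N + 2) ≤ 1 := by rw [div_le_one (by positivity)]; linarith
  have hα0 : 0 < N / (N + 2) := by positivity
  have hs : 1 / (1 - q⁻¹.toReal)⁻¹ = 1 - q⁻¹.toReal := by rw [one_div, inv_inv]
  have key := H ρ lam B hlam hB hK p.toReal (1 - q⁻¹.toReal)⁻¹ hP1 hP2 (by rw [hs, hpq, hx])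
  rw [hs, ← hx, sub_sub_cancel] at key
  refine lpLqBound_of_multForm (s := (1 - q⁻¹.toReal)⁻¹)
    (hasTemperateGrowth_symbol h.smooth h.support h.smooth_weight ψ ρ lam)
    (h.integrable_symbol ρ hlam) hpt ?_ hs (by positivity) ?_
  · rw [hpq, hx]; nlinarith
  · rwa [hs, ← hx]

end Admissible

/-- The input with `N = n = d - 2` and `B` independent of `ρ`, for part (ii). -/
theorem norm_regKernel_zero_le_rpow (k : ℕ) {ρ t : ℝ} (ht : t ≠ 0)
    (x : EuclideanSpace ℝ (Fin (n + 1))) :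
    ‖regKernel k ρ t 0 x‖ ≤ √2 ^ n * |t| ^ (-((n : ℝ) / 2)) := by
  have ht0 : 0 < |t| := abs_pos.2 ht
  refine (norm_regKernel_le k ρ ht le_rfl x).trans (le_of_eq ?_)
  rw [Real.sqrt_div zero_le_two, div_pow, div_eq_mul_inv, Real.rpow_neg ht0.le, Real.sqrt_eq_rpow |t|,
    ← Real.rpow_natCast, ← Real.rpow_natCast (|t| ^ (1 / 2 : ℝ)), ← Real.rpow_mul ht0.le]
  congr 3; ring

/-- The input with `N = n + 1 = d - 1` and `B` proportional to `|ρ|^{-1/2}`, for part (i). -/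
theorem norm_regKernel_zero_le_rpow_of_ne_zero (k : ℕ) {ρ t : ℝ} (ht : t ≠ 0) (hρ : ρ ≠ 0)
    (x : EuclideanSpace ℝ (Fin (n + 1))) :
    ‖regKernel k ρ t 0 x‖ ≤ 40 * ((n + 1) * 2 ^ n) * |ρ| ^ (-(1 / 2 : ℝ)) *
      |t| ^ (-(((n : ℝ) + 1) / 2)) := by
  have ht0 : 0 < |t| := abs_pos.2 ht
  have hρ0 : 0 < |ρ| := abs_pos.2 hρ
  refine (norm_regKernel_zero_le k ρ ht hρ x).trans (le_of_eq ?_)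
  rw [Real.sqrt_div zero_le_one, Real.sqrt_one, one_div, inv_pow, abs_mul,
    Real.sqrt_mul (abs_nonneg t), Real.rpow_neg hρ0.le, Real.rpow_neg ht0.le, add_div,
    Real.rpow_add ht0, Real.sqrt_eq_rpow |t|, Real.sqrt_eq_rpow |ρ|,
    ← Real.rpow_natCast (|t| ^ (1 / 2 : ℝ)), ← Real.rpow_mul ht0.le,
    show 1 / 2 * (n : ℝ) = (n : ℝ) / 2 by ring]
  field_simp

theorem rpow_le_max_one {c θ : ℝ} (hc : 0 < c) (h0 : 0 ≤ θ) (h1 : θ ≤ 1) : c ^ θ ≤ max 1 c := by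
  have := rpow_mul_rpow_le_max one_pos hc h0 h1
  rwa [Real.one_rpow, one_mul] at this

end

section

variable {n : ℕ}

theorem LpLqBound.mono {d : ℕ}
    {T : 𝓢'(EuclideanSpace ℝ (Fin d), ℂ) →L[ℂ] 𝓢'(EuclideanSpace ℝ (Fin d), ℂ)}
    {p q : ℝ≥0∞} [Fact (1 ≤ p)] [Fact (1 ≤ q)] {A A' : ℝ} (h : LpLqBound T p q A)
    (hA : A ≤ A') : LpLqBound T p q A' := fun f => by
  obtain ⟨g, hg, hgA⟩ := h f
  exact ⟨g, hg, hgA.trans (mul_le_mul_of_nonneg_right hA (norm_nonneg _))⟩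

theorem fourierInv_eq_zero_of_tsupport {ψ : 𝓢(ℝ, ℂ)}
    (hψ : tsupport (𝓕 ψ : 𝓢(ℝ, ℂ)) ⊆ Set.Icc (-2 : ℝ) (-1 / 2) ∪ Set.Icc (1 / 2 : ℝ) 2)
    {s : ℝ} (hs : 2 < |s| ∨ |s| < 1 / 2) : 𝓕⁻ (ψ : ℝ → ℂ) s = 0 := by
  rw [Real.fourierInv_eq_fourier_neg, ← SchwartzMap.fourier_coe]
  refine image_eq_zero_of_notMem_tsupport fun hmem => ?_
  rcases hψ hmem with ⟨h1, h2⟩ | ⟨h1, h2⟩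
  · rw [abs_of_pos (by linarith)] at hs
    rcases hs with hs | hs <;> linarith
  · rw [abs_of_neg (by linarith)] at hs
    rcases hs with hs | hs <;> linarith

/-- As `p ≤ 2`, `y ≤ 1/2 ≤ 1/p`. The exponent `1/p - 1/q` of `B` therefore stays in `[0, 1]`, and
the numerical part of `B` is absorbed into a constant independent of `p`. -/
theorem exponent_bounds {p : ℝ≥0∞} [hp1 : Fact (1 ≤ p)] (hp2 : p ≤ 2) {y c : ℝ} (hc0 : 0 ≤ c)
    (hc1 : c ≤ 1) (hy : y = c * (1 - p⁻¹.toReal)) :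
    0 ≤ p⁻¹.toReal - y ∧ p⁻¹.toReal - y ≤ 1 := by
  have h1 : p⁻¹.toReal ≤ 1 := by
    have := ENNReal.toReal_mono (by norm_num) (ENNReal.inv_le_one.2 hp1.out)
    simpa using this
  have h2 : 1 / 2 ≤ p⁻¹.toReal := by
    have hp0 : p ≠ 0 := fun h => by simpa [h] using hp1.out
    have := ENNReal.toReal_mono (ENNReal.inv_ne_top.2 hp0) (ENNReal.inv_le_inv.2 hp2)
    simpa using this
  rw [hy]
  have h3 : 0 ≤ c * (1 - p⁻¹.toReal) := mul_nonneg hc0 (by linarith)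
  constructor <;> nlinarith

end

end GraphMultiplier

/-! ### The theorem. -/

open GraphMultiplier in
theorem mainTheorem6 (n k : ℕ) (hn : 1 ≤ n) (hk : 1 ≤ k) (hkn : k ≤ n + 1)
    (d : ℝ) (hd : d = (n : ℝ) + 2)
    (χ : EuclideanSpace ℝ (Fin (n + 1)) → ℂ) (hχ : ContDiff ℝ ∞ χ)
    (hχD : tsupport χ ⊆ domainD k)
    (m : EuclideanSpace ℝ (Fin (n + 1)) → ℝ) (hm : ContDiffOn ℝ ∞ m (domainD k))
    (hmD : ∀ t ∈ domainD k, 1 / 2 ≤ m t ∧ m t ≤ 2)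
    (ψ : 𝓢(ℝ, ℂ))
    (hψ : tsupport (𝓕 ψ : 𝓢(ℝ, ℂ)) ⊆ Set.Icc (-2 : ℝ) (-1 / 2) ∪ Set.Icc (1 / 2 : ℝ) 2)
    (R : ℝ) :
    (∀ ρ lam : ℝ, 0 < lam →
      (symbol k χ m ψ ρ lam).HasTemperateGrowth) ∧
    ∃ C : ℝ, 0 < C ∧
      ∀ ρ lam : ℝ, 0 < lam → 0 < |ρ| → |ρ| ≤ R →
        ∀ (p q : ℝ≥0∞) [Fact (1 ≤ p)] [Fact (1 ≤ q)], p ≤ 2 →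
          (q⁻¹.toReal = (d - 1) / (d + 1) * (1 - p⁻¹.toReal) →
            LpLqBound (multOp k χ m ψ ρ lam) p q
              (C * |ρ| ^ (-(1 / 2 : ℝ) * (p⁻¹.toReal - q⁻¹.toReal))
                * lam ^ (d * p⁻¹.toReal - (d - 1) / 2))) ∧
          (q⁻¹.toReal = (d - 2) / d * (1 - p⁻¹.toReal) →
            LpLqBound (multOp k χ m ψ ρ lam) p q
              (C * lam ^ ((d - 1) * p⁻¹.toReal - (d - 2) / 2))) := by
  refine ⟨fun ρ lam _ => hasTemperateGrowth_symbol hχ hχD hm ψ ρ lam, ?_⟩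
  have h : Admissible k χ m ψ 2 :=
    ⟨hχ, hχD, hm, hmD, fun s hs => fourierInv_eq_zero_of_tsupport hψ (Or.inl hs)⟩
  have hb : ∀ s, |s| < 1 / 2 → 𝓕⁻ (ψ : ℝ → ℂ) s = 0 :=
    fun s hs => fourierInv_eq_zero_of_tsupport hψ (Or.inr hs)
  have hn' : (1 : ℝ) ≤ n := by exact_mod_cast hn
  -- `N / (N + 2)` equals `(d - 1) / (d + 1)` for `N = n + 1` and `(d - 2) / d` for `N = n`, the
  -- slopes in (i) and (ii).
  obtain ⟨A₁, hA₁, H₁⟩ := h.exists_lpLqBound (by norm_num) hb (N := (n : ℝ) + 1) (by positivity)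
  obtain ⟨A₂, hA₂, H₂⟩ := h.exists_lpLqBound (by norm_num) hb (N := (n : ℝ)) (by positivity)
  set c₁ : ℝ := 40 * ((n + 1) * 2 ^ n)
  set c₂ : ℝ := √2 ^ n
  have hc₁ : 0 < c₁ := by positivity
  have hc₂ : 0 < c₂ := by positivity
  refine ⟨max (A₁ * max 1 c₁) (A₂ * max 1 c₂), lt_max_of_lt_left (by positivity),
    fun ρ lam hlam hρ _ p q _ _ hp => ⟨fun hpq => ?_, fun hpq => ?_⟩⟩
  · have hpq' : q⁻¹.toReal = ((n : ℝ) + 1) / ((n : ℝ) + 1 + 2) * (1 - p⁻¹.toReal) := by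
      rw [hpq, hd]; congr 2 <;> ring
    refine (H₁ ρ lam (c₁ * |ρ| ^ (-(1 / 2 : ℝ))) hlam (by positivity)
      (fun t ht x => norm_regKernel_zero_le_rpow_of_ne_zero k ht (abs_pos.1 hρ) x) p q hp
      hpq').mono ?_
    obtain ⟨e0, e1⟩ := exponent_bounds hp (by positivity)
      ((div_le_one (by positivity)).2 (by linarith)) hpq'
    rw [Real.mul_rpow hc₁.le (by positivity), ← Real.rpow_mul (abs_nonneg ρ), hd,
      show (n : ℝ) + 2 - 1 = n + 1 by ring, show (n : ℝ) + 2 = n + 1 + 1 by ring]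
    calc _ = A₁ * c₁ ^ (p⁻¹.toReal - q⁻¹.toReal) *
          |ρ| ^ (-(1 / 2 : ℝ) * (p⁻¹.toReal - q⁻¹.toReal)) *
          lam ^ (((n : ℝ) + 1 + 1) * p⁻¹.toReal - (n + 1) / 2) := by ring
      _ ≤ _ := by
        gcongr
        exact (mul_le_mul_of_nonneg_left (rpow_le_max_one hc₁ e0 e1) hA₁.le).trans
          (le_max_left _ _)
  · have hpq' : q⁻¹.toReal = (n : ℝ) / ((n : ℝ) + 2) * (1 - p⁻¹.toReal) := by
      rw [hpq, hd]; congr 2; ring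
    refine (H₂ ρ lam c₂ hlam hc₂
      (fun t ht x => norm_regKernel_zero_le_rpow k ht x) p q hp hpq').mono ?_
    obtain ⟨e0, e1⟩ := exponent_bounds hp (by positivity)
      ((div_le_one (by positivity)).2 (by linarith)) hpq'
    rw [hd, show (n : ℝ) + 2 - 1 = n + 1 by ring, show (n : ℝ) + 2 - 2 = n by ring, ← mul_assoc]
    gcongr
    exact (mul_le_mul_of_nonneg_left (rpow_le_max_one hc₂ e0 e1) hA₂.le).trans
      (le_max_right _ _)
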